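/- Let $M$ be a smooth manifold with boundary $\mathcal I$, $\dim M=n+1$, and let $\hat g$ be a smooth Lorentzian metric on its interior. Fix a constant $\nu_0\neq 0$. A smooth chart $(\rho,y^\alpha)$ of $M$ with $\rho\ge 0$, and $\rho=0$ on $\mathcal I$, is called a *Beig–Schmidt chart* with coefficients $h_{\alpha\beta},k_{\alpha\beta},\sigma$ (smooth functions of $y$, with $h$ Lorentzian if $\nu_0>0$ and Riemannian if $\nu_0<0$) if in it $g=\rho^2\hat g$ satisfies, locally uniformly along $\mathcal I$, $$g_{\rho\rho}=\rho^{-2}\nu_0^{-1}\bigl(1+2\rho\sigma+\rho^2\sigma^2+O(\rho^3\ln\rho)\bigr),\quad g_{\rho\alpha}=O(\rho^2\ln\rho),\quad g_{\alpha\beta}=h_{\alpha\beta}+\rho\,(k_{\alpha\beta}-2\sigma h_{\alpha\beta})+O(\rho^2\ln\rho).$$ Assume that $M$ has a smooth boundary defining function $\rho$ (positive in the interior, zero on $\mathcal I$, $d\rho\ne0$ on $\mathcal I$) such that each point of $\mathcal I$ lies in the domain of a Beig–Schmidt chart $(\rho,y^\alpha)$ with this $\rho$ as first coordinate. Spi (if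 $\nu_0>0$) or Ti (if $\nu_0<0$) is the line bundle over $\mathcal I$ whose fibre over $p$ consists of the $2$-jets $j^2_p\rho+s\,j^2_p\rho^2$, $s\in\mathbb R$; $a\in\mathbb R$ acts on it by adding $a\,j^2_p\rho^2$. A *coordinate system* $(u,y^\alpha)$ on Spi/Ti consists of local coordinates $y^\alpha$ on $\mathcal I$ and a smooth fibre coordinate $u$ over their domain for which this action is $u\mapsto u+a$. A Beig–Schmidt chart $(\rho_1,y_1^\alpha)$ is *adapted* to $(u,y^\alpha)$ if on $\mathcal I$ one has $y_1^\alpha=y^\alpha$ and, for each boundary point $p$ of its domain, $j^2_p\rho_1$ is the point of the fibre over $p$ with $u=0$. **Proposition.** 1. For every coordinate system $(u,y^\alpha)$ on Spi/Ti, there is an adapted Beig–Schmidt chart around each point of $\mathcal I$ in the domain of $y$. It is unique up to third order: if $(\rho,y^\alpha)$ and $(\rho',y'^\alpha)$ are two adapted charts, then $\rho'-\rho=O(\rho^3)$ and $y'^\alpha-y^\alpha=O(\rho^3)$ near each boundary point of the common domain. 2. Let $(\rho_1,y_1^\alpha)$ and $(\rho_2,y_2^\alpha)$ be Beig–Schmidt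 charts adapted to $(u_1,y_1^\alpha)$ and $(u_2,y_2^\alpha)$, with coefficients $(h_1,k_1,\sigma_1)$ and $(h_2,k_2,\sigma_2)$, and let $\omega$ be a smooth function of $y_1$ on the boundary part of the common domain. Over the common domain, $$u_2=u_1+\omega\iff \rho_2=\rho_1-\omega\,\rho_1^2+O(\rho_1^3),$$ and if this holds, then at every boundary point of the common domain $h_1$ and $h_2$ are the same tensor $h$, $$k_{2\,\alpha\beta}\,dy_2^\alpha dy_2^\beta=\Bigl(k_{1\,\alpha\beta}-2\bigl(h_{\alpha\beta}\,\omega+\nu_0^{-1}D_\alpha D_\beta\,\omega\bigr)\Bigr)dy_1^\alpha dy_1^\beta,\qquad \sigma_2=\sigma_1,$$ where $D$ is the Levi-Civita connection of $h$. -/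

import Mathlib

open Set Filter Topology Asymptotics
open scoped Manifold ContDiff Matrix

noncomputable section

namespace ExtendedBoundary

/-! ### Tensor calculus on open subsets of `ℝⁿ` (components in coordinates) -/

/-- The model of the `n`-dimensional boundary. -/
abbrev E (n : ℕ) := EuclideanSpace ℝ (Fin n)

/-- The partial derivative `∂_α f`. -/
def pd {n : ℕ} (α : Fin n) (f : E n → ℝ) (y : E n) : ℝ :=
  fderiv ℝ f y (EuclideanSpace.single α 1)

/-- The Christoffel symbols `Γ^γ_{αβ} = ½ h^{γδ} (∂_α h_{δβ} + ∂_β h_{δα} - ∂_δ h_{αβ})`. -/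
def christoffel {n : ℕ} (h : E n → Matrix (Fin n) (Fin n) ℝ) (γ α β : Fin n) (y : E n) : ℝ :=
  (1 / 2) * ∑ δ, (h y)⁻¹ γ δ *
    (pd α (fun z => h z δ β) y + pd β (fun z => h z δ α) y - pd δ (fun z => h z α β) y)

/-- The covariant Hessian `D_α D_β w = ∂_α ∂_β w - Γ^γ_{αβ} ∂_γ w`. -/
def covHess {n : ℕ} (h : E n → Matrix (Fin n) (Fin n) ℝ) (w : E n → ℝ) (y : E n) :
    Matrix (Fin n) (Fin n) ℝ :=
  Matrix.of fun α β => pd α (pd β w) y - ∑ γ, christoffel h γ α β y * pd γ w y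

/-- The Jacobian matrix `∂θ^γ/∂y^α` (row `γ`, column `α`). -/
def jacobian {n : ℕ} (θ : E n → E n) (y : E n) : Matrix (Fin n) (Fin n) ℝ :=
  Matrix.of fun γ α => pd α (fun z => θ z γ) y

/-- A symmetric matrix of signature `(-, +, …, +)`. -/
def IsLorentzianMatrix {n : ℕ} (A : Matrix (Fin n) (Fin n) ℝ) : Prop :=
  ∃ P : Matrix (Fin n) (Fin n) ℝ, IsUnit P.det ∧
    Pᵀ * A * P = Matrix.diagonal fun i : Fin n => if (i : ℕ) = 0 then -1 else 1

/-! ### Manifolds with boundary -/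

variable {n : ℕ} {M : Type*} [TopologicalSpace M] [ChartedSpace (EuclideanHalfSpace (n + 1)) M]

variable (n M) in
/-- The boundary `𝓘` of `M`. -/
abbrev Bdry : Set M := (𝓡∂ (n + 1)).boundary M

variable (n M) in
/-- The interior of `M` (the physical spacetime). -/
abbrev Inn : Set M := (𝓡∂ (n + 1)).interior M

variable (n M) in
/-- A field of bilinear forms on the tangent spaces of `M`. -/
abbrev BilinField : Type _ :=
  ∀ x : M, TangentSpace (𝓡∂ (n + 1)) x →L[ℝ] TangentSpace (𝓡∂ (n + 1)) x →L[ℝ] ℝ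

/-- The first coordinate `ρ` of a chart `(ρ, y)` of `M` with values in the half space. -/
def rhoOf (φ : OpenPartialHomeomorph M (EuclideanHalfSpace (n + 1))) (x : M) : ℝ :=
  (φ x).1 0

/-- The last `n` coordinates `y` of a chart `(ρ, y)` of `M`. -/
def yOf (φ : OpenPartialHomeomorph M (EuclideanHalfSpace (n + 1))) (x : M) : E n :=
  WithLp.toLp 2 fun α => (φ x).1 α.succ

/-- The set of values of `y` at the boundary points of the domain of a chart `(ρ, y)`. -/
def bdryImage (φ : OpenPartialHomeomorph M (EuclideanHalfSpace (n + 1))) : Set (E n) :=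
  yOf φ '' (φ.source ∩ Bdry n M)

/-- The coordinate vector field `∂_i` of a chart: the vectors `∂_i` at `x` form the basis of the
tangent space dual to the differentials of the coordinates. -/
def coordVec (φ : OpenPartialHomeomorph M (EuclideanHalfSpace (n + 1))) (x : M)
    (i : Fin (n + 1)) : TangentSpace (𝓡∂ (n + 1)) x :=
  (mfderiv (𝓡∂ (n + 1)) 𝓘(ℝ, E (n + 1)) (φ.extend (𝓡∂ (n + 1))) x).inverse
    (EuclideanSpace.single i 1 : E (n + 1))

/-- The components `g_{ij}` of the rescaled metric `g = ρ² ĝ` in a chart `(ρ, y)`. -/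
def rescaled (ghat : BilinField n M) (φ : OpenPartialHomeomorph M (EuclideanHalfSpace (n + 1)))
    (i j : Fin (n + 1)) (x : M) : ℝ :=
  rhoOf φ x ^ 2 * ghat x (coordVec φ x i) (coordVec φ x j)

/-- A bilinear form of signature `(-, +, …, +)` at a point of the `(n+1)`-dimensional `M`. -/
def IsLorentzianAt (ghat : BilinField n M) (x : M) : Prop :=
  ∃ b : Module.Basis (Fin (n + 1)) ℝ (TangentSpace (𝓡∂ (n + 1)) x),
    ∀ i j, ghat x (b i) (b j) = if i = j then (if i = 0 then -1 else 1) else 0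

/-! ### Beig–Schmidt charts -/

/-- `φ = (ρ, y)` is a Beig–Schmidt chart for the physical metric `ĝ`, with coefficients
`h`, `k`, `σ`: it is a chart of the smooth manifold with boundary `M`, and in it `g = ρ² ĝ` satisfies
`g = ρ⁻² ν₀⁻¹ (1 + 2ρσ + ρ²σ² + O(ρ³ ln ρ)) dρ²`
`    + (h_{αβ} + ρ (k_{αβ} - 2σ h_{αβ}) + O(ρ² ln ρ)) dy^α dy^β`,
the components `g_{ρα}` being of the order of the remainders. The `O` are
locally uniform along the boundary. The metric `h` has Lorentzian signature if `ν₀ > 0` (space-like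
infinity) and is Riemannian if `ν₀ < 0` (past or future time-like infinity). -/
structure IsBeigSchmidt (ghat : BilinField n M) (ν₀ : ℝ)
    (φ : OpenPartialHomeomorph M (EuclideanHalfSpace (n + 1)))
    (h k : E n → Matrix (Fin n) (Fin n) ℝ) (σ : E n → ℝ) : Prop where
  mem_atlas : φ ∈ IsManifold.maximalAtlas (𝓡∂ (n + 1)) ∞ M
  smooth_h : ∀ α β, ContDiffOn ℝ ∞ (fun y => h y α β) (bdryImage φ)
  smooth_k : ∀ α β, ContDiffOn ℝ ∞ (fun y => k y α β) (bdryImage φ)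
  smooth_σ : ContDiffOn ℝ ∞ σ (bdryImage φ)
  signature : ∀ y ∈ bdryImage φ,
    (0 < ν₀ ∧ IsLorentzianMatrix (h y)) ∨ (ν₀ < 0 ∧ (h y).PosDef)
  expansion_rho_rho : ∀ q ∈ φ.source ∩ Bdry n M,
    (fun x => rhoOf φ x ^ 2 * rescaled ghat φ 0 0 x -
      ν₀⁻¹ * (1 + 2 * rhoOf φ x * σ (yOf φ x) + rhoOf φ x ^ 2 * σ (yOf φ x) ^ 2))
    =O[𝓝[Inn n M] q] fun x => rhoOf φ x ^ 3 * Real.log (rhoOf φ x)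
  expansion_rho_y : ∀ q ∈ φ.source ∩ Bdry n M, ∀ α : Fin n,
    (fun x => rescaled ghat φ 0 α.succ x)
    =O[𝓝[Inn n M] q] fun x => rhoOf φ x ^ 2 * Real.log (rhoOf φ x)
  expansion_y_y : ∀ q ∈ φ.source ∩ Bdry n M, ∀ α β : Fin n,
    (fun x => rescaled ghat φ α.succ β.succ x -
      (h (yOf φ x) α β + rhoOf φ x *
        (k (yOf φ x) α β - 2 * σ (yOf φ x) * h (yOf φ x) α β)))
    =O[𝓝[Inn n M] q] fun x => rhoOf φ x ^ 2 * Real.log (rhoOf φ x)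

/-! ### Two-jets -/

/-- The real functions on `M` that are smooth at `p`. -/
def SmoothAt (n : ℕ) {M : Type*} [TopologicalSpace M]
    [ChartedSpace (EuclideanHalfSpace (n + 1)) M] (p : M) : Submodule ℝ (M → ℝ) where
  carrier := {f | ContMDiffAt (𝓡∂ (n + 1)) 𝓘(ℝ, ℝ) ∞ (f : M → ℝ) p}
  add_mem' hf hg := ContMDiffAt.add hf hg
  zero_mem' := contMDiffAt_const
  smul_mem' c f hf := by
    have hc : ContMDiffAt (𝓡∂ (n + 1)) 𝓘(ℝ, ℝ) ∞ (fun _ : M => c) p := contMDiffAt_const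
    exact hc.smul hf

/-- The functions, smooth at `p`, that vanish to second order at `p`: `f = o(|x - p|²)` in a
chart. -/
def VanishToSecondOrder (p : M) : Submodule ℝ (SmoothAt n p) where
  carrier := {f | (f : M → ℝ) =o[𝓝 p]
    fun x => ‖extChartAt (𝓡∂ (n + 1)) p x - extChartAt (𝓡∂ (n + 1)) p p‖ ^ 2}
  add_mem' hf hg := IsLittleO.add hf hg
  zero_mem' := isLittleO_zero _ _
  smul_mem' c _ hf := IsLittleO.const_smul_left hf c

/-- The space `J²_p M` of two-jets at `p` of real functions on `M`. -/
abbrev Jet2 (p : M) : Type _ := SmoothAt n p ⧸ VanishToSecondOrder (n := n) p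

/-- The two-jet at `p` of a function that is smooth at `p`. -/
def jet2 (p : M) (f : M → ℝ) (hf : ContMDiffAt (𝓡∂ (n + 1)) 𝓘(ℝ, ℝ) ∞ f p) :
    Jet2 (n := n) p :=
  Submodule.Quotient.mk ⟨f, hf⟩

variable [IsManifold (𝓡∂ (n + 1)) ∞ M]

variable (n M) in
/-- A spacetime, realised as the interior of a manifold with boundary `M`, that is asymptotically
flat at spatial infinity (`ν₀ > 0`) or at past/future time-like infinity (`ν₀ < 0`): there is a
boundary defining function `ρ` such that the metric has a Beig–Schmidt
expansion in a chart `(ρ, y)` around each boundary point. -/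
structure AsymptoticSpacetime where
  /-- The physical metric `ĝ`; only its values on the interior of `M` matter. -/
  ghat : BilinField n M
  ghat_symm : ∀ x ∈ Inn n M, ∀ v w, ghat x v w = ghat x w v
  ghat_lorentzian : ∀ x ∈ Inn n M, IsLorentzianAt ghat x
  ghat_smooth : ContMDiffOn (𝓡∂ (n + 1))
    ((𝓡∂ (n + 1)).prod 𝓘(ℝ, E (n + 1) →L[ℝ] E (n + 1) →L[ℝ] ℝ)) ∞
    (fun x => Bundle.TotalSpace.mk' (E (n + 1) →L[ℝ] E (n + 1) →L[ℝ] ℝ)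
      (E := fun x : M => TangentSpace (𝓡∂ (n + 1)) x →L[ℝ] TangentSpace (𝓡∂ (n + 1)) x →L[ℝ] ℝ)
      x (ghat x)) (Inn n M)
  /-- The constant boundary value of `ν = ρ⁻² g^{ab} ∇_a ρ ∇_b ρ`. -/
  ν₀ : ℝ
  /-- The boundary defining function. -/
  ρ : M → ℝ
  ρ_smooth : ContMDiff (𝓡∂ (n + 1)) 𝓘(ℝ, ℝ) ∞ ρ
  ρ_pos : ∀ x ∈ Inn n M, 0 < ρ x
  ρ_zero : ∀ x ∈ Bdry n M, ρ x = 0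
  dρ_ne_zero : ∀ x ∈ Bdry n M, mfderiv (𝓡∂ (n + 1)) 𝓘(ℝ, ℝ) ρ x ≠ 0
  exists_chart : ∀ q ∈ Bdry n M, ∃ φ h k σ, IsBeigSchmidt ghat ν₀ φ h k σ ∧
    q ∈ φ.source ∧ ∀ x ∈ φ.source, rhoOf φ x = ρ x

namespace AsymptoticSpacetime

variable (S : AsymptoticSpacetime n M)

/-- `j²_p ρ`. -/
def jetρ (p : M) : Jet2 (n := n) p := jet2 p S.ρ (S.ρ_smooth p)

/-- `j²_p ρ²`. -/
def jetρsq (p : M) : Jet2 (n := n) p :=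
  jet2 p (fun x => S.ρ x ^ 2) (ContMDiffAt.pow (S.ρ_smooth p) 2)

/-! ### The line bundle `Spi` / `Ti` -/

/-- The line spanned by `j²_p ρ²` in `J²_p M`. -/
def line (p : M) : Submodule ℝ (Jet2 (n := n) p) := Submodule.span ℝ {S.jetρsq p}

/-- The section `φ` of the quotient of `J² M` by the line spanned by `j² ρ²`. -/
def phi (p : M) : Jet2 (n := n) p ⧸ S.line p := Submodule.Quotient.mk (S.jetρ p)

/-- `Spi` (or `Ti`): the pullback by `φ` of the line bundle `J² M → J² M / ⟨j² ρ²⟩` over the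
boundary. Its points are the `(p, j)` with `p` in the boundary and `j ∈ J²_p M` of class `φ(p)`,
i.e. `j = j²_p ρ + u j²_p ρ²`. -/
structure Spi where
  pt : M
  pt_mem : pt ∈ Bdry n M
  jet : Jet2 (n := n) pt
  jet_mem : (Submodule.Quotient.mk jet : Jet2 (n := n) pt ⧸ S.line pt) = S.phi pt

variable {S} in
/-- The `ℝ`-action `j ↦ j + a j²_p ρ²` on the fibres. -/
def Spi.act (a : ℝ) (z : S.Spi) : S.Spi where
  pt := z.pt
  pt_mem := z.pt_mem
  jet := z.jet + a • S.jetρsq z.pt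
  jet_mem := by
    rw [← z.jet_mem, Submodule.Quotient.eq]
    simpa using (S.line z.pt).smul_mem a (Submodule.mem_span_singleton_self (S.jetρsq z.pt))

/-- The section `p ↦ j²_p ρ`. -/
def refSection (p : Bdry n M) : S.Spi := ⟨p, p.2, S.jetρ p, rfl⟩

/-- A coordinate system `(u, y)` on `Spi`: local coordinates `y` on the boundary, and a smooth
fibre coordinate `u` over their domain in which the `ℝ`-action is the translation of `u`. -/
structure SpiCoord where
  /-- The coordinates `y` of the boundary. -/
  y : OpenPartialHomeomorph (Bdry n M) (E n)
  /-- The coordinates `y` are locally restrictions of smooth functions on `M`. -/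
  y_smooth : ∀ p ∈ y.source, ∃ Y : M → E n,
    ContMDiffAt (𝓡∂ (n + 1)) 𝓘(ℝ, E n) ∞ Y p ∧
      ∀ᶠ x in 𝓝 (p : M), ∀ hx : x ∈ Bdry n M, Y x = y ⟨x, hx⟩
  y_symm_smooth : ContMDiffOn 𝓘(ℝ, E n) (𝓡∂ (n + 1)) ∞ (fun v => (y.symm v : M)) y.target
  /-- The fibre coordinate; only its values over the domain of `y` matter. -/
  u : S.Spi → ℝ
  u_act : ∀ (z : S.Spi) (a : ℝ), (⟨z.pt, z.pt_mem⟩ : Bdry n M) ∈ y.source →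
    u (z.act a) = u z + a
  u_smooth : ContDiffOn ℝ ∞ (fun v => u (S.refSection (y.symm v))) y.target

/-- The chart `φ = (ρ_φ, y_φ)` of `M` is adapted to the coordinate system `(u, y)` on `Spi`: on the
boundary `y_φ` is `y`, and the two-jet of `ρ_φ` at each boundary point is the point of `Spi` with
`u = 0`. -/
structure IsAdapted {S : AsymptoticSpacetime n M} (c : S.SpiCoord)
    (φ : OpenPartialHomeomorph M (EuclideanHalfSpace (n + 1))) : Prop where
  mem_source : ∀ p : Bdry n M, (p : M) ∈ φ.source → p ∈ c.y.source
  y_eq : ∀ p : Bdry n M, (p : M) ∈ φ.source → yOf φ p = c.y p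
  zero_section : ∀ p : Bdry n M, (p : M) ∈ φ.source → ∃ z : S.Spi, z.pt = p ∧ c.u z = 0 ∧
    ∃ hρ : ContMDiffAt (𝓡∂ (n + 1)) 𝓘(ℝ, ℝ) ∞ (rhoOf φ) z.pt, z.jet = jet2 z.pt (rhoOf φ) hρ

end AsymptoticSpacetime

end ExtendedBoundary

end

set_option linter.unusedSectionVars false

noncomputable section

namespace ExtendedBoundary

/-! ### Calculus on the closed half space -/

section HalfSpace

variable {n : ℕ}

/-! The whole proposition is a computation with the normal jets of transition maps at the boundary.
Let `(P, Y)` be a Beig–Schmidt chart with coefficients `h, k, σ`, and let `(r, v)` be another chart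
with `∂P/∂r = 1` on the boundary. By Taylor's formula in the normal direction (`taylor_normal`), `P
= r + w r² + c r³ + O(r⁴)` and `Y = θ + b r + ½ b' r² + O(r³)`, where `w, c, θ, b, b'` are functions
of `v` alone (`TransitionJets`). Inserting this into the physical metric and rescaling by `r²` gives
(`exp_new_rho_rho`, `exp_new_rho_y`, `exp_new_y_y`), with remainders `r³ ln r`, `r² ln r`, `r² ln
r`: `r² g_ρρ = ν⁻¹ (1 + r σ∘θ)² + r² radialCoef`, `g_ρα = mixedCoefZero + r mixedCoefOne`, `g_αβ =
θ*h + r tangentialCoef`.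

A logarithmic remainder is still smaller than the last retained power of `r`, so coefficients can be
compared. If the new chart is Beig–Schmidt as well, the three obstructions `radialCoef`,
`mixedCoefZero` and `mixedCoefOne` vanish. Conversely their vanishing, with smoothness and the right
signature of the new coefficients, makes it Beig–Schmidt (`TransitionJets.isBeigSchmidt`).

These equations are triangular. Since `h` and the Jacobian of `θ` are invertible, `mixedCoefZero =
0` says that `b` is the image under `θ` of `-ν⁻¹ grad w`; then `radialCoef = 0` gives `c`, and
`mixedCoefOne = 0` is a linear algebraic equation for `b'`. Thus `w` and `θ` are free and fix the
other jets. Existence follows by solving the equations (`exists_normal_jets`), taking a transition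
map polynomial in `r` with these jets and inverting it (`exists_polyMap_diffeomorphism`). Uniqueness
follows because `w = 0` forces `b = c = b' = 0` (`TransitionJets.rigidity`).

The link with Spi/Ti is that an adapted chart has first coordinate `ρ - u(j²ρ) ρ² + o(2)`. So
between adapted charts `w = u₁ - u₂` along the reference section (`normal_jets`), and `u₂ - u₁` is
constant on the fibres because both coordinates are equivariant (`u_sub_u`). Finally,
`tangentialCoef` contains the Lie derivative of the metric along `b`, that is along a gradient,
which is `-2 ν⁻¹ DDw` (`lieCoef_eq_covHess`). With `w = -ω` this is the transformation law of `k`.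
-/

lemma two_le_infty : (2 : WithTop ℕ∞) ≤ ∞ :=
  WithTop.coe_le_coe.2 (le_top : (2 : ℕ∞) ≤ ⊤)

/-- The closed half space `{z | 0 ≤ z 0}`. -/
def HS (n : ℕ) : Set (E (n + 1)) := {z | 0 ≤ z 0}

/-- The point `(t, y)` of `ℝ × ℝⁿ`. -/
def pair (t : ℝ) (y : E n) : E (n + 1) := WithLp.toLp 2 (Fin.cons t fun α => y α)

/-- The last `n` coordinates of a point of `ℝⁿ⁺¹`. -/
def tl (z : E (n + 1)) : E n := WithLp.toLp 2 fun α => z α.succ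

/-- The partial derivative `∂_i F` in the half space. -/
def dd (i : Fin (n + 1)) (F : E (n + 1) → ℝ) (z : E (n + 1)) : ℝ :=
  fderivWithin ℝ F (HS n) z (EuclideanSpace.single i 1)

@[simp] lemma pair_zero (t : ℝ) (y : E n) : pair t y 0 = t := rfl

@[simp] lemma pair_succ (t : ℝ) (y : E n) (α : Fin n) : pair t y α.succ = y α := rfl

@[simp] lemma tl_apply (z : E (n + 1)) (α : Fin n) : tl z α = z α.succ := rfl

@[simp] lemma tl_pair (t : ℝ) (y : E n) : tl (pair t y) = y := rfl

@[simp] lemma pair_tl (z : E (n + 1)) : pair (z 0) (tl z) = z := by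
  ext i; refine Fin.cases ?_ (fun α => ?_) i <;> simp

lemma pair_eq (t : ℝ) (y : E n) :
    pair t y = t • (EuclideanSpace.single 0 1 : E (n + 1)) + pair 0 y := by
  ext i; refine Fin.cases ?_ (fun α => ?_) i <;> simp

/-- The linear inclusion `y ↦ (0, y)`. -/
def incL : E n →L[ℝ] E (n + 1) := LinearMap.toContinuousLinearMap
  { toFun := pair 0
    map_add' := fun x y => by ext i; refine Fin.cases ?_ (fun α => ?_) i <;> simp
    map_smul' := fun c x => by ext i; refine Fin.cases ?_ (fun α => ?_) i <;> simp }

/-- The linear projection `(t, y) ↦ y`. -/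
def tlL : E (n + 1) →L[ℝ] E n := LinearMap.toContinuousLinearMap
  { toFun := tl
    map_add' := fun x y => by ext i; simp
    map_smul' := fun c x => by ext i; simp }

@[simp] lemma incL_apply (y : E n) : incL y = pair 0 y := rfl

lemma contDiff_pair_zero {m : WithTop ℕ∞} : ContDiff ℝ m (pair (n := n) 0) := incL.contDiff

lemma contDiff_tl {m : WithTop ℕ∞} : ContDiff ℝ m (tl (n := n)) := tlL.contDiff

lemma contDiff_coord {m : WithTop ℕ∞} {k : ℕ} (i : Fin k) : ContDiff ℝ m fun z : E k => z i :=
  (EuclideanSpace.proj (𝕜 := ℝ) i).contDiff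

lemma HS_eq_range : HS n = range (𝓡∂ (n + 1)) :=
  (range_modelWithCornersEuclideanHalfSpace (n + 1)).symm

lemma pair_mem_HS {t : ℝ} (ht : 0 ≤ t) (y : E n) : pair t y ∈ HS n := ht

lemma uniqueDiffOn_HS : UniqueDiffOn ℝ (HS n) := by
  rw [HS_eq_range]; exact (𝓡∂ (n + 1)).uniqueDiffOn

lemma interior_HS : interior (HS n) = {z | 0 < z 0} := by
  rw [HS_eq_range, interior_range_modelWithCornersEuclideanHalfSpace]

lemma closure_interior_HS : closure (interior (HS n)) = HS n := by
  rw [interior_HS, closure_open_halfSpace]; rfl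

variable {U : Set (E (n + 1))} {F G : E (n + 1) → ℝ} {z : E (n + 1)}

lemma uniqueDiffOn_inter_HS (hU : IsOpen U) : UniqueDiffOn ℝ (U ∩ HS n) := by
  rw [inter_comm]; exact uniqueDiffOn_HS.inter hU

lemma inter_HS_mem (hU : IsOpen U) (hz : z ∈ U) : U ∩ HS n ∈ 𝓝[HS n] z :=
  inter_mem_nhdsWithin _ (hU.mem_nhds hz) |> fun h => by rwa [inter_comm] at h

lemma contDiffWithinAt_HS {m : WithTop ℕ∞} {V : Type*} [NormedAddCommGroup V]
    [NormedSpace ℝ V] {F : E (n + 1) → V}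
    (hF : ContDiffOn ℝ m F (U ∩ HS n)) (hU : IsOpen U)
    (hz : z ∈ U ∩ HS n) : ContDiffWithinAt ℝ m F (HS n) z :=
  (hF z hz).mono_of_mem_nhdsWithin (inter_HS_mem hU hz.1)

lemma differentiableWithinAt_HS {V : Type*} [NormedAddCommGroup V]
    [NormedSpace ℝ V] {F : E (n + 1) → V} (hF : ContDiffOn ℝ ∞ F (U ∩ HS n)) (hU : IsOpen U)
    (hz : z ∈ U ∩ HS n) : DifferentiableWithinAt ℝ F (HS n) z :=
  (contDiffWithinAt_HS hF hU hz).differentiableWithinAt (by simp)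

lemma dd_congr (i : Fin (n + 1)) (hU : IsOpen U) (h : EqOn F G (U ∩ HS n)) :
    EqOn (dd i F) (dd i G) (U ∩ HS n) := by
  intro z hz
  unfold dd
  rw [Filter.EventuallyEq.fderivWithin_eq (h.eventuallyEq_of_mem (inter_HS_mem hU hz.1)) (h hz)]

lemma contDiffOn_dd (hF : ContDiffOn ℝ ∞ F (U ∩ HS n)) (hU : IsOpen U) (i : Fin (n + 1)) :
    ContDiffOn ℝ ∞ (dd i F) (U ∩ HS n) := by
  have h : ContDiffOn ℝ ∞ (fderivWithin ℝ F (U ∩ HS n)) (U ∩ HS n) :=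
    hF.fderivWithin (uniqueDiffOn_inter_HS hU) (by simp)
  refine (h.clm_apply (contDiffOn_const (c := EuclideanSpace.single i (1 : ℝ)))).congr
    fun z hz => ?_
  unfold dd
  rw [inter_comm, fderivWithin_inter (hU.mem_nhds hz.1)]

lemma contDiffOn_iterate_dd (hF : ContDiffOn ℝ ∞ F (U ∩ HS n)) (hU : IsOpen U) (k : ℕ) :
    ContDiffOn ℝ ∞ ((dd 0)^[k] F) (U ∩ HS n) := by
  induction k generalizing F with
  | zero => exact hF
  | succ k ih => exact ih (contDiffOn_dd hF hU 0)

/-- Symmetry of second derivatives survives at boundary points because the half space is the closure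
of its interior. -/
lemma dd_comm (hF : ContDiffOn ℝ ∞ F (U ∩ HS n)) (hU : IsOpen U) (i j : Fin (n + 1))
    (hz : z ∈ U ∩ HS n) : dd i (dd j F) z = dd j (dd i F) z := by
  have hs := (contDiffWithinAt_HS hF hU hz).isSymmSndFDerivWithinAt
    (by simpa using two_le_infty) uniqueDiffOn_HS
    (by rw [closure_interior_HS]; exact hz.2) hz.2
  have hd : DifferentiableWithinAt ℝ (fderivWithin ℝ F (HS n)) (HS n) z :=
    ((contDiffWithinAt_HS hF hU hz).fderivWithin_right (m := 1) uniqueDiffOn_HS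
      (by norm_num; exact two_le_infty) hz.2).differentiableWithinAt (by simp)
  have key : ∀ i j : Fin (n + 1), dd i (dd j F) z =
      fderivWithin ℝ (fderivWithin ℝ F (HS n)) (HS n) z (EuclideanSpace.single i 1)
        (EuclideanSpace.single j 1) := fun i j => by
    have : HasFDerivWithinAt (dd j F) _ (HS n) z :=
      hd.hasFDerivWithinAt.clm_apply (hasFDerivWithinAt_const (EuclideanSpace.single j 1) _ _)
    conv_lhs => rw [dd, this.fderivWithin (uniqueDiffOn_HS z hz.2)]
    simp
  rw [key, key, hs.eq]

lemma iterate_dd_congr (hU : IsOpen U) (h : EqOn F G (U ∩ HS n)) (k : ℕ) :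
    EqOn ((dd 0)^[k] F) ((dd 0)^[k] G) (U ∩ HS n) := by
  induction k generalizing F G with
  | zero => exact h
  | succ k ih => exact ih (dd_congr 0 hU h)

lemma iterate_dd_comm (hF : ContDiffOn ℝ ∞ F (U ∩ HS n)) (hU : IsOpen U) (i : Fin (n + 1))
    (k : ℕ) (hz : z ∈ U ∩ HS n) : (dd 0)^[k] (dd i F) z = dd i ((dd 0)^[k] F) z := by
  induction k generalizing F with
  | zero => rfl
  | succ k ih =>
    rw [Function.iterate_succ_apply, Function.iterate_succ_apply, ← ih (contDiffOn_dd hF hU 0)]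
    exact iterate_dd_congr hU (fun w hw => dd_comm hF hU 0 i hw) k hz

/-- Tangential derivatives at the boundary. -/
lemma dd_succ_boundary {y : E n} (α : Fin n)
    (hF : DifferentiableWithinAt ℝ F (HS n) (pair 0 y)) :
    dd α.succ F (pair 0 y) = pd α (fun v => F (pair 0 v)) y := by
  have h1 : HasFDerivAt (fun v => F (pair 0 v))
      ((fderivWithin ℝ F (HS n) (pair 0 y)).comp incL) y := by
    have := hF.hasFDerivWithinAt.comp (f := incL) (s := univ) y incL.hasFDerivWithinAt
      (fun v _ => pair_mem_HS le_rfl v)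
    rwa [hasFDerivWithinAt_univ] at this
  rw [pd, h1.fderiv, dd]
  have : pair 0 (EuclideanSpace.single α (1 : ℝ)) = EuclideanSpace.single α.succ 1 := by
    ext i; refine Fin.cases ?_ (fun β => ?_) i
    · simp
    · simp [Fin.succ_inj]
  simp [this]

lemma hasDerivWithinAt_pair {t : ℝ} {y : E n}
    (hF : DifferentiableWithinAt ℝ F (HS n) (pair t y)) :
    HasDerivWithinAt (fun s => F (pair s y)) (dd 0 F (pair t y)) (Ici 0) t := by
  have h0 : HasDerivWithinAt (fun s => pair s y) (EuclideanSpace.single 0 1) (Ici 0) t := by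
    have : (fun s => pair s y) = fun s => s • (EuclideanSpace.single 0 1 : E (n + 1)) + pair 0 y :=
      funext fun s => pair_eq s y
    rw [this]
    simpa using ((hasDerivWithinAt_id t (Ici 0)).smul_const
      (EuclideanSpace.single 0 1 : E (n + 1))).add_const (pair 0 y)
  exact hF.hasFDerivWithinAt.comp_hasDerivWithinAt t h0 fun s hs => hs

/-- Keeps the normal segment from `z` down to the boundary inside any ball around a boundary point
that contains `z`; this is what makes the Taylor estimate uniform. -/
lemma dist_pair_le {z : E (n + 1)} {y₀ : E n} {t : ℝ} (h : |t| ≤ |z 0|) :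
    dist (pair t (tl z)) (pair 0 y₀) ≤ dist z (pair 0 y₀) := by
  rw [EuclideanSpace.dist_eq, EuclideanSpace.dist_eq]
  apply Real.sqrt_le_sqrt
  rw [Fin.sum_univ_succ, Fin.sum_univ_succ]
  refine add_le_add ?_ (le_of_eq (by simp))
  simpa [Real.dist_eq, sq_abs] using sq_le_sq.2 h

/-- Taylor expansion in the normal direction, uniformly in the tangential directions. -/
lemma taylor_normal (hU : IsOpen U) (hF : ContDiffOn ℝ ∞ F (U ∩ HS n)) {y₀ : E n}
    (hy : pair 0 y₀ ∈ U) (k : ℕ) :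
    (fun z => F z - ∑ j ∈ Finset.range k,
      z 0 ^ j / (j.factorial : ℝ) * (dd 0)^[j] F (pair 0 (tl z)))
      =O[𝓝[HS n] (pair 0 y₀)] fun z => z 0 ^ k := by
  induction k generalizing F with
  | zero =>
    simp only [Finset.range_zero, Finset.sum_empty, sub_zero, pow_zero]
    have hc : ContinuousWithinAt F (HS n) (pair 0 y₀) :=
      (contDiffWithinAt_HS hF hU ⟨hy, pair_mem_HS le_rfl _⟩).continuousWithinAt
    exact hc.tendsto.isBigO_one ℝ
  | succ k ih =>
    obtain ⟨C, hC₀, hC⟩ := (ih (contDiffOn_dd hF hU 0)).exists_nonneg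
    rw [isBigOWith_iff] at hC
    -- The induction hypothesis for `dd 0 F` has to hold with one constant on a whole ball, since it
    -- is used at all points of the normal segment below `z`.
    have hC' : ∀ᶠ z in 𝓝 (pair 0 y₀), z ∈ U ∧ (z ∈ HS n →
        ‖dd 0 F z - ∑ j ∈ Finset.range k, z 0 ^ j / (j.factorial : ℝ) *
          (dd 0)^[j] (dd 0 F) (pair 0 (tl z))‖ ≤ C * ‖z 0 ^ k‖) :=
      Filter.Eventually.and (hU.mem_nhds hy) (eventually_nhdsWithin_iff.1 hC)
    obtain ⟨ε, hε, hb⟩ := Metric.eventually_nhds_iff.1 hC'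
    refine IsBigO.of_bound C ?_
    filter_upwards [inter_HS_mem Metric.isOpen_ball (Metric.mem_ball_self hε)] with z hz
    have hz0 : 0 ≤ z 0 := hz.2
    have hmem : ∀ t ∈ Icc 0 (z 0), dist (pair t (tl z)) (pair 0 y₀) < ε := fun t ht =>
      lt_of_le_of_lt (dist_pair_le (by rw [abs_of_nonneg ht.1, abs_of_nonneg hz0]; exact ht.2)) hz.1
    set g : ℝ → ℝ := fun t => F (pair t (tl z)) - ∑ j ∈ Finset.range (k + 1),
      t ^ j / (j.factorial : ℝ) * (dd 0)^[j] F (pair 0 (tl z)) with hg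
    have hder : ∀ t ∈ Icc 0 (z 0), HasDerivWithinAt g (dd 0 F (pair t (tl z)) -
        ∑ j ∈ Finset.range k, t ^ j / (j.factorial : ℝ) *
          (dd 0)^[j] (dd 0 F) (pair 0 (tl z))) (Icc 0 (z 0)) t := fun t ht => by
      refine HasDerivWithinAt.sub ?_ ?_
      · exact (hasDerivWithinAt_pair (differentiableWithinAt_HS hF hU
          ⟨(hb (hmem t ht)).1, ht.1⟩)).mono Icc_subset_Ici_self
      · have h1 : ∀ j ∈ Finset.range (k + 1), HasDerivWithinAt
            (fun t : ℝ => t ^ j / (j.factorial : ℝ) * (dd 0)^[j] F (pair 0 (tl z)))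
            ((j * t ^ (j - 1)) / (j.factorial : ℝ) * (dd 0)^[j] F (pair 0 (tl z)))
            (Icc 0 (z 0)) t := fun j _ =>
          (((hasDerivAt_pow j t).div_const _).mul_const _).hasDerivWithinAt
        have h2 := HasDerivWithinAt.fun_sum h1
        refine h2.congr_deriv ?_
        rw [Finset.sum_range_succ']
        simp only [Nat.cast_zero, zero_mul, zero_div, add_zero]
        refine Finset.sum_congr rfl fun j _ => ?_
        have : ((j + 1 : ℕ) : ℝ) ≠ 0 := by positivity
        have h3 : ((j.factorial : ℕ) : ℝ) ≠ 0 := by positivity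
        rw [Nat.factorial_succ, Function.iterate_succ_apply]
        push_cast at this ⊢
        field_simp
    -- The mean value inequality on `[0, z 0]` gains the missing power: the Taylor remainder
    -- vanishes at `0` and its derivative is the remainder of `dd 0 F`, of size at most `C * z 0 ^
    -- k`.
    have hbd := Convex.norm_image_sub_le_of_norm_hasDerivWithin_le (C := C * z 0 ^ k) hder
      (fun t ht => ?_) (convex_Icc _ _) (left_mem_Icc.2 hz0) (right_mem_Icc.2 hz0)
    · have h0 : g 0 = 0 := by
        simp [hg, Finset.sum_range_succ']
      have h1 : g (z 0) = F z - ∑ j ∈ Finset.range (k + 1),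
          z 0 ^ j / (j.factorial : ℝ) * (dd 0)^[j] F (pair 0 (tl z)) := by simp [hg]
      rw [h0, h1, sub_zero, sub_zero] at hbd
      refine hbd.trans (le_of_eq ?_)
      rw [Real.norm_of_nonneg hz0, Real.norm_of_nonneg (by positivity), pow_succ, mul_assoc]
    · have hC0 := (hb (hmem t ht)).2 ht.1
      refine hC0.trans ?_
      simp only [pair_zero]
      rw [Real.norm_of_nonneg (pow_nonneg ht.1 _)]
      exact mul_le_mul_of_nonneg_left (pow_le_pow_left₀ ht.1 ht.2 _) hC₀

end HalfSpace

/-! ### Asymptotic expansions with logarithmic remainders -/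

section Expansions

variable {X : Type*} {l : Filter X} {r : X → ℝ}

lemma isBigO_one_log (hr : Tendsto r l (𝓝[>] 0)) :
    (fun _ => (1 : ℝ)) =O[l] fun x => Real.log (r x) := by
  have h : Tendsto (fun x => Real.log (r x)) l atBot := Real.tendsto_log_nhdsGT_zero.comp hr
  refine IsBigO.of_bound 1 ?_
  filter_upwards [h.eventually_le_atBot (-1)] with x hx
  rw [norm_one, one_mul, Real.norm_eq_abs, abs_of_neg (by linarith)]
  linarith

lemma isBigO_pow_mul_log (hr : Tendsto r l (𝓝[>] 0)) (k : ℕ) :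
    (fun x => r x ^ k) =O[l] fun x => r x ^ k * Real.log (r x) := by
  simpa using (isBigO_refl (fun x => r x ^ k) l).mul (isBigO_one_log hr)

lemma isBigO_coord_one (hr : Tendsto r l (𝓝[>] 0)) : r =O[l] fun _ => (1 : ℝ) :=
  (hr.mono_right nhdsWithin_le_nhds).isBigO_one ℝ

lemma isBigO_pow_pow (hr : Tendsto r l (𝓝[>] 0)) {j k : ℕ} (h : j ≤ k) :
    (fun x => r x ^ k) =O[l] fun x => r x ^ j := by
  obtain ⟨m, rfl⟩ := Nat.exists_eq_add_of_le h
  simpa [pow_add] using (isBigO_refl (fun x => r x ^ j) l).mul ((isBigO_coord_one hr).pow m)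

lemma isLittleO_pow_mul_log (hr : Tendsto r l (𝓝[>] 0)) {j k : ℕ} (h : j < k) :
    (fun x => r x ^ k * Real.log (r x)) =o[l] fun x => r x ^ j := by
  obtain ⟨m, rfl⟩ := Nat.exists_eq_add_of_le (Nat.succ_le_of_lt h)
  have h1 : Tendsto (fun x => Real.log (r x) * r x) l (𝓝 0) := by
    have := tendsto_log_mul_rpow_nhdsGT_zero (r := 1) one_pos
    simp only [Real.rpow_one] at this
    exact this.comp hr
  have h2 : (fun x => Real.log (r x) * r x) =o[l] fun _ => (1 : ℝ) :=
    (isLittleO_one_iff ℝ).2 h1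
  refine (((isBigO_refl (fun x => r x ^ j) l).mul_isLittleO h2).mul_isBigO
    ((isBigO_coord_one hr).pow m)).congr (fun x => ?_) fun x => ?_
  · rw [Nat.succ_eq_add_one]; ring
  · simp

lemma isBigO_pow_mul_log_le (hr : Tendsto r l (𝓝[>] 0)) {j k : ℕ} (h : j ≤ k) :
    (fun x => r x ^ k * Real.log (r x)) =O[l] fun x => r x ^ j * Real.log (r x) :=
  (isBigO_pow_pow hr h).mul (isBigO_refl _ _)

/-- `f = a + b r + O(r² ln r)` with bounded coefficients. -/
structure Exp2 (l : Filter X) (r f a b : X → ℝ) : Prop where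
  rem : (fun x => f x - (a x + b x * r x)) =O[l] fun x => r x ^ 2 * Real.log (r x)
  bdd₀ : a =O[l] fun _ => (1 : ℝ)
  bdd₁ : b =O[l] fun _ => (1 : ℝ)

/-- `f = a + b r + c r² + O(r³ ln r)` with bounded coefficients. -/
structure Exp3 (l : Filter X) (r f a b c : X → ℝ) : Prop where
  rem : (fun x => f x - (a x + b x * r x + c x * r x ^ 2))
    =O[l] fun x => r x ^ 3 * Real.log (r x)
  bdd₀ : a =O[l] fun _ => (1 : ℝ)
  bdd₁ : b =O[l] fun _ => (1 : ℝ)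
  bdd₂ : c =O[l] fun _ => (1 : ℝ)

variable {f g a b c a' b' c' : X → ℝ}

lemma IsBigO_one_mul {u v : X → ℝ} (hu : u =O[l] fun _ => (1 : ℝ))
    (hv : v =O[l] fun _ => (1 : ℝ)) : (fun x => u x * v x) =O[l] fun _ => (1 : ℝ) := by
  simpa using hu.mul hv

namespace Exp2

lemma congr (h : Exp2 l r f a b) (hfg : f =ᶠ[l] g) : Exp2 l r g a b :=
  ⟨h.rem.congr' (by filter_upwards [hfg] with x hx; rw [hx]) .rfl, h.bdd₀, h.bdd₁⟩

lemma coef (h : Exp2 l r f a b) (h0 : ∀ x, a x = a' x) (h1 : ∀ x, b x = b' x) :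
    Exp2 l r f a' b' := by
  obtain rfl : a = a' := funext h0
  obtain rfl : b = b' := funext h1
  exact h

lemma coef_ev (h : Exp2 l r f a b) (h0 : a =ᶠ[l] a') (h1 : b =ᶠ[l] b') : Exp2 l r f a' b' :=
  ⟨h.rem.congr' (by filter_upwards [h0, h1] with x hx hx'; rw [hx, hx']) .rfl,
    h.bdd₀.congr' h0 .rfl, h.bdd₁.congr' h1 .rfl⟩

lemma of_isBigO (hr : Tendsto r l (𝓝[>] 0))
    (h : (fun x => f x - (a x + b x * r x)) =O[l] fun x => r x ^ 2)
    (h0 : a =O[l] fun _ => (1 : ℝ)) (h1 : b =O[l] fun _ => (1 : ℝ)) : Exp2 l r f a b :=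
  ⟨h.trans (isBigO_pow_mul_log hr 2), h0, h1⟩

lemma isBigO_one (hr : Tendsto r l (𝓝[>] 0)) (h : Exp2 l r f a b) :
    f =O[l] fun _ => (1 : ℝ) := by
  have h1 : (fun x => r x ^ 2 * Real.log (r x)) =O[l] fun _ => (1 : ℝ) := by
    simpa using (isLittleO_pow_mul_log hr (j := 0) (k := 2) (by norm_num)).isBigO
  have := (h.rem.trans h1).add (h.bdd₀.add (IsBigO_one_mul h.bdd₁ (isBigO_coord_one hr)))
  simpa using this

lemma of_le (h : f =O[l] fun x => r x ^ 2 * Real.log (r x)) :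
    Exp2 l r f (fun _ => 0) (fun _ => 0) :=
  ⟨by simpa using h, isBigO_zero _ _, isBigO_zero _ _⟩

lemma self (h0 : a =O[l] fun _ => (1 : ℝ)) : Exp2 l r a a (fun _ => 0) :=
  ⟨by simpa using isBigO_zero _ _, h0, isBigO_zero _ _⟩

lemma add (h : Exp2 l r f a b) (h' : Exp2 l r g a' b') :
    Exp2 l r (fun x => f x + g x) (fun x => a x + a' x) (fun x => b x + b' x) :=
  ⟨(h.rem.add h'.rem).congr_left fun x => by ring, h.bdd₀.add h'.bdd₀, h.bdd₁.add h'.bdd₁⟩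

lemma sum {ι : Type*} {s : Finset ι} {f a b : ι → X → ℝ}
    (h : ∀ i ∈ s, Exp2 l r (f i) (a i) (b i)) :
    Exp2 l r (fun x => ∑ i ∈ s, f i x) (fun x => ∑ i ∈ s, a i x) (fun x => ∑ i ∈ s, b i x) := by
  refine ⟨(IsBigO.fun_sum fun i hi => (h i hi).rem).congr_left fun x => ?_,
    IsBigO.fun_sum fun i hi => (h i hi).bdd₀, IsBigO.fun_sum fun i hi => (h i hi).bdd₁⟩
  rw [Finset.sum_sub_distrib, Finset.sum_add_distrib, Finset.sum_mul]

lemma mul (hr : Tendsto r l (𝓝[>] 0)) (h : Exp2 l r f a b) (h' : Exp2 l r g a' b') :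
    Exp2 l r (fun x => f x * g x) (fun x => a x * a' x)
      (fun x => a x * b' x + b x * a' x) := by
  refine ⟨?_, IsBigO_one_mul h.bdd₀ h'.bdd₀,
    (IsBigO_one_mul h.bdd₀ h'.bdd₁).add (IsBigO_one_mul h.bdd₁ h'.bdd₀)⟩
  have h1 : (fun x => (f x - (a x + b x * r x)) * g x)
      =O[l] fun x => r x ^ 2 * Real.log (r x) := by
    simpa using h.rem.mul (h'.isBigO_one hr)
  have h2 : (fun x => (a x + b x * r x) * (g x - (a' x + b' x * r x)))
      =O[l] fun x => r x ^ 2 * Real.log (r x) := by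
    simpa using (h.bdd₀.add (IsBigO_one_mul h.bdd₁ (isBigO_coord_one hr))).mul h'.rem
  have h3 : (fun x => b x * b' x * r x ^ 2) =O[l] fun x => r x ^ 2 * Real.log (r x) := by
    simpa using (IsBigO_one_mul h.bdd₁ h'.bdd₁).mul (isBigO_pow_mul_log hr 2)
  exact ((h1.add h2).add h3).congr_left fun x => by ring

end Exp2

namespace Exp3

lemma congr (h : Exp3 l r f a b c) (hfg : f =ᶠ[l] g) : Exp3 l r g a b c :=
  ⟨h.rem.congr' (by filter_upwards [hfg] with x hx; rw [hx]) .rfl, h.bdd₀, h.bdd₁, h.bdd₂⟩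

lemma coef (h : Exp3 l r f a b c) (h0 : ∀ x, a x = a' x) (h1 : ∀ x, b x = b' x)
    (h2 : ∀ x, c x = c' x) : Exp3 l r f a' b' c' := by
  obtain rfl : a = a' := funext h0
  obtain rfl : b = b' := funext h1
  obtain rfl : c = c' := funext h2
  exact h

lemma of_isBigO (hr : Tendsto r l (𝓝[>] 0))
    (h : (fun x => f x - (a x + b x * r x + c x * r x ^ 2)) =O[l] fun x => r x ^ 3)
    (h0 : a =O[l] fun _ => (1 : ℝ)) (h1 : b =O[l] fun _ => (1 : ℝ))
    (h2 : c =O[l] fun _ => (1 : ℝ)) : Exp3 l r f a b c :=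
  ⟨h.trans (isBigO_pow_mul_log hr 3), h0, h1, h2⟩

lemma self (h0 : a =O[l] fun _ => (1 : ℝ)) : Exp3 l r a a (fun _ => 0) (fun _ => 0) :=
  ⟨by simpa using isBigO_zero _ _, h0, isBigO_zero _ _, isBigO_zero _ _⟩

lemma of_le (h : f =O[l] fun x => r x ^ 3 * Real.log (r x)) :
    Exp3 l r f (fun _ => 0) (fun _ => 0) (fun _ => 0) :=
  ⟨by simpa using h, isBigO_zero _ _, isBigO_zero _ _, isBigO_zero _ _⟩

lemma toExp2 (hr : Tendsto r l (𝓝[>] 0)) (h : Exp3 l r f a b c) : Exp2 l r f a b := by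
  refine ⟨?_, h.bdd₀, h.bdd₁⟩
  have h1 : (fun x => c x * r x ^ 2) =O[l] fun x => r x ^ 2 * Real.log (r x) := by
    simpa using h.bdd₂.mul (isBigO_pow_mul_log hr 2)
  exact ((h.rem.trans (isBigO_pow_mul_log_le hr (by norm_num))).add h1).congr_left
    fun x => by ring

lemma isBigO_one (hr : Tendsto r l (𝓝[>] 0)) (h : Exp3 l r f a b c) :
    f =O[l] fun _ => (1 : ℝ) := (h.toExp2 hr).isBigO_one hr

lemma add (h : Exp3 l r f a b c) (h' : Exp3 l r g a' b' c') :
    Exp3 l r (fun x => f x + g x) (fun x => a x + a' x) (fun x => b x + b' x)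
      (fun x => c x + c' x) :=
  ⟨(h.rem.add h'.rem).congr_left fun x => by ring, h.bdd₀.add h'.bdd₀, h.bdd₁.add h'.bdd₁,
    h.bdd₂.add h'.bdd₂⟩

lemma mul (hr : Tendsto r l (𝓝[>] 0)) (h : Exp3 l r f a b c) (h' : Exp3 l r g a' b' c') :
    Exp3 l r (fun x => f x * g x) (fun x => a x * a' x)
      (fun x => a x * b' x + b x * a' x) (fun x => a x * c' x + b x * b' x + c x * a' x) := by
  refine ⟨?_, IsBigO_one_mul h.bdd₀ h'.bdd₀,
    (IsBigO_one_mul h.bdd₀ h'.bdd₁).add (IsBigO_one_mul h.bdd₁ h'.bdd₀),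
    ((IsBigO_one_mul h.bdd₀ h'.bdd₂).add (IsBigO_one_mul h.bdd₁ h'.bdd₁)).add
      (IsBigO_one_mul h.bdd₂ h'.bdd₀)⟩
  have h1 : (fun x => (f x - (a x + b x * r x + c x * r x ^ 2)) * g x)
      =O[l] fun x => r x ^ 3 * Real.log (r x) := by
    simpa using h.rem.mul (h'.isBigO_one hr)
  have hr1 := isBigO_coord_one hr
  have hr2 : (fun x => r x ^ 2) =O[l] fun _ => (1 : ℝ) := by simpa using hr1.pow 2
  have h2 : (fun x => (a x + b x * r x + c x * r x ^ 2) *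
      (g x - (a' x + b' x * r x + c' x * r x ^ 2)))
      =O[l] fun x => r x ^ 3 * Real.log (r x) := by
    simpa using ((h.bdd₀.add (IsBigO_one_mul h.bdd₁ hr1)).add
      (IsBigO_one_mul h.bdd₂ hr2)).mul h'.rem
  have h3 : (fun x => (b x * c' x + c x * b' x + c x * c' x * r x) * r x ^ 3)
      =O[l] fun x => r x ^ 3 * Real.log (r x) := by
    simpa using (((IsBigO_one_mul h.bdd₁ h'.bdd₂).add (IsBigO_one_mul h.bdd₂ h'.bdd₁)).add
      (IsBigO_one_mul (IsBigO_one_mul h.bdd₂ h'.bdd₂) hr1)).mul (isBigO_pow_mul_log hr 3)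
  exact ((h1.add h2).add h3).congr_left fun x => by ring

lemma tendsto_one (hr : Tendsto r l (𝓝[>] 0)) (h : Exp3 l r f (fun _ => 1) b c) :
    Tendsto f l (𝓝 1) := by
  have hr0 : Tendsto r l (𝓝 0) := hr.mono_right nhdsWithin_le_nhds
  have h0 : r =o[l] fun _ => (1 : ℝ) := (isLittleO_one_iff ℝ).2 hr0
  have h1 : (fun x => f x - (1 + b x * r x)) =o[l] fun _ => (1 : ℝ) := by
    simpa using (h.toExp2 hr).rem.trans_isLittleO
      (isLittleO_pow_mul_log hr (j := 0) (k := 2) (by norm_num))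
  have h2 : (fun x => b x * r x) =o[l] fun _ => (1 : ℝ) := by
    simpa using h.bdd₁.mul_isLittleO h0
  have h3 : (fun x => f x - 1) =o[l] fun _ => (1 : ℝ) :=
    (h1.add h2).congr_left fun x => by ring
  have := ((isLittleO_one_iff ℝ).1 h3).add_const 1
  simpa using this

/-- The product of `f` with the truncated geometric series is `1 + O(r³ ln r)`, and `f⁻¹` is bounded
because `f → 1`. -/
lemma inv (hr : Tendsto r l (𝓝[>] 0)) (h : Exp3 l r f (fun _ => 1) b c) :
    Exp3 l r (fun x => (f x)⁻¹) (fun _ => 1) (fun x => - b x) (fun x => b x ^ 2 - c x) := by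
  have ht := (h.tendsto_one hr)
  have hne : ∀ᶠ x in l, f x ≠ 0 := ht.eventually_ne one_ne_zero
  have hi : (fun x => (f x)⁻¹) =O[l] fun _ => (1 : ℝ) := (ht.inv₀ one_ne_zero).isBigO_one ℝ
  have hb2 : (fun x => b x ^ 2 - c x) =O[l] fun _ => (1 : ℝ) := by
    simpa [pow_two] using (IsBigO_one_mul h.bdd₁ h.bdd₁).sub h.bdd₂
  refine ⟨?_, h.bdd₀, h.bdd₁.neg_left, hb2⟩
  have hq : Exp3 l r (fun x => 1 + -b x * r x + (b x ^ 2 - c x) * r x ^ 2) (fun _ => 1)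
      (fun x => - b x) (fun x => b x ^ 2 - c x) :=
    ⟨by simpa using isBigO_zero _ _, h.bdd₀, h.bdd₁.neg_left, hb2⟩
  have hm := (h.mul hr hq).rem
  refine (((hi.mul hm).neg_left).congr' ?_ (.of_forall fun x => one_mul _))
  filter_upwards [hne] with x hx
  field_simp
  ring

end Exp3

/-- A factor `r` raises the accuracy by one order. Terms carrying explicit powers of `r` therefore
need less precise input. -/
lemma Exp2.shift (h : Exp2 l r f a b) : Exp3 l r (fun x => r x * f x) (fun _ => 0) a b := by
  refine ⟨?_, isBigO_zero _ _, h.bdd₀, h.bdd₁⟩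
  exact ((isBigO_refl r l).mul h.rem).congr (fun x => by ring) fun x => by ring

/-- Coefficients of an expansion are unique: the limit gives `a`, and dividing by `r ≠ 0` gives `b`.
The logarithmic versions below follow because `r^(k+1) ln r = o(r^k)`. -/
lemma eq_zero_of_isLittleO [l.NeBot] (hr : Tendsto r l (𝓝[>] 0)) {a b : ℝ}
    (h : (fun x => a + b * r x) =o[l] r) : a = 0 ∧ b = 0 := by
  have hr0 : Tendsto r l (𝓝 0) := hr.mono_right nhdsWithin_le_nhds
  have hpos : ∀ᶠ x in l, 0 < r x := hr.eventually self_mem_nhdsWithin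
  have ha : a = 0 := by
    have h1 : Tendsto (fun x => a + b * r x) l (𝓝 0) := h.isBigO.trans_tendsto hr0
    have h2 : Tendsto (fun x => a + b * r x) l (𝓝 (a + b * 0)) := (hr0.const_mul b).const_add a
    simpa using tendsto_nhds_unique h2 h1
  refine ⟨ha, ?_⟩
  subst ha
  by_contra hb
  have h2 := (isLittleO_const_mul_left_iff hb).1 (h.congr_left fun x => zero_add _)
  exact isLittleO_irrefl (hpos.frequently.mono fun x hx => hx.ne') h2

lemma eq_zero_of_isLittleO_sq [l.NeBot] (hr : Tendsto r l (𝓝[>] 0)) {a b c : ℝ}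
    (h : (fun x => a + b * r x + c * r x ^ 2) =o[l] fun x => r x ^ 2) :
    a = 0 ∧ b = 0 ∧ c = 0 := by
  have hr0 : Tendsto r l (𝓝 0) := hr.mono_right nhdsWithin_le_nhds
  have hpos : ∀ᶠ x in l, 0 < r x := hr.eventually self_mem_nhdsWithin
  have hsq : (fun x => r x ^ 2) =o[l] r := by
    simpa [pow_two] using (isBigO_refl r l).mul_isLittleO ((isLittleO_one_iff ℝ).2 hr0)
  obtain ⟨rfl, rfl⟩ := eq_zero_of_isLittleO (a := a) (b := b) hr
    (((h.trans hsq).sub (hsq.const_mul_left c)).congr_left fun x => by ring)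
  refine ⟨rfl, rfl, ?_⟩
  by_contra hc
  have h2 := (isLittleO_const_mul_left_iff (f := fun x => r x ^ 2) hc).1
    (h.congr_left fun x => by ring)
  exact isLittleO_irrefl (hpos.frequently.mono fun x hx => (pow_pos hx 2).ne') h2

lemma eq_zero_of_isBigO [l.NeBot] (hr : Tendsto r l (𝓝[>] 0)) {a b : ℝ}
    (h : (fun x => a + b * r x) =O[l] fun x => r x ^ 2 * Real.log (r x)) : a = 0 ∧ b = 0 :=
  eq_zero_of_isLittleO hr (by
    simpa using h.trans_isLittleO (isLittleO_pow_mul_log hr (j := 1) (by norm_num)))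

lemma eq_zero_of_isBigO_three [l.NeBot] (hr : Tendsto r l (𝓝[>] 0)) {a b c : ℝ}
    (h : (fun x => a + b * r x + c * r x ^ 2) =O[l] fun x => r x ^ 3 * Real.log (r x)) :
    a = 0 ∧ b = 0 ∧ c = 0 :=
  eq_zero_of_isLittleO_sq hr (h.trans_isLittleO (isLittleO_pow_mul_log hr (by norm_num)))

end Expansions

/-! ### Expansion of a Beig–Schmidt metric in new coordinates -/

section Transformation

variable {n : ℕ} {X : Type*} {l : Filter X} {r : X → ℝ}

/-- The components of the metric in the new coordinates. -/
def newG (T G : Fin (n + 1) → Fin (n + 1) → X → ℝ) (i j : Fin (n + 1)) (x : X) : ℝ :=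
  ∑ a, ∑ b, T a i x * T b j x * G a b x

/-- The components `G` of a metric with a Beig–Schmidt expansion in coordinates `(P, Y)` with
coefficients `H`, `K`, `s`, and the expansions in powers of a new radial coordinate `r` of `P`, of the
Jacobian `T a i = ∂_i (P, Y)^a` and of the coefficients. -/
structure TransitionExpansion (l : Filter X) (r : X → ℝ) (ν : ℝ) (P : X → ℝ)
    (T G : Fin (n + 1) → Fin (n + 1) → X → ℝ) (H K : Fin n → Fin n → X → ℝ) (s : X → ℝ)
    (w c : X → ℝ) (wd cd : Fin n → X → ℝ) (s₀ s₁ : X → ℝ) (H₀ H₁ K₀ K₁ : Fin n → Fin n → X → ℝ)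
    (b b' : Fin n → X → ℝ) (θ bd : Fin n → Fin n → X → ℝ) : Prop where
  tendsto : Tendsto r l (𝓝[>] 0)
  symm : ∀ γ, G γ 0 =ᶠ[l] G 0 γ
  rho_rho : (fun x => P x ^ 2 * (P x ^ 2 * G 0 0 x) -
    ν⁻¹ * (1 + 2 * P x * s x + P x ^ 2 * s x ^ 2)) =O[l] fun x => P x ^ 3 * Real.log (P x)
  rho_y : ∀ γ : Fin n, (fun x => P x ^ 2 * G 0 γ.succ x) =O[l] fun x => P x ^ 2 * Real.log (P x)
  y_y : ∀ γ δ : Fin n, (fun x => P x ^ 2 * G γ.succ δ.succ x -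
    (H γ δ x + P x * (K γ δ x - 2 * s x * H γ δ x))) =O[l] fun x => P x ^ 2 * Real.log (P x)
  exp_P : Exp3 l r (fun x => P x / r x) (fun _ => 1) w c
  exp_P_rho : Exp3 l r (T 0 0) (fun _ => 1) (fun x => 2 * w x) (fun x => 3 * c x)
  exp_P_y : ∀ α : Fin n, Exp2 l r (fun x => T 0 α.succ x / r x ^ 2) (wd α) (cd α)
  exp_s : Exp2 l r s s₀ s₁
  exp_H : ∀ γ δ, Exp2 l r (H γ δ) (H₀ γ δ) (H₁ γ δ)
  exp_K : ∀ γ δ, Exp2 l r (K γ δ) (K₀ γ δ) (K₁ γ δ)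
  exp_Y_rho : ∀ γ : Fin n, Exp2 l r (T γ.succ 0) (b γ) (b' γ)
  exp_Y_y : ∀ γ α : Fin n, Exp2 l r (T γ.succ α.succ) (θ γ α) (bd γ α)

namespace TransitionExpansion

variable {ν : ℝ} {P : X → ℝ}
    {T G : Fin (n + 1) → Fin (n + 1) → X → ℝ} {H K : Fin n → Fin n → X → ℝ} {s : X → ℝ}
    {w c : X → ℝ} {wd cd : Fin n → X → ℝ} {s₀ s₁ : X → ℝ} {H₀ H₁ K₀ K₁ : Fin n → Fin n → X → ℝ}
    {b b' : Fin n → X → ℝ} {θ bd : Fin n → Fin n → X → ℝ}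
    (D : TransitionExpansion l r ν P T G H K s w c wd cd s₀ s₁ H₀ H₁ K₀ K₁ b b' θ bd)

include D

lemma pos : ∀ᶠ x in l, 0 < r x ∧ 0 < P x / r x :=
  (D.tendsto.eventually self_mem_nhdsWithin).and
    ((D.exp_P.tendsto_one D.tendsto).eventually_const_lt zero_lt_one)

lemma isBigO_P : P =O[l] r := by
  have h := ((D.exp_P.tendsto_one D.tendsto).isBigO_one ℝ).mul (isBigO_refl r l)
  refine h.congr' ?_ (.of_forall fun x => one_mul _)
  filter_upwards [D.pos] with x hx
  field_simp [hx.1.ne']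

lemma isBigO_log : (fun x => Real.log (P x)) =O[l] fun x => Real.log (r x) := by
  have h1 : (fun x => Real.log (P x / r x)) =O[l] fun _ => (1 : ℝ) :=
    ((D.exp_P.tendsto_one D.tendsto).log one_ne_zero).isBigO_one ℝ
  refine ((h1.trans (isBigO_one_log D.tendsto)).add (isBigO_refl _ _)).congr' ?_ .rfl
  filter_upwards [D.pos] with x hx
  rw [← Real.log_mul hx.2.ne' hx.1.ne', div_mul_cancel₀ _ hx.1.ne']

lemma isBigO_pow_log (k : ℕ) :
    (fun x => P x ^ k * Real.log (P x)) =O[l] fun x => r x ^ k * Real.log (r x) :=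
  (D.isBigO_P.pow k).mul D.isBigO_log

lemma exp_inv : Exp3 l r (fun x => (P x / r x)⁻¹) (fun _ => 1) (fun x => - w x)
    (fun x => w x ^ 2 - c x) := D.exp_P.inv D.tendsto

lemma exp_Ps : Exp3 l r (fun x => P x * s x) (fun _ => 0) s₀ (fun x => s₁ x + w x * s₀ x) := by
  have h := (((D.exp_P.toExp2 D.tendsto).mul D.tendsto D.exp_s).shift).congr
    (g := fun x => P x * s x) (by
      filter_upwards [D.pos] with x hx
      field_simp [hx.1.ne'])
  exact h.coef (fun x => rfl) (fun x => by ring) fun x => by ring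

/-- `r⁴ G_{ρρ}`. -/
lemma exp_G_rho_rho : Exp3 l r (fun x => r x ^ 4 * G 0 0 x) (fun _ => ν⁻¹)
    (fun x => ν⁻¹ * (2 * s₀ x - 4 * w x))
    (fun x => ν⁻¹ * (s₀ x ^ 2 + 2 * s₁ x - 6 * w x * s₀ x + 10 * w x ^ 2 - 4 * c x)) := by
  have hr := D.tendsto
  -- The prescribed radial expansion is the perfect square `(1 + P s)²`.
  have h1 : Exp3 l r (fun x => 1 + P x * s x) (fun _ => 1) s₀ (fun x => s₁ x + w x * s₀ x) :=
    ((Exp3.self (isBigO_refl _ _)).add D.exp_Ps).coef (fun x => by ring) (fun x => by ring)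
      fun x => by ring
  have hν : Exp3 l r (fun _ => ν⁻¹) (fun _ => ν⁻¹) (fun _ => 0) (fun _ => 0) :=
    Exp3.self (isBigO_const_const _ one_ne_zero _)
  have h2 := hν.mul hr (h1.mul hr h1)
  have h3 := h2.add (Exp3.of_le (D.rho_rho.trans (D.isBigO_pow_log 3)))
  -- Its square `(P / r)⁻⁴` converts `P⁴ G` into `r⁴ G`.
  have hi2 := D.exp_inv.mul hr D.exp_inv
  have h4 := (hi2.mul hr hi2).mul hr h3
  refine (h4.congr ?_).coef (fun x => by ring) (fun x => by ring) (fun x => by ring)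
  filter_upwards [D.pos] with x hx
  have hP : P x ≠ 0 := fun h => by simp [h] at hx
  field_simp [hx.1.ne']
  ring

lemma isBigO_G_rho_y (γ : Fin n) :
    (fun x => r x ^ 2 * G 0 γ.succ x) =O[l] fun x => r x ^ 2 * Real.log (r x) := by
  have h := ((D.exp_inv.isBigO_one D.tendsto).pow 2).mul
    ((D.rho_y γ).trans (D.isBigO_pow_log 2))
  refine h.congr' ?_ (.of_forall fun x => by simp)
  filter_upwards [D.pos] with x hx
  have hP : P x ≠ 0 := fun h => by simp [h] at hx
  field_simp

lemma exp_G_y_y (γ δ : Fin n) : Exp2 l r (fun x => r x ^ 2 * G γ.succ δ.succ x) (H₀ γ δ)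
    (fun x => H₁ γ δ x + K₀ γ δ x - 2 * s₀ x * H₀ γ δ x - 2 * w x * H₀ γ δ x) := by
  have hr := D.tendsto
  have hi := (D.exp_inv.mul hr D.exp_inv).toExp2 hr
  have hP : Exp2 l r P (fun _ => 0) (fun _ => 1) := by
    refine (D.exp_P.toExp2 hr).shift.toExp2 hr |>.congr ?_
    filter_upwards [D.pos] with x hx
    field_simp [hx.1.ne']
  have h2 : Exp2 l r (fun _ => -2) (fun _ => -2) (fun _ => 0) :=
    Exp2.self (isBigO_const_const _ one_ne_zero _)
  have hb := (D.exp_H γ δ).add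
    (hP.mul hr ((D.exp_K γ δ).add (h2.mul hr (D.exp_s.mul hr (D.exp_H γ δ)))))
  have h := hi.mul hr (hb.add (Exp2.of_le ((D.y_y γ δ).trans (D.isBigO_pow_log 2))))
  refine (h.congr ?_).coef (fun x => by ring) (fun x => by ring)
  filter_upwards [D.pos] with x hx
  have hP : P x ≠ 0 := fun h => by simp [h] at hx
  field_simp
  ring

/-- Splits the transformed metric into radial, mixed and tangential blocks, whose singular behaviour
differs: `G 0 0` is of order `r⁻⁴`, the tangential block of order `r⁻²`. -/
lemma newG_eq (i j : Fin (n + 1)) : ∀ᶠ x in l, newG T G i j x =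
    T 0 i x * T 0 j x * G 0 0 x + (∑ γ : Fin n, (T 0 i x * T γ.succ j x + T γ.succ i x * T 0 j x) *
      G 0 γ.succ x) + ∑ γ : Fin n, ∑ δ : Fin n, T γ.succ i x * T δ.succ j x *
        G γ.succ δ.succ x := by
  filter_upwards [eventually_all.2 D.symm] with x hx
  simp only [newG, Fin.sum_univ_succ, Finset.sum_add_distrib, add_mul]
  rw [Finset.sum_congr rfl fun γ _ => by rw [hx (Fin.succ γ)]]
  ring

lemma exp_quadratic {u v u₀ v₀ u₁ v₁ : Fin n → X → ℝ} (hu : ∀ γ, Exp2 l r (u γ) (u₀ γ) (u₁ γ))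
    (hv : ∀ γ, Exp2 l r (v γ) (v₀ γ) (v₁ γ)) :
    Exp2 l r (fun x => ∑ γ, ∑ δ, u γ x * v δ x * (r x ^ 2 * G γ.succ δ.succ x))
      (fun x => ∑ γ, ∑ δ, H₀ γ δ x * u₀ γ x * v₀ δ x)
      (fun x => ∑ γ, ∑ δ, ((H₁ γ δ x + K₀ γ δ x - 2 * s₀ x * H₀ γ δ x - 2 * w x * H₀ γ δ x) *
        u₀ γ x * v₀ δ x + H₀ γ δ x * u₁ γ x * v₀ δ x + H₀ γ δ x * u₀ γ x * v₁ δ x)) := by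
  have hr := D.tendsto
  refine (Exp2.sum fun γ _ => Exp2.sum fun δ _ =>
    ((hu γ).mul hr (hv δ)).mul hr (D.exp_G_y_y γ δ)).coef (fun x => ?_) fun x => ?_
  · exact Finset.sum_congr rfl fun γ _ => Finset.sum_congr rfl fun δ _ => by ring
  · exact Finset.sum_congr rfl fun γ _ => Finset.sum_congr rfl fun δ _ => by ring

/-- The old mixed components only feed the remainder, so they never enter the coefficients. -/
lemma isBigO_cross {u : Fin n → X → ℝ} (hu : ∀ γ, u γ =O[l] fun _ => (1 : ℝ)) :
    (fun x => ∑ γ : Fin n, u γ x * (r x ^ 2 * G 0 γ.succ x))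
      =O[l] fun x => r x ^ 2 * Real.log (r x) := by
  refine IsBigO.fun_sum fun γ _ => ?_
  simpa using (hu γ).mul (D.isBigO_G_rho_y γ)

lemma isBigO_T_zero_succ (α : Fin n) : T 0 α.succ =O[l] fun _ => (1 : ℝ) := by
  have h := ((D.exp_P_y α).isBigO_one D.tendsto).mul ((isBigO_coord_one D.tendsto).pow 2)
  refine h.congr' ?_ (.of_forall fun x => by simp)
  filter_upwards [D.pos] with x hx
  field_simp [hx.1.ne']

/-- The expansion of the `ρρ` component. -/
theorem exp_new_rho_rho : Exp3 l r (fun x => r x ^ 4 * newG T G 0 0 x) (fun _ => ν⁻¹)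
    (fun x => ν⁻¹ * (2 * s₀ x))
    (fun x => ν⁻¹ * (s₀ x ^ 2 + 2 * (c x - w x ^ 2 + w x * s₀ x + s₁ x)) +
      ∑ γ, ∑ δ, H₀ γ δ x * b γ x * b δ x) := by
  have hr := D.tendsto
  have h1 := (D.exp_P_rho.mul hr D.exp_P_rho).mul hr D.exp_G_rho_rho
  -- The tangential block is known after multiplication by `r²`; the two further factors `r` move
  -- its leading term `h(b, b)` to second order.
  have h2 := ((D.exp_quadratic D.exp_Y_rho D.exp_Y_rho).shift.toExp2 hr).shift
  have hT0 := D.exp_P_rho.isBigO_one hr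
  have h3 : Exp3 l r _ _ _ _ := Exp3.of_le (((isBigO_coord_one hr).mul
    ((isBigO_refl r l).mul (D.isBigO_cross (u := fun γ x => 2 * (T 0 0 x * T γ.succ 0 x))
      fun γ => (IsBigO_one_mul hT0 ((D.exp_Y_rho γ).isBigO_one hr)).const_mul_left 2))).congr_right
        (fun x => by ring))
  refine (((h1.add h3).add h2).congr ?_).coef (fun x => by ring) (fun x => by ring)
    (fun x => by ring)
  filter_upwards [D.newG_eq 0 0] with x hx
  rw [hx, mul_add, mul_add, Finset.mul_sum, Finset.mul_sum, Finset.mul_sum, Finset.mul_sum,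
    Finset.mul_sum, Finset.mul_sum]
  congr 1
  · congr 1
    · ring
    · exact Finset.sum_congr rfl fun γ _ => by ring
  · refine Finset.sum_congr rfl fun γ _ => ?_
    rw [Finset.mul_sum, Finset.mul_sum, Finset.mul_sum]
    exact Finset.sum_congr rfl fun δ _ => by ring

/-- The expansion of the `ρy` components. -/
theorem exp_new_rho_y (α : Fin n) : Exp2 l r (fun x => r x ^ 2 * newG T G 0 α.succ x)
    (fun x => ν⁻¹ * wd α x + ∑ γ, ∑ δ, H₀ γ δ x * b γ x * θ δ α x)
    (fun x => ν⁻¹ * (cd α x + (2 * s₀ x - 2 * w x) * wd α x) +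
      ∑ γ, ∑ δ, ((H₁ γ δ x + K₀ γ δ x - 2 * s₀ x * H₀ γ δ x - 2 * w x * H₀ γ δ x) *
        b γ x * θ δ α x + H₀ γ δ x * b' γ x * θ δ α x + H₀ γ δ x * b γ x * bd δ α x)) := by
  have hr := D.tendsto
  -- `∂_α P` is of order `r²`, which exactly compensates the singularity: `r² T₀₀ T₀_α G₀₀ = T₀₀
  -- (T₀_α / r²) (r⁴ G₀₀)`.
  have h1 := ((D.exp_P_rho.toExp2 hr).mul hr (D.exp_P_y α)).mul hr (D.exp_G_rho_rho.toExp2 hr)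
  have h2 := D.exp_quadratic D.exp_Y_rho (v := fun δ => T δ.succ α.succ)
    fun δ => D.exp_Y_y δ α
  have hT0 := D.exp_P_rho.isBigO_one hr
  have h3 := Exp2.of_le (D.isBigO_cross
    (u := fun γ x => T 0 0 x * T γ.succ α.succ x + T γ.succ 0 x * T 0 α.succ x)
      fun γ => (IsBigO_one_mul hT0 ((D.exp_Y_y γ α).isBigO_one hr)).add
        (IsBigO_one_mul ((D.exp_Y_rho γ).isBigO_one hr) (D.isBigO_T_zero_succ α)))
  refine (((h1.add h3).add h2).congr ?_).coef (fun x => by ring) (fun x => by ring)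
  filter_upwards [D.newG_eq 0 α.succ, D.pos] with x hx hpos
  rw [hx, mul_add, mul_add, Finset.mul_sum, Finset.mul_sum]
  congr 1
  · congr 1
    · field_simp [hpos.1.ne']
    · exact Finset.sum_congr rfl fun γ _ => by ring
  · refine Finset.sum_congr rfl fun γ _ => ?_
    rw [Finset.mul_sum]
    exact Finset.sum_congr rfl fun δ _ => by ring

/-- The expansion of the `yy` components. -/
theorem exp_new_y_y (α β : Fin n) : Exp2 l r (fun x => r x ^ 2 * newG T G α.succ β.succ x)
    (fun x => ∑ γ, ∑ δ, H₀ γ δ x * θ γ α x * θ δ β x)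
    (fun x => ∑ γ, ∑ δ, ((H₁ γ δ x + K₀ γ δ x - 2 * s₀ x * H₀ γ δ x - 2 * w x * H₀ γ δ x) *
        θ γ α x * θ δ β x + H₀ γ δ x * bd γ α x * θ δ β x + H₀ γ δ x * θ γ α x * bd δ β x)) := by
  have hr := D.tendsto
  -- Here both Jacobian factors are of order `r²`, so the radial block has an overall factor `r²`
  -- and is absorbed in the remainder.
  have h1 := ((((D.exp_P_y α).mul hr (D.exp_P_y β)).mul hr
    (D.exp_G_rho_rho.toExp2 hr)).shift.toExp2 hr).shift.toExp2 hr
  have h2 := D.exp_quadratic (u := fun δ => T δ.succ α.succ) (v := fun δ => T δ.succ β.succ)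
    (fun δ => D.exp_Y_y δ α) fun δ => D.exp_Y_y δ β
  have h3 := Exp2.of_le (D.isBigO_cross
    (u := fun γ x => T 0 α.succ x * T γ.succ β.succ x + T γ.succ α.succ x * T 0 β.succ x)
      fun γ => (IsBigO_one_mul (D.isBigO_T_zero_succ α) ((D.exp_Y_y γ β).isBigO_one hr)).add
        (IsBigO_one_mul ((D.exp_Y_y γ α).isBigO_one hr) (D.isBigO_T_zero_succ β)))
  refine (((h1.add h3).add h2).congr ?_).coef (fun x => by ring) (fun x => by ring)
  filter_upwards [D.newG_eq α.succ β.succ, D.pos] with x hx hpos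
  rw [hx, mul_add, mul_add, Finset.mul_sum, Finset.mul_sum]
  congr 1
  · congr 1
    · field_simp [hpos.1.ne']
    · exact Finset.sum_congr rfl fun γ _ => by ring
  · refine Finset.sum_congr rfl fun γ _ => ?_
    rw [Finset.mul_sum]
    exact Finset.sum_congr rfl fun δ _ => by ring

end TransitionExpansion

end Transformation

/-! ### Charts of a manifold with boundary -/

section Charts

variable {n : ℕ} {M : Type*} [TopologicalSpace M] [ChartedSpace (EuclideanHalfSpace (n + 1)) M]
variable {φ φ' : OpenPartialHomeomorph M (EuclideanHalfSpace (n + 1))} {O : Set M} {x q : M}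

/-- The coordinates `(ρ, y)` of a point. -/
def co (φ : OpenPartialHomeomorph M (EuclideanHalfSpace (n + 1))) (x : M) : E (n + 1) := (φ x).1

/-- The point with given coordinates. -/
def coInv (φ : OpenPartialHomeomorph M (EuclideanHalfSpace (n + 1))) (z : E (n + 1)) : M :=
  φ.symm ((𝓡∂ (n + 1)).symm z)

/-- An open set of `ℝⁿ⁺¹` whose intersection with the half space is the image of `O`. -/
def coordDom (φ : OpenPartialHomeomorph M (EuclideanHalfSpace (n + 1))) (O : Set M) :
    Set (E (n + 1)) := (𝓡∂ (n + 1)).symm ⁻¹' (φ.target ∩ φ.symm ⁻¹' O)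

lemma co_zero : co φ x 0 = rhoOf φ x := rfl

lemma tl_co : tl (co φ x) = yOf φ x := rfl

lemma co_succ (α : Fin n) : co φ x α.succ = yOf φ x α := rfl

lemma pair_co : pair (rhoOf φ x) (yOf φ x) = co φ x := pair_tl (co φ x)

lemma co_mem_HS : co φ x ∈ HS n := (φ x).2

lemma model_symm_coe (w : EuclideanHalfSpace (n + 1)) : (𝓡∂ (n + 1)).symm w.1 = w :=
  (𝓡∂ (n + 1)).left_inv w

lemma model_coe_symm {z : E (n + 1)} (hz : z ∈ HS n) : ((𝓡∂ (n + 1)).symm z).1 = z :=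
  (𝓡∂ (n + 1)).right_inv (by rwa [HS_eq_range] at hz)

lemma coInv_co (hx : x ∈ φ.source) : coInv φ (co φ x) = x := by
  rw [coInv, co, model_symm_coe, φ.left_inv hx]

lemma isOpen_coordDom (hO : IsOpen O) : IsOpen (coordDom φ O) :=
  (φ.isOpen_inter_preimage_symm hO).preimage (𝓡∂ (n + 1)).continuous_symm

lemma co_mem_coordDom (hx : x ∈ φ.source) (hO : x ∈ O) : co φ x ∈ coordDom φ O := by
  rw [coordDom, mem_preimage, co, model_symm_coe]
  exact ⟨φ.map_source hx, by rwa [mem_preimage, φ.left_inv hx]⟩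

lemma coInv_mem {z : E (n + 1)} (hz : z ∈ coordDom φ O) : coInv φ z ∈ O := hz.2

lemma coInv_mem_source {z : E (n + 1)} (hz : z ∈ coordDom φ O) : coInv φ z ∈ φ.source :=
  φ.map_target hz.1

lemma co_coInv {z : E (n + 1)} (hz : z ∈ coordDom φ O ∩ HS n) : co φ (coInv φ z) = z := by
  rw [co, coInv, φ.right_inv hz.1.1, model_coe_symm hz.2]

lemma continuousOn_co : ContinuousOn (co φ) φ.source :=
  continuous_subtype_val.comp_continuousOn φ.continuousOn

lemma continuousAt_co (hx : x ∈ φ.source) : ContinuousAt (co φ) x :=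
  continuousOn_co.continuousAt (φ.open_source.mem_nhds hx)

lemma continuousAt_rhoOf (hx : x ∈ φ.source) : ContinuousAt (rhoOf φ) x :=
  (contDiff_coord (m := 0) (0 : Fin (n + 1))).continuous.continuousAt.comp (continuousAt_co hx)

lemma continuousAt_yOf (hx : x ∈ φ.source) : ContinuousAt (yOf φ) x :=
  (contDiff_tl (m := 0)).continuous.continuousAt.comp (continuousAt_co hx)

lemma tendsto_co (hx : x ∈ φ.source) : Tendsto (co φ) (𝓝 x) (𝓝[HS n] (co φ x)) :=
  tendsto_nhdsWithin_iff.2 ⟨continuousAt_co hx, .of_forall fun _ => co_mem_HS⟩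

lemma tendsto_coInv (hx : x ∈ φ.source) : Tendsto (coInv φ) (𝓝 (co φ x)) (𝓝 x) := by
  have h1 : Tendsto (𝓡∂ (n + 1)).symm (𝓝 (co φ x)) (𝓝 (φ x)) := by
    have := (𝓡∂ (n + 1)).continuous_symm.tendsto (co φ x)
    rwa [co, model_symm_coe] at this
  have h2 := (φ.symm.continuousAt (φ.map_source hx)).tendsto
  rw [φ.left_inv hx] at h2
  exact h2.comp h1

lemma isOpen_overlap : IsOpen (φ.source ∩ φ'.source) := φ.open_source.inter φ'.open_source

variable [IsManifold (𝓡∂ (n + 1)) ∞ M]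

lemma isInteriorPoint_model_iff (w : EuclideanHalfSpace (n + 1)) :
    (𝓡∂ (n + 1)).IsInteriorPoint w ↔ 0 < w.1 0 := by
  change extChartAt (𝓡∂ (n + 1)) w w ∈ interior (range (𝓡∂ (n + 1))) ↔ _
  rw [interior_range_modelWithCornersEuclideanHalfSpace]
  rfl

/-- Makes the notions of interior and boundary point independent of the chart: local diffeomorphisms
preserve them, so they can be read off from the sign of `ρ` in any chart of the maximal atlas. -/
lemma isLocalDiffeomorphAt_chart (hφ : φ ∈ IsManifold.maximalAtlas (𝓡∂ (n + 1)) ∞ M)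
    (hx : x ∈ φ.source) : IsLocalDiffeomorphAt (𝓡∂ (n + 1)) (𝓡∂ (n + 1)) ∞ φ x :=
  ⟨{ toPartialEquiv := φ.toPartialEquiv
     open_source := φ.open_source
     open_target := φ.open_target
     contMDiffOn_toFun := contMDiffOn_of_mem_maximalAtlas hφ
     contMDiffOn_invFun := contMDiffOn_symm_of_mem_maximalAtlas hφ }, hx, fun _ _ => rfl⟩

lemma mem_Inn_iff (hφ : φ ∈ IsManifold.maximalAtlas (𝓡∂ (n + 1)) ∞ M) (hx : x ∈ φ.source) :
    x ∈ Inn n M ↔ 0 < rhoOf φ x := by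
  exact ((isLocalDiffeomorphAt_chart hφ hx).isInteriorPoint_iff (by simp)).trans (isInteriorPoint_model_iff _)

lemma mem_Bdry_iff (hφ : φ ∈ IsManifold.maximalAtlas (𝓡∂ (n + 1)) ∞ M) (hx : x ∈ φ.source) :
    x ∈ Bdry n M ↔ rhoOf φ x = 0 := by
  have h0 : 0 ≤ rhoOf φ x := (φ x).2
  have h1 : x ∈ Bdry n M ↔ ¬ x ∈ Inn n M :=
    (𝓡∂ (n + 1)).isBoundaryPoint_iff_not_isInteriorPoint x
  rw [h1, mem_Inn_iff hφ hx, not_lt]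
  exact ⟨fun h => le_antisymm h h0, fun h => h.le⟩

lemma co_boundary (hφ : φ ∈ IsManifold.maximalAtlas (𝓡∂ (n + 1)) ∞ M)
    (hq : q ∈ φ.source ∩ Bdry n M) : co φ q = pair 0 (yOf φ q) := by
  rw [← pair_co, (mem_Bdry_iff hφ hq.1).1 hq.2]

lemma coInv_pair_mem_Bdry (hφ : φ ∈ IsManifold.maximalAtlas (𝓡∂ (n + 1)) ∞ M) {v : E n}
    (hv : pair 0 v ∈ coordDom φ O) : coInv φ (pair 0 v) ∈ Bdry n M := by
  rw [mem_Bdry_iff hφ (coInv_mem_source hv), ← co_zero,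
    co_coInv ⟨hv, pair_mem_HS le_rfl v⟩, pair_zero]

lemma yOf_coInv_pair {v : E n} {t : ℝ} (ht : 0 ≤ t)
    (hv : pair t v ∈ coordDom φ O) : yOf φ (coInv φ (pair t v)) = v := by
  rw [← tl_co, co_coInv ⟨hv, pair_mem_HS ht v⟩, tl_pair]

/-- A smooth function in coordinates. -/
lemma contDiffOn_comp_coInv {V : Type*} [NormedAddCommGroup V] [NormedSpace ℝ V] {f : M → V}
    (hφ : φ ∈ IsManifold.maximalAtlas (𝓡∂ (n + 1)) ∞ M)
    (hf : ContMDiffOn (𝓡∂ (n + 1)) 𝓘(ℝ, V) ∞ f O) :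
    ContDiffOn ℝ ∞ (fun z => f (coInv φ z)) (coordDom φ O ∩ HS n) := by
  rw [← contMDiffOn_iff_contDiffOn]
  refine hf.comp ((contMDiffOn_extend_symm hφ).mono ?_) fun z hz => coInv_mem hz.1
  intro z hz
  exact ⟨_, hz.1.1, model_coe_symm hz.2⟩

lemma contMDiffOn_co (hφ : φ ∈ IsManifold.maximalAtlas (𝓡∂ (n + 1)) ∞ M) :
    ContMDiffOn (𝓡∂ (n + 1)) 𝓘(ℝ, E (n + 1)) ∞ (co φ) φ.source :=
  OpenPartialHomeomorph.contMDiffOn_extend hφ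

lemma contMDiffOn_rhoOf (hφ : φ ∈ IsManifold.maximalAtlas (𝓡∂ (n + 1)) ∞ M) :
    ContMDiffOn (𝓡∂ (n + 1)) 𝓘(ℝ, ℝ) ∞ (rhoOf φ) φ.source :=
  (contDiff_coord (0 : Fin (n + 1))).contMDiff.comp_contMDiffOn (contMDiffOn_co hφ)

lemma contMDiffOn_yOf (hφ : φ ∈ IsManifold.maximalAtlas (𝓡∂ (n + 1)) ∞ M) :
    ContMDiffOn (𝓡∂ (n + 1)) 𝓘(ℝ, E n) ∞ (yOf φ) φ.source :=
  contDiff_tl.contMDiff.comp_contMDiffOn (contMDiffOn_co hφ)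

lemma contMDiffAt_rhoOf (hφ : φ ∈ IsManifold.maximalAtlas (𝓡∂ (n + 1)) ∞ M) (hx : x ∈ φ.source) :
    ContMDiffAt (𝓡∂ (n + 1)) 𝓘(ℝ, ℝ) ∞ (rhoOf φ) x :=
  (contMDiffOn_rhoOf hφ).contMDiffAt (φ.open_source.mem_nhds hx)

/-! ### The filter of interior neighbourhoods of a boundary point -/

lemma tendsto_rhoOf (hφ : φ ∈ IsManifold.maximalAtlas (𝓡∂ (n + 1)) ∞ M)
    (hq : q ∈ φ.source ∩ Bdry n M) : Tendsto (rhoOf φ) (𝓝[Inn n M] q) (𝓝[>] 0) := by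
  refine tendsto_nhdsWithin_iff.2 ⟨?_, ?_⟩
  · have := (continuousAt_rhoOf hq.1).tendsto.mono_left (nhdsWithin_le_nhds (s := Inn n M))
    rwa [(mem_Bdry_iff hφ hq.1).1 hq.2] at this
  · filter_upwards [self_mem_nhdsWithin, nhdsWithin_le_nhds (φ.open_source.mem_nhds hq.1)]
      with x hx hx'
    exact (mem_Inn_iff hφ hx').1 hx

/-- The normal ray through a boundary point. -/
lemma tendsto_ray (hφ : φ ∈ IsManifold.maximalAtlas (𝓡∂ (n + 1)) ∞ M)
    (hq : q ∈ φ.source ∩ Bdry n M) :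
    Tendsto (fun t => coInv φ (pair t (yOf φ q))) (𝓝[>] 0) (𝓝[Inn n M] q) ∧
    ∀ᶠ t in 𝓝[>] 0, co φ (coInv φ (pair t (yOf φ q))) = pair t (yOf φ q) := by
  have hc : Tendsto (fun t => pair t (yOf φ q)) (𝓝[>] 0) (𝓝 (co φ q)) := by
    rw [co_boundary hφ hq]
    have : Continuous fun t => pair t (yOf φ q) := by
      rw [show (fun t => pair t (yOf φ q)) = fun t =>
        t • (EuclideanSpace.single 0 1 : E (n + 1)) + pair 0 (yOf φ q) from
        funext fun t => pair_eq t _]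
      fun_prop
    exact (this.tendsto 0).mono_left nhdsWithin_le_nhds
  have hU : ∀ᶠ t in 𝓝[>] 0, pair t (yOf φ q) ∈ coordDom φ φ.source :=
    hc.eventually ((isOpen_coordDom φ.open_source).mem_nhds (co_mem_coordDom hq.1 hq.1))
  have hco : ∀ᶠ t in 𝓝[>] 0, co φ (coInv φ (pair t (yOf φ q))) = pair t (yOf φ q) := by
    filter_upwards [hU, self_mem_nhdsWithin] with t ht ht0
    exact co_coInv ⟨ht, pair_mem_HS (le_of_lt ht0) _⟩
  refine ⟨tendsto_nhdsWithin_iff.2 ⟨(tendsto_coInv hq.1).comp hc, ?_⟩, hco⟩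
  filter_upwards [hU, hco, self_mem_nhdsWithin] with t ht h1 ht0
  rw [mem_Inn_iff hφ (coInv_mem_source ht), ← co_zero, h1]
  exact ht0

/-- Normal Taylor expansion seen on `M`: the coefficients are evaluated at the foot `(0, y)` of the
normal through `x`, so they are functions of `y` alone. -/
lemma exp2_comp {F : E (n + 1) → ℝ} {U : Set (E (n + 1))}
    (hφ : φ ∈ IsManifold.maximalAtlas (𝓡∂ (n + 1)) ∞ M) (hq : q ∈ φ.source ∩ Bdry n M)
    (hU : IsOpen U) (hF : ContDiffOn ℝ ∞ F (U ∩ HS n)) (hqU : co φ q ∈ U) :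
    Exp2 (𝓝[Inn n M] q) (rhoOf φ) (fun x => F (co φ x)) (fun x => F (pair 0 (yOf φ x)))
      (fun x => dd 0 F (pair 0 (yOf φ x))) := by
  rw [co_boundary hφ hq] at hqU
  have ht : Tendsto (co φ) (𝓝[Inn n M] q) (𝓝[HS n] (pair 0 (yOf φ q))) := by
    rw [← co_boundary hφ hq]
    exact (tendsto_co hq.1).mono_left nhdsWithin_le_nhds
  have hb : ∀ {F : E (n + 1) → ℝ}, ContDiffOn ℝ ∞ F (U ∩ HS n) →
      (fun x => F (pair 0 (yOf φ x))) =O[𝓝[Inn n M] q] fun _ => (1 : ℝ) := fun {F} hF => by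
    have h1 : ContinuousWithinAt F (HS n) (pair 0 (yOf φ q)) :=
      (contDiffWithinAt_HS hF hU ⟨hqU, pair_mem_HS le_rfl _⟩).continuousWithinAt
    have h2 : Tendsto (fun x => pair 0 (yOf φ x)) (𝓝[Inn n M] q)
        (𝓝[HS n] (pair 0 (yOf φ q))) := by
      refine tendsto_nhdsWithin_iff.2 ⟨?_, .of_forall fun x => pair_mem_HS le_rfl _⟩
      exact ((contDiff_pair_zero (m := 0)).continuous.continuousAt.comp
        (continuousAt_yOf hq.1)).tendsto.mono_left nhdsWithin_le_nhds
    exact (h1.tendsto.comp h2).isBigO_one ℝ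
  refine Exp2.of_isBigO (tendsto_rhoOf hφ hq) ?_ (hb hF) (hb (contDiffOn_dd hF hU 0))
  refine ((taylor_normal hU hF hqU 2).comp_tendsto ht).congr_left fun x => ?_
  simp [Finset.sum_range_succ, co_zero, tl_co, mul_comm]

end Charts

/-! ### Coordinate vector fields under a change of chart -/

section CoordVec

variable {n : ℕ} {M : Type*} [TopologicalSpace M] [ChartedSpace (EuclideanHalfSpace (n + 1)) M]
variable {φ φ' : OpenPartialHomeomorph M (EuclideanHalfSpace (n + 1))} {O : Set M} {x q : M}
variable [IsManifold (𝓡∂ (n + 1)) ∞ M]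

/-- Needed because `coordVec` is defined by `ContinuousLinearMap.inverse`, which is meaningful only
for invertible maps. -/
lemma isInvertible_mfderiv_co (hφ : φ ∈ IsManifold.maximalAtlas (𝓡∂ (n + 1)) ∞ M)
    (hx : x ∈ φ.source) :
    (mfderiv (𝓡∂ (n + 1)) 𝓘(ℝ, E (n + 1)) (φ.extend (𝓡∂ (n + 1))) x).IsInvertible := by
  have h := isLocalDiffeomorphAt_chart hφ hx
  have h1 : HasMFDerivAt (𝓡∂ (n + 1)) 𝓘(ℝ, E (n + 1)) (φ.extend (𝓡∂ (n + 1))) x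
      (mfderiv (𝓡∂ (n + 1)) (𝓡∂ (n + 1)) φ x) :=
    ((𝓡∂ (n + 1)).hasMFDerivAt (x := φ x)).comp x (h.mdifferentiableAt (by simp)).hasMFDerivAt
  rw [h1.mfderiv]
  exact ⟨h.mfderivToContinuousLinearEquiv (by simp), rfl⟩

/-- The transition map between two charts. -/
def trans (φ φ' : OpenPartialHomeomorph M (EuclideanHalfSpace (n + 1))) (a : Fin (n + 1))
    (z : E (n + 1)) : ℝ := co φ' (coInv φ z) a

lemma contDiffOn_trans_vec (hφ : φ ∈ IsManifold.maximalAtlas (𝓡∂ (n + 1)) ∞ M)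
    (hφ' : φ' ∈ IsManifold.maximalAtlas (𝓡∂ (n + 1)) ∞ M) (hO : O ⊆ φ'.source) :
    ContDiffOn ℝ ∞ (fun z => co φ' (coInv φ z)) (coordDom φ O ∩ HS n) :=
  contDiffOn_comp_coInv hφ ((contMDiffOn_co hφ').mono hO)

lemma contDiffOn_trans (hφ : φ ∈ IsManifold.maximalAtlas (𝓡∂ (n + 1)) ∞ M)
    (hφ' : φ' ∈ IsManifold.maximalAtlas (𝓡∂ (n + 1)) ∞ M) (hO : O ⊆ φ'.source)
    (a : Fin (n + 1)) : ContDiffOn ℝ ∞ (trans φ φ' a) (coordDom φ O ∩ HS n) :=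
  (contDiff_coord a).comp_contDiffOn (contDiffOn_trans_vec hφ hφ' hO)

/-- By the chain rule the differentials `A`, `A'` of the two charts satisfy `A' = L ∘ A`, with `L`
the derivative of the transition map; hence `A'` sends `A⁻¹ e_i` to `L e_i`, and applying `A'⁻¹`
gives the claim. -/
lemma coordVec_eq (hφ : φ ∈ IsManifold.maximalAtlas (𝓡∂ (n + 1)) ∞ M)
    (hφ' : φ' ∈ IsManifold.maximalAtlas (𝓡∂ (n + 1)) ∞ M) (hx : x ∈ φ.source ∩ φ'.source)
    (i : Fin (n + 1)) :
    coordVec φ x i = ∑ a, dd i (trans φ φ' a) (co φ x) • coordVec φ' x a := by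
  have hA := isInvertible_mfderiv_co hφ hx.1
  have hA' := isInvertible_mfderiv_co hφ' hx.2
  have hz : co φ x ∈ coordDom φ φ'.source ∩ HS n := ⟨co_mem_coordDom hx.1 hx.2, co_mem_HS⟩
  have hT : DifferentiableWithinAt ℝ (fun z => co φ' (coInv φ z)) (HS n) (co φ x) :=
    differentiableWithinAt_HS (contDiffOn_trans_vec hφ hφ' le_rfl)
      (isOpen_coordDom φ'.open_source) hz
  set L := fderivWithin ℝ (fun z => co φ' (coInv φ z)) (HS n) (co φ x) with hL
  have hdd : ∀ a, dd i (trans φ φ' a) (co φ x) = L (EuclideanSpace.single i 1) a := fun a => by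
    have : HasFDerivWithinAt (trans φ φ' a)
        ((EuclideanSpace.proj (𝕜 := ℝ) a).comp L) (HS n) (co φ x) :=
      (EuclideanSpace.proj (𝕜 := ℝ) a).hasFDerivAt.comp_hasFDerivWithinAt _ hT.hasFDerivWithinAt
    rw [dd, this.fderivWithin (uniqueDiffOn_HS _ hz.2)]
    rfl
  have hcomp : mfderiv (𝓡∂ (n + 1)) 𝓘(ℝ, E (n + 1)) (φ'.extend (𝓡∂ (n + 1))) x =
      L.comp (mfderiv (𝓡∂ (n + 1)) 𝓘(ℝ, E (n + 1)) (φ.extend (𝓡∂ (n + 1))) x) := by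
    have h1 : HasMFDerivWithinAt 𝓘(ℝ, E (n + 1)) 𝓘(ℝ, E (n + 1))
        (fun z => co φ' (coInv φ z)) (HS n) (φ.extend (𝓡∂ (n + 1)) x) L :=
      hT.hasFDerivWithinAt.hasMFDerivWithinAt
    have h2 : HasMFDerivAt (𝓡∂ (n + 1)) 𝓘(ℝ, E (n + 1)) (φ.extend (𝓡∂ (n + 1))) x
        (mfderiv (𝓡∂ (n + 1)) 𝓘(ℝ, E (n + 1)) (φ.extend (𝓡∂ (n + 1))) x) :=
      ((φ.contMDiffAt_extend hφ hx.1).mdifferentiableAt (by simp)).hasMFDerivAt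
    have h3 := h1.comp x h2.hasMFDerivWithinAt (s := univ) fun y _ => co_mem_HS
    rw [hasMFDerivWithinAt_univ] at h3
    refine (h3.congr_of_eventuallyEq ?_).mfderiv
    filter_upwards [φ.open_source.mem_nhds hx.1] with y hy
    exact (congrArg (co φ') (coInv_co hy)).symm
  set A := mfderiv (𝓡∂ (n + 1)) 𝓘(ℝ, E (n + 1)) (φ.extend (𝓡∂ (n + 1))) x with hAdef
  set A' := mfderiv (𝓡∂ (n + 1)) 𝓘(ℝ, E (n + 1)) (φ'.extend (𝓡∂ (n + 1))) x with hAdef'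
  have h1 : A' (A.inverse (EuclideanSpace.single i 1 : E (n + 1))) =
      L (EuclideanSpace.single i 1) := by
    rw [hcomp]
    exact congrArg L (hA.self_apply_inverse _)
  have h2 : L (EuclideanSpace.single i 1) =
      ∑ a, dd i (trans φ φ' a) (co φ x) • (EuclideanSpace.single a 1 : E (n + 1)) := by
    ext b
    simp [hdd, Pi.single_apply]
  have h3 : coordVec φ x i = A'.inverse (A' (coordVec φ x i)) := (hA'.inverse_apply_self _).symm
  rw [h3]
  have h4 : A' (coordVec φ x i) = ∑ a, dd i (trans φ φ' a) (co φ x) •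
      (EuclideanSpace.single a 1 : E (n + 1)) := h1.trans h2
  rw [h4]
  have h5 : ∀ (B : E (n + 1) →L[ℝ] TangentSpace (𝓡∂ (n + 1)) x) (c : Fin (n + 1) → ℝ),
      B (∑ a, c a • (EuclideanSpace.single a 1 : E (n + 1))) =
        ∑ a, c a • B (EuclideanSpace.single a 1) := fun B c => by
    rw [map_sum]
    exact Finset.sum_congr rfl fun a _ => map_smul _ _ _
  exact h5 A'.inverse _

/-- The components of the physical metric. -/
def comp (ghat : BilinField n M) (φ : OpenPartialHomeomorph M (EuclideanHalfSpace (n + 1)))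
    (i j : Fin (n + 1)) (x : M) : ℝ := ghat x (coordVec φ x i) (coordVec φ x j)

lemma rescaled_eq (ghat : BilinField n M) (i j : Fin (n + 1)) :
    rescaled ghat φ i j x = rhoOf φ x ^ 2 * comp ghat φ i j x := rfl

lemma comp_eq_newG (ghat : BilinField n M)
    (hφ : φ ∈ IsManifold.maximalAtlas (𝓡∂ (n + 1)) ∞ M)
    (hφ' : φ' ∈ IsManifold.maximalAtlas (𝓡∂ (n + 1)) ∞ M) (hx : x ∈ φ.source ∩ φ'.source)
    (i j : Fin (n + 1)) :
    comp ghat φ i j x = newG (fun a i x => dd i (trans φ φ' a) (co φ x)) (comp ghat φ') i j x := by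
  rw [comp, coordVec_eq hφ hφ' hx i, coordVec_eq hφ hφ' hx j, newG]
  simp only [map_sum, map_smul, sum_apply, smul_apply, smul_eq_mul, comp, Finset.mul_sum]
  rw [Finset.sum_comm]
  exact Finset.sum_congr rfl fun a _ => Finset.sum_congr rfl fun b _ => by ring

end CoordVec

/-! ### Partial derivatives and the chain rule -/

section PartialDerivatives

variable {n : ℕ} {f g : E n → ℝ} {v : E n}

lemma pd_congr (α : Fin n) (h : f =ᶠ[𝓝 v] g) : pd α f v = pd α g v := by
  rw [pd, h.fderiv_eq, pd]

lemma pd_const (α : Fin n) (a : ℝ) : pd α (fun _ => a) v = 0 := by simp [pd]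

lemma pd_const_mul (α : Fin n) (a : ℝ) : pd α (fun y => a * f y) v = a * pd α f v := by
  have : (fun y => a * f y) = a • f := rfl
  rw [pd, this, fderiv_const_smul_field]
  rfl

lemma contDiffOn_pd {U : Set (E n)} (hU : IsOpen U) (hf : ContDiffOn ℝ ∞ f U) (α : Fin n) :
    ContDiffOn ℝ ∞ (pd α f) U :=
  (hf.fderiv_of_isOpen hU (m := ∞) (by simp)).clm_apply
    (contDiffOn_const (c := EuclideanSpace.single α (1 : ℝ)))

lemma dd_comp {Y : E (n + 1) → E n} {z : E (n + 1)} (i : Fin (n + 1)) (hz : z ∈ HS n)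
    (hf : DifferentiableAt ℝ f (Y z)) (hY : DifferentiableWithinAt ℝ Y (HS n) z) :
    dd i (fun u => f (Y u)) z = ∑ γ, pd γ f (Y z) * dd i (fun u => Y u γ) z := by
  have h1 : HasFDerivWithinAt (fun u => f (Y u)) _ (HS n) z :=
    hf.hasFDerivAt.comp_hasFDerivWithinAt z hY.hasFDerivWithinAt
  have h2 : ∀ γ : Fin n, dd i (fun u => Y u γ) z =
      fderivWithin ℝ Y (HS n) z (EuclideanSpace.single i 1) γ := fun γ => by
    have : HasFDerivWithinAt (fun u => Y u γ) ((EuclideanSpace.proj (𝕜 := ℝ) γ).comp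
        (fderivWithin ℝ Y (HS n) z)) (HS n) z :=
      (EuclideanSpace.proj (𝕜 := ℝ) γ).hasFDerivAt.comp_hasFDerivWithinAt _ hY.hasFDerivWithinAt
    rw [dd, this.fderivWithin (uniqueDiffOn_HS _ hz)]
    rfl
  rw [dd, h1.fderivWithin (uniqueDiffOn_HS _ hz)]
  set u := fderivWithin ℝ Y (HS n) z (EuclideanSpace.single i 1) with hu
  have h3 : u = ∑ γ, u γ • (EuclideanSpace.single γ 1 : E n) := by
    ext b
    simp [Pi.single_apply]
  rw [ContinuousLinearMap.comp_apply, ← hu, h3, map_sum]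
  refine Finset.sum_congr rfl fun γ _ => ?_
  rw [map_smul, h2 γ, smul_eq_mul, mul_comm, pd]

end PartialDerivatives

/-! ### Normal jets of transition maps and the resulting expansions -/

section BoundaryJets

variable {n : ℕ} {M : Type*} [TopologicalSpace M] [ChartedSpace (EuclideanHalfSpace (n + 1)) M]
variable {φ φ' : OpenPartialHomeomorph M (EuclideanHalfSpace (n + 1))} {O : Set M} {x q : M}
variable [IsManifold (𝓡∂ (n + 1)) ∞ M]

lemma image_boundary_eq (hφ : φ ∈ IsManifold.maximalAtlas (𝓡∂ (n + 1)) ∞ M)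
    (hO : O ⊆ φ.source) : yOf φ '' (O ∩ Bdry n M) = pair 0 ⁻¹' coordDom φ O := by
  ext v
  constructor
  · rintro ⟨x, hx, rfl⟩
    rw [mem_preimage, ← co_boundary hφ ⟨hO hx.1, hx.2⟩]
    exact co_mem_coordDom (hO hx.1) hx.1
  · intro hv
    exact ⟨coInv φ (pair 0 v), ⟨coInv_mem hv, coInv_pair_mem_Bdry hφ hv⟩,
      yOf_coInv_pair le_rfl hv⟩

lemma isOpen_image_boundary (hφ : φ ∈ IsManifold.maximalAtlas (𝓡∂ (n + 1)) ∞ M)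
    (hO : IsOpen O) (hO' : O ⊆ φ.source) : IsOpen (yOf φ '' (O ∩ Bdry n M)) := by
  rw [image_boundary_eq hφ hO']
  exact (isOpen_coordDom hO).preimage (contDiff_pair_zero (m := 0)).continuous

lemma isOpen_bdryImage (hφ : φ ∈ IsManifold.maximalAtlas (𝓡∂ (n + 1)) ∞ M) :
    IsOpen (bdryImage φ) := isOpen_image_boundary hφ φ.open_source le_rfl

lemma yOf_mem_bdryImage (hq : q ∈ φ.source ∩ Bdry n M) : yOf φ q ∈ bdryImage φ :=
  mem_image_of_mem _ hq

/-- Data on the normal derivatives at the boundary of a transition map. -/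
structure TransitionJets (φ φ' : OpenPartialHomeomorph M (EuclideanHalfSpace (n + 1)))
    (O : Set M) (w c : E n → ℝ) (θ : E n → E n) (b b' : Fin n → E n → ℝ) : Prop where
  mem : φ ∈ IsManifold.maximalAtlas (𝓡∂ (n + 1)) ∞ M
  mem' : φ' ∈ IsManifold.maximalAtlas (𝓡∂ (n + 1)) ∞ M
  isOpen : IsOpen O
  sub : O ⊆ φ.source ∩ φ'.source
  rho_one : ∀ v, pair 0 v ∈ coordDom φ O → dd 0 (trans φ φ' 0) (pair 0 v) = 1
  rho_two : ∀ v, pair 0 v ∈ coordDom φ O → dd 0 (dd 0 (trans φ φ' 0)) (pair 0 v) = 2 * w v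
  rho_three : ∀ v, pair 0 v ∈ coordDom φ O →
    dd 0 (dd 0 (dd 0 (trans φ φ' 0))) (pair 0 v) = 6 * c v
  y_zero : ∀ v, pair 0 v ∈ coordDom φ O → ∀ γ, trans φ φ' γ.succ (pair 0 v) = θ v γ
  y_one : ∀ v, pair 0 v ∈ coordDom φ O → ∀ γ, dd 0 (trans φ φ' γ.succ) (pair 0 v) = b γ v
  y_two : ∀ v, pair 0 v ∈ coordDom φ O → ∀ γ,
    dd 0 (dd 0 (trans φ φ' γ.succ)) (pair 0 v) = b' γ v

lemma trans_co (hx : x ∈ φ.source) (a : Fin (n + 1)) : trans φ φ' a (co φ x) = co φ' x a := by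
  rw [trans, coInv_co hx]

lemma trans_zero_boundary (hφ : φ ∈ IsManifold.maximalAtlas (𝓡∂ (n + 1)) ∞ M)
    (hφ' : φ' ∈ IsManifold.maximalAtlas (𝓡∂ (n + 1)) ∞ M) (hO : O ⊆ φ'.source)
    {v : E n} (hv : pair 0 v ∈ coordDom φ O) : trans φ φ' 0 (pair 0 v) = 0 :=
  (mem_Bdry_iff hφ' (hO (coInv_mem hv))).1 (coInv_pair_mem_Bdry hφ hv)

/-- The jet identities are available only on the boundary part of `O`; near `q` the foot of each
normal lies there, so they may be used at nearby interior points. -/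
lemma eventually_pair_mem (hφ : φ ∈ IsManifold.maximalAtlas (𝓡∂ (n + 1)) ∞ M)
    (hO : IsOpen O) (hO' : O ⊆ φ.source) (hq : q ∈ O ∩ Bdry n M) :
    ∀ᶠ x in 𝓝 q, pair 0 (yOf φ x) ∈ coordDom φ O := by
  have h := (continuousAt_yOf (φ := φ) (hO' hq.1)).eventually_mem
    ((isOpen_image_boundary hφ hO hO').mem_nhds (mem_image_of_mem _ hq))
  rw [image_boundary_eq hφ hO'] at h
  exact h

namespace TransitionJets

variable {w c : E n → ℝ} {θ : E n → E n} {b b' : Fin n → E n → ℝ}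
  (J : TransitionJets φ φ' O w c θ b b')

include J

lemma sub_left : O ⊆ φ.source := fun _ h => (J.sub h).1

lemma sub_right : O ⊆ φ'.source := fun _ h => (J.sub h).2

lemma smooth (a : Fin (n + 1)) : ContDiffOn ℝ ∞ (trans φ φ' a) (coordDom φ O ∩ HS n) :=
  contDiffOn_trans J.mem J.mem' J.sub_right a

lemma yOf_coInv {v : E n} (hv : pair 0 v ∈ coordDom φ O) :
    yOf φ' (coInv φ (pair 0 v)) = θ v := by
  ext γ
  exact J.y_zero v hv γ

lemma eventually_pair (hq : q ∈ O ∩ Bdry n M) :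
    ∀ᶠ x in 𝓝[Inn n M] q, pair 0 (yOf φ x) ∈ coordDom φ O :=
  nhdsWithin_le_nhds (eventually_pair_mem J.mem J.isOpen J.sub_left hq)

lemma taylor_nhds {F : E (n + 1) → ℝ} (hF : ContDiffOn ℝ ∞ F (coordDom φ O ∩ HS n))
    (hq : q ∈ O ∩ Bdry n M) (k : ℕ) :
    (fun x => F (co φ x) - ∑ j ∈ Finset.range k, rhoOf φ x ^ j / (j.factorial : ℝ) *
      (dd 0)^[j] F (pair 0 (yOf φ x))) =O[𝓝 q] fun x => rhoOf φ x ^ k := by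
  have hq' : q ∈ φ.source ∩ Bdry n M := ⟨J.sub_left hq.1, hq.2⟩
  have hqU : pair 0 (yOf φ q) ∈ coordDom φ O := by
    rw [← co_boundary J.mem hq']; exact co_mem_coordDom hq'.1 hq.1
  have ht : Tendsto (co φ) (𝓝 q) (𝓝[HS n] (pair 0 (yOf φ q))) := by
    rw [← co_boundary J.mem hq']
    exact tendsto_co hq'.1
  exact (taylor_normal (isOpen_coordDom J.isOpen) hF hqU k).comp_tendsto ht

lemma taylor {F : E (n + 1) → ℝ} (hF : ContDiffOn ℝ ∞ F (coordDom φ O ∩ HS n))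
    (hq : q ∈ O ∩ Bdry n M) (k : ℕ) :
    (fun x => F (co φ x) - ∑ j ∈ Finset.range k, rhoOf φ x ^ j / (j.factorial : ℝ) *
      (dd 0)^[j] F (pair 0 (yOf φ x))) =O[𝓝[Inn n M] q] fun x => rhoOf φ x ^ k :=
  (J.taylor_nhds hF hq k).mono nhdsWithin_le_nhds

lemma exp {F : E (n + 1) → ℝ} (hF : ContDiffOn ℝ ∞ F (coordDom φ O ∩ HS n))
    (hq : q ∈ O ∩ Bdry n M) :
    Exp2 (𝓝[Inn n M] q) (rhoOf φ) (fun x => F (co φ x)) (fun x => F (pair 0 (yOf φ x)))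
      (fun x => dd 0 F (pair 0 (yOf φ x))) :=
  exp2_comp J.mem ⟨J.sub_left hq.1, hq.2⟩ (isOpen_coordDom J.isOpen) hF
    (co_mem_coordDom (J.sub_left hq.1) hq.1)

lemma bdd {F : E (n + 1) → ℝ} (hF : ContDiffOn ℝ ∞ F (coordDom φ O ∩ HS n))
    (hq : q ∈ O ∩ Bdry n M) :
    (fun x => F (pair 0 (yOf φ x))) =O[𝓝[Inn n M] q] fun _ => (1 : ℝ) := (J.exp hF hq).bdd₀

lemma nhds_pair {v : E n} (hv : pair 0 v ∈ coordDom φ O) :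
    ∀ᶠ u in 𝓝 v, pair 0 u ∈ coordDom φ O :=
  (contDiff_pair_zero (m := 0)).continuous.continuousAt.eventually_mem
    ((isOpen_coordDom J.isOpen).mem_nhds hv)

/-- Tangential derivatives of boundary values. -/
lemma dd_succ {F : E (n + 1) → ℝ} {f : E n → ℝ} (hF : ContDiffOn ℝ ∞ F (coordDom φ O ∩ HS n))
    (hf : ∀ v, pair 0 v ∈ coordDom φ O → F (pair 0 v) = f v) {v : E n}
    (hv : pair 0 v ∈ coordDom φ O) (α : Fin n) : dd α.succ F (pair 0 v) = pd α f v := by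
  rw [dd_succ_boundary α (differentiableWithinAt_HS hF (isOpen_coordDom J.isOpen)
    ⟨hv, pair_mem_HS le_rfl v⟩)]
  exact pd_congr α ((J.nhds_pair hv).mono fun u hu => hf u hu)

lemma w_bdd (hq : q ∈ O ∩ Bdry n M) :
    (fun x => w (yOf φ x)) =O[𝓝[Inn n M] q] fun _ => (1 : ℝ) := by
  refine ((J.bdd (contDiffOn_iterate_dd (J.smooth 0) (isOpen_coordDom J.isOpen) 2) hq).const_mul_left
    (1 / 2)).congr' ?_ .rfl
  filter_upwards [J.eventually_pair hq] with x hx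
  simp [J.rho_two _ hx]

lemma c_bdd (hq : q ∈ O ∩ Bdry n M) :
    (fun x => c (yOf φ x)) =O[𝓝[Inn n M] q] fun _ => (1 : ℝ) := by
  refine ((J.bdd (contDiffOn_iterate_dd (J.smooth 0) (isOpen_coordDom J.isOpen) 3) hq).const_mul_left
    (1 / 6)).congr' ?_ .rfl
  filter_upwards [J.eventually_pair hq] with x hx
  simp [J.rho_three _ hx]

lemma eventually_pos (hq : q ∈ O ∩ Bdry n M) : ∀ᶠ x in 𝓝[Inn n M] q, 0 < rhoOf φ x :=
  (tendsto_rhoOf J.mem ⟨J.sub_left hq.1, hq.2⟩).eventually self_mem_nhdsWithin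

lemma eventually_mem (hq : q ∈ O ∩ Bdry n M) : ∀ᶠ x in 𝓝[Inn n M] q, x ∈ O :=
  nhdsWithin_le_nhds (J.isOpen.mem_nhds hq.1)

lemma exp_P (hq : q ∈ O ∩ Bdry n M) :
    Exp3 (𝓝[Inn n M] q) (rhoOf φ) (fun x => rhoOf φ' x / rhoOf φ x) (fun _ => 1)
      (fun x => w (yOf φ x)) (fun x => c (yOf φ x)) := by
  refine Exp3.of_isBigO (tendsto_rhoOf J.mem ⟨J.sub_left hq.1, hq.2⟩) ?_ (isBigO_refl _ _)
    (J.w_bdd hq) (J.c_bdd hq)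
  -- One order more than in the conclusion, because dividing by `r` costs one. The constant Taylor
  -- term vanishes since boundary points go to boundary points.
  refine ((isBigO_refl (fun x => (rhoOf φ x)⁻¹) _).mul (J.taylor (J.smooth 0) hq 4)).congr' ?_ ?_
  · filter_upwards [J.eventually_pair hq, J.eventually_pos hq, J.eventually_mem hq]
      with x hx hpos hO
    simp only [Finset.sum_range_succ, Finset.range_zero, Finset.sum_empty, Function.iterate_succ,
      Function.iterate_zero, Function.comp_apply, id_eq, J.rho_one _ hx, J.rho_two _ hx,
      J.rho_three _ hx, trans_zero_boundary J.mem J.mem' J.sub_right hx,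
      trans_co (J.sub_left hO), co_zero, Nat.factorial]
    field_simp
    ring
  · filter_upwards [J.eventually_pos hq] with x hpos
    field_simp

lemma exp_P_rho (hq : q ∈ O ∩ Bdry n M) :
    Exp3 (𝓝[Inn n M] q) (rhoOf φ) (fun x => dd 0 (trans φ φ' 0) (co φ x)) (fun _ => 1)
      (fun x => 2 * w (yOf φ x)) (fun x => 3 * c (yOf φ x)) := by
  refine Exp3.of_isBigO (tendsto_rhoOf J.mem ⟨J.sub_left hq.1, hq.2⟩) ?_ (isBigO_refl _ _)
    ((J.w_bdd hq).const_mul_left 2) ((J.c_bdd hq).const_mul_left 3)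
  refine (J.taylor (contDiffOn_dd (J.smooth 0) (isOpen_coordDom J.isOpen) 0) hq 3).congr' ?_ .rfl
  filter_upwards [J.eventually_pair hq] with x hx
  simp only [Finset.sum_range_succ, Finset.range_zero, Finset.sum_empty, Function.iterate_succ,
    Function.iterate_zero, Function.comp_apply, id_eq, J.rho_one _ hx, J.rho_two _ hx,
    J.rho_three _ hx, Nat.factorial]
  push_cast
  ring

lemma iterate_dd_succ {F : E (n + 1) → ℝ} {f : E n → ℝ} (k : ℕ)
    (hF : ContDiffOn ℝ ∞ F (coordDom φ O ∩ HS n))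
    (hf : ∀ v, pair 0 v ∈ coordDom φ O → (dd 0)^[k] F (pair 0 v) = f v) {v : E n}
    (hv : pair 0 v ∈ coordDom φ O) (α : Fin n) :
    (dd 0)^[k] (dd α.succ F) (pair 0 v) = pd α f v := by
  rw [iterate_dd_comm hF (isOpen_coordDom J.isOpen) _ _ ⟨hv, pair_mem_HS le_rfl v⟩]
  exact J.dd_succ (contDiffOn_iterate_dd hF (isOpen_coordDom J.isOpen) k) hf hv α

/-- On the boundary `P = 0` and `∂P/∂r = 1` are constants, so their tangential derivatives vanish
and `∂_α P` starts at order `r²`. Commuting `∂_α` with the normal derivatives identifies the next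
two coefficients. -/
lemma exp_P_y (hq : q ∈ O ∩ Bdry n M) (α : Fin n) :
    Exp2 (𝓝[Inn n M] q) (rhoOf φ)
      (fun x => dd α.succ (trans φ φ' 0) (co φ x) / rhoOf φ x ^ 2)
      (fun x => pd α w (yOf φ x)) (fun x => pd α c (yOf φ x)) := by
  have hU := isOpen_coordDom (φ := φ) J.isOpen
  have hS := contDiffOn_dd (J.smooth 0) hU α.succ
  have h0 := fun v (hv : pair 0 v ∈ coordDom φ O) =>
    (J.iterate_dd_succ 0 (J.smooth 0) (f := fun _ => 0)
      (fun v hv => trans_zero_boundary J.mem J.mem' J.sub_right hv) hv α).trans (pd_const α 0)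
  have h1 := fun v (hv : pair 0 v ∈ coordDom φ O) =>
    (J.iterate_dd_succ 1 (J.smooth 0) (f := fun _ => 1) J.rho_one hv α).trans (pd_const α 1)
  have h2 := fun v (hv : pair 0 v ∈ coordDom φ O) =>
    (J.iterate_dd_succ 2 (J.smooth 0) J.rho_two hv α).trans (pd_const_mul α 2)
  have h3 := fun v (hv : pair 0 v ∈ coordDom φ O) =>
    (J.iterate_dd_succ 3 (J.smooth 0) J.rho_three hv α).trans (pd_const_mul α 6)
  refine Exp2.of_isBigO (tendsto_rhoOf J.mem ⟨J.sub_left hq.1, hq.2⟩) ?_ ?_ ?_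
  · refine ((isBigO_refl (fun x => (rhoOf φ x ^ 2)⁻¹) _).mul (J.taylor hS hq 4)).congr' ?_ ?_
    · filter_upwards [J.eventually_pair hq, J.eventually_pos hq, J.eventually_mem hq]
        with x hx hpos hO
      simp only [Finset.sum_range_succ, Finset.range_zero, Finset.sum_empty, h0 _ hx, h1 _ hx,
        h2 _ hx, h3 _ hx, Nat.factorial]
      field_simp
      push_cast
      ring
    · filter_upwards [J.eventually_pos hq] with x hpos
      field_simp
  · refine ((J.bdd (contDiffOn_iterate_dd hS hU 2) hq).const_mul_left (1 / 2)).congr' ?_ .rfl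
    filter_upwards [J.eventually_pair hq] with x hx
    rw [h2 _ hx]; ring
  · refine ((J.bdd (contDiffOn_iterate_dd hS hU 3) hq).const_mul_left (1 / 6)).congr' ?_ .rfl
    filter_upwards [J.eventually_pair hq] with x hx
    rw [h3 _ hx]; ring

lemma exp_coefficient {f : E n → ℝ} (hf : ContDiffOn ℝ ∞ f (bdryImage φ'))
    (hq : q ∈ O ∩ Bdry n M) :
    Exp2 (𝓝[Inn n M] q) (rhoOf φ) (fun x => f (yOf φ' x)) (fun x => f (θ (yOf φ x)))
      (fun x => ∑ γ, pd γ f (θ (yOf φ x)) * b γ (yOf φ x)) := by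
  have hB := isOpen_bdryImage J.mem'
  have hyc : ContinuousOn (yOf φ') φ'.source := fun x hx =>
    (continuousAt_yOf hx).continuousWithinAt
  -- `f` is smooth only on the boundary values of `y`, while it is evaluated at the `y` of interior
  -- points; shrinking the domain makes the composition smooth.
  set O' : Set M := O ∩ (φ'.source ∩ yOf φ' ⁻¹' bdryImage φ') with hO'
  have hO'o : IsOpen O' := J.isOpen.inter (hyc.isOpen_inter_preimage φ'.open_source hB)
  have hqO : q ∈ O' ∩ Bdry n M := ⟨⟨hq.1, J.sub_right hq.1,
    yOf_mem_bdryImage ⟨J.sub_right hq.1, hq.2⟩⟩, hq.2⟩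
  have hs : ContMDiffOn (𝓡∂ (n + 1)) 𝓘(ℝ, ℝ) ∞ (fun x => f (yOf φ' x)) O' :=
    hf.contMDiffOn.comp ((contMDiffOn_yOf J.mem').mono fun x hx => hx.2.1) fun x hx => hx.2.2
  have hF := contDiffOn_comp_coInv J.mem hs
  have hO's : O' ⊆ φ.source := fun x hx => J.sub_left hx.1
  refine ((exp2_comp J.mem ⟨hO's hqO.1, hq.2⟩ (isOpen_coordDom hO'o) hF
    (co_mem_coordDom (hO's hqO.1) hqO.1)).congr ?_).coef_ev ?_ ?_
  · filter_upwards [J.eventually_mem hq] with x hx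
    rw [coInv_co (J.sub_left hx)]
  · filter_upwards [J.eventually_pair hq] with x hx
    rw [J.yOf_coInv hx]
  · filter_upwards [J.eventually_pair hq,
      nhdsWithin_le_nhds (eventually_pair_mem J.mem hO'o hO's hqO)] with x hx hx'
    have hfd : DifferentiableAt ℝ f (yOf φ' (coInv φ (pair 0 (yOf φ x)))) :=
      (hf.contDiffAt (hB.mem_nhds (coInv_mem hx').2.2)).differentiableAt (by simp)
    have hYs : ContDiffOn ℝ ∞ (fun z => yOf φ' (coInv φ z)) (coordDom φ O ∩ HS n) :=
      contDiffOn_comp_coInv J.mem ((contMDiffOn_yOf J.mem').mono J.sub_right)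
    rw [dd_comp (Y := fun z => yOf φ' (coInv φ z)) 0 (pair_mem_HS le_rfl _) hfd
      (differentiableWithinAt_HS hYs (isOpen_coordDom J.isOpen) ⟨hx, pair_mem_HS le_rfl _⟩),
      J.yOf_coInv hx]
    exact Finset.sum_congr rfl fun γ _ => congrArg _ (J.y_one _ hx γ)

/-- The expansions needed to transform a Beig–Schmidt metric. -/
theorem transitionExpansion {ghat : BilinField n M} {ν : ℝ}
    {h k : E n → Matrix (Fin n) (Fin n) ℝ} {σ : E n → ℝ} (hB : IsBeigSchmidt ghat ν φ' h k σ)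
    (hsymm : ∀ x ∈ Inn n M, ∀ v w, ghat x v w = ghat x w v) (hq : q ∈ O ∩ Bdry n M) :
    TransitionExpansion (𝓝[Inn n M] q) (rhoOf φ) ν (rhoOf φ')
      (fun a i x => dd i (trans φ φ' a) (co φ x)) (comp ghat φ')
      (fun γ δ x => h (yOf φ' x) γ δ) (fun γ δ x => k (yOf φ' x) γ δ) (fun x => σ (yOf φ' x))
      (fun x => w (yOf φ x)) (fun x => c (yOf φ x))
      (fun α x => pd α w (yOf φ x)) (fun α x => pd α c (yOf φ x))
      (fun x => σ (θ (yOf φ x))) (fun x => ∑ ε, pd ε σ (θ (yOf φ x)) * b ε (yOf φ x))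
      (fun γ δ x => h (θ (yOf φ x)) γ δ)
      (fun γ δ x => ∑ ε, pd ε (fun y => h y γ δ) (θ (yOf φ x)) * b ε (yOf φ x))
      (fun γ δ x => k (θ (yOf φ x)) γ δ)
      (fun γ δ x => ∑ ε, pd ε (fun y => k y γ δ) (θ (yOf φ x)) * b ε (yOf φ x))
      (fun γ x => b γ (yOf φ x)) (fun γ x => b' γ (yOf φ x))
      (fun γ α x => pd α (fun v => θ v γ) (yOf φ x)) (fun γ α x => pd α (b γ) (yOf φ x)) where
  tendsto := tendsto_rhoOf J.mem ⟨J.sub_left hq.1, hq.2⟩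
  symm γ := by
    filter_upwards [self_mem_nhdsWithin] with x hx
    exact hsymm x hx _ _
  rho_rho := (hB.expansion_rho_rho q ⟨J.sub_right hq.1, hq.2⟩)
  rho_y γ := hB.expansion_rho_y q ⟨J.sub_right hq.1, hq.2⟩ γ
  y_y γ δ := hB.expansion_y_y q ⟨J.sub_right hq.1, hq.2⟩ γ δ
  exp_P := J.exp_P hq
  exp_P_rho := J.exp_P_rho hq
  exp_P_y α := J.exp_P_y hq α
  exp_s := J.exp_coefficient hB.smooth_σ hq
  exp_H γ δ := J.exp_coefficient (hB.smooth_h γ δ) hq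
  exp_K γ δ := J.exp_coefficient (hB.smooth_k γ δ) hq
  exp_Y_rho γ := by
    refine (J.exp (contDiffOn_dd (J.smooth γ.succ) (isOpen_coordDom J.isOpen) 0) hq).coef_ev ?_ ?_
    · filter_upwards [J.eventually_pair hq] with x hx using J.y_one _ hx γ
    · filter_upwards [J.eventually_pair hq] with x hx using J.y_two _ hx γ
  exp_Y_y γ α := by
    refine (J.exp (contDiffOn_dd (J.smooth γ.succ) (isOpen_coordDom J.isOpen) α.succ)
      hq).coef_ev ?_ ?_
    · filter_upwards [J.eventually_pair hq] with x hx using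
        J.iterate_dd_succ 0 (J.smooth γ.succ) (fun v hv => J.y_zero v hv γ) hx α
    · filter_upwards [J.eventually_pair hq] with x hx using
        J.iterate_dd_succ 1 (J.smooth γ.succ) (fun v hv => J.y_one v hv γ) hx α

lemma comp_eq (ghat : BilinField n M) (hq : q ∈ O ∩ Bdry n M) (i j : Fin (n + 1)) :
    newG (fun a i x => dd i (trans φ φ' a) (co φ x)) (comp ghat φ') i j
      =ᶠ[𝓝[Inn n M] q] comp ghat φ i j := by
  filter_upwards [J.eventually_mem hq] with x hx
  exact (comp_eq_newG ghat J.mem J.mem' (J.sub hx) i j).symm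

end TransitionJets

end BoundaryJets

/-! ### Coefficients of the transformed expansions -/

section Coefficients

variable {n : ℕ}

/-- The pull-back of `h` by `θ`. -/
def pullMetric (h : E n → Matrix (Fin n) (Fin n) ℝ) (θ : E n → E n) (v : E n) :
    Matrix (Fin n) (Fin n) ℝ :=
  Matrix.of fun α β => ∑ γ, ∑ δ,
    h (θ v) γ δ * pd α (fun u => θ u γ) v * pd β (fun u => θ u δ) v

/-- The first order coefficient of the rescaled tangential components before the change of basis. -/
def firstCoef (h k : E n → Matrix (Fin n) (Fin n) ℝ) (σ w : E n → ℝ) (θ : E n → E n)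
    (b : Fin n → E n → ℝ) (γ δ : Fin n) (v : E n) : ℝ :=
  (∑ ε, pd ε (fun y => h y γ δ) (θ v) * b ε v) + k (θ v) γ δ - 2 * σ (θ v) * h (θ v) γ δ -
    2 * w v * h (θ v) γ δ

/-- The first order coefficient of the `yy` components. -/
def tangentialCoef (h k : E n → Matrix (Fin n) (Fin n) ℝ) (σ w : E n → ℝ) (θ : E n → E n)
    (b : Fin n → E n → ℝ) (α β : Fin n) (v : E n) : ℝ :=
  ∑ γ, ∑ δ, (firstCoef h k σ w θ b γ δ v * pd α (fun u => θ u γ) v * pd β (fun u => θ u δ) v +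
    h (θ v) γ δ * pd α (b γ) v * pd β (fun u => θ u δ) v +
    h (θ v) γ δ * pd α (fun u => θ u γ) v * pd β (b δ) v)

/-- The zeroth order coefficient of the `ρy` components. -/
def mixedCoefZero (ν : ℝ) (h : E n → Matrix (Fin n) (Fin n) ℝ) (w : E n → ℝ) (θ : E n → E n)
    (b : Fin n → E n → ℝ) (α : Fin n) (v : E n) : ℝ :=
  ν⁻¹ * pd α w v + ∑ γ, ∑ δ, h (θ v) γ δ * b γ v * pd α (fun u => θ u δ) v

/-- The first order coefficient of the `ρy` components. -/
def mixedCoefOne (ν : ℝ) (h k : E n → Matrix (Fin n) (Fin n) ℝ) (σ w c : E n → ℝ) (θ : E n → E n)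
    (b b' : Fin n → E n → ℝ) (α : Fin n) (v : E n) : ℝ :=
  ν⁻¹ * (pd α c v + (2 * σ (θ v) - 2 * w v) * pd α w v) +
    ∑ γ, ∑ δ, (firstCoef h k σ w θ b γ δ v * b γ v * pd α (fun u => θ u δ) v +
      h (θ v) γ δ * b' γ v * pd α (fun u => θ u δ) v + h (θ v) γ δ * b γ v * pd α (b δ) v)

/-- The difference of the second order coefficient of the `ρρ` component and `σ²`. -/
def radialCoef (ν : ℝ) (h : E n → Matrix (Fin n) (Fin n) ℝ) (σ w c : E n → ℝ) (θ : E n → E n)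
    (b : Fin n → E n → ℝ) (v : E n) : ℝ :=
  ν⁻¹ * (2 * (c v - w v ^ 2 + w v * σ (θ v) + ∑ ε, pd ε σ (θ v) * b ε v)) +
    ∑ γ, ∑ δ, h (θ v) γ δ * b γ v * b δ v

end Coefficients

/-! ### Comparing coefficients of two expansions of the same metric -/

section Comparison

variable {n : ℕ} {M : Type*} [TopologicalSpace M] [ChartedSpace (EuclideanHalfSpace (n + 1)) M]
variable {φ φ' : OpenPartialHomeomorph M (EuclideanHalfSpace (n + 1))} {O : Set M} {x q : M}
variable [IsManifold (𝓡∂ (n + 1)) ∞ M]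

/-- Along the normal ray through `q` the coordinates `y` are frozen, so coefficient functions become
constants and uniqueness of numerical expansions applies. -/
lemma comp_ray {f : ℝ → E n → ℝ} {g : ℝ → ℝ}
    (hφ : φ ∈ IsManifold.maximalAtlas (𝓡∂ (n + 1)) ∞ M) (hq : q ∈ φ.source ∩ Bdry n M)
    (h : (fun x => f (rhoOf φ x) (yOf φ x)) =O[𝓝[Inn n M] q] fun x => g (rhoOf φ x)) :
    (fun t => f t (yOf φ q)) =O[𝓝[>] 0] g := by
  obtain ⟨h1, h2⟩ := tendsto_ray hφ hq
  refine (h.comp_tendsto h1).congr' ?_ ?_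
  · filter_upwards [h2] with t ht
    change f (co φ (coInv φ (pair t (yOf φ q))) 0) (tl (co φ (coInv φ (pair t (yOf φ q))))) = _
    rw [ht, pair_zero, tl_pair]
  · filter_upwards [h2] with t ht
    simp only [Function.comp_apply, ← co_zero, ht]
    rfl

lemma coefficients_eq_zero {a b : E n → ℝ}
    (hφ : φ ∈ IsManifold.maximalAtlas (𝓡∂ (n + 1)) ∞ M) (hq : q ∈ φ.source ∩ Bdry n M)
    (h : (fun x => a (yOf φ x) + b (yOf φ x) * rhoOf φ x)
      =O[𝓝[Inn n M] q] fun x => rhoOf φ x ^ 2 * Real.log (rhoOf φ x)) :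
    a (yOf φ q) = 0 ∧ b (yOf φ q) = 0 :=
  eq_zero_of_isBigO tendsto_id (comp_ray (f := fun t y => a y + b y * t)
    (g := fun t => t ^ 2 * Real.log t) hφ hq h)

lemma coefficients_eq_zero_three {a b c : E n → ℝ}
    (hφ : φ ∈ IsManifold.maximalAtlas (𝓡∂ (n + 1)) ∞ M) (hq : q ∈ φ.source ∩ Bdry n M)
    (h : (fun x => a (yOf φ x) + b (yOf φ x) * rhoOf φ x + c (yOf φ x) * rhoOf φ x ^ 2)
      =O[𝓝[Inn n M] q] fun x => rhoOf φ x ^ 3 * Real.log (rhoOf φ x)) :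
    a (yOf φ q) = 0 ∧ b (yOf φ q) = 0 ∧ c (yOf φ q) = 0 :=
  eq_zero_of_isBigO_three tendsto_id (comp_ray (f := fun t y => a y + b y * t + c y * t ^ 2)
    (g := fun t => t ^ 3 * Real.log t) hφ hq h)

namespace TransitionJets

variable {w c : E n → ℝ} {θ : E n → E n} {b b' : Fin n → E n → ℝ}
  (J : TransitionJets φ φ' O w c θ b b') {ghat : BilinField n M} {ν : ℝ}
  {h k : E n → Matrix (Fin n) (Fin n) ℝ} {σ : E n → ℝ} (hB : IsBeigSchmidt ghat ν φ' h k σ)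
  (hsymm : ∀ x ∈ Inn n M, ∀ v w, ghat x v w = ghat x w v)

include J hB hsymm

lemma exp_rescaled_rho_rho (hq : q ∈ O ∩ Bdry n M) :
    Exp3 (𝓝[Inn n M] q) (rhoOf φ) (fun x => rhoOf φ x ^ 2 * rescaled ghat φ 0 0 x)
      (fun _ => ν⁻¹) (fun x => ν⁻¹ * (2 * σ (θ (yOf φ x))))
      (fun x => ν⁻¹ * σ (θ (yOf φ x)) ^ 2 + radialCoef ν h σ w c θ b (yOf φ x)) := by
  refine ((J.transitionExpansion hB hsymm hq).exp_new_rho_rho.congr ?_).coef (fun x => rfl)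
    (fun x => rfl) fun x => by unfold radialCoef; ring
  filter_upwards [J.comp_eq ghat hq 0 0] with x hx
  rw [hx, rescaled_eq]
  ring

lemma exp_rescaled_rho_y (hq : q ∈ O ∩ Bdry n M) (α : Fin n) :
    Exp2 (𝓝[Inn n M] q) (rhoOf φ) (rescaled ghat φ 0 α.succ)
      (fun x => mixedCoefZero ν h w θ b α (yOf φ x))
      (fun x => mixedCoefOne ν h k σ w c θ b b' α (yOf φ x)) := by
  refine ((J.transitionExpansion hB hsymm hq).exp_new_rho_y α).congr ?_
  filter_upwards [J.comp_eq ghat hq 0 α.succ] with x hx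
  rw [hx, rescaled_eq]

lemma exp_rescaled_y_y (hq : q ∈ O ∩ Bdry n M) (α β : Fin n) :
    Exp2 (𝓝[Inn n M] q) (rhoOf φ) (rescaled ghat φ α.succ β.succ)
      (fun x => pullMetric h θ (yOf φ x) α β)
      (fun x => tangentialCoef h k σ w θ b α β (yOf φ x)) := by
  refine ((J.transitionExpansion hB hsymm hq).exp_new_y_y α β).congr ?_
  filter_upwards [J.comp_eq ghat hq α.succ β.succ] with x hx
  rw [hx, rescaled_eq]

/-- A chart is a Beig–Schmidt chart if the coefficients in the transformed expansions are right. -/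
theorem isBeigSchmidt (hO : O = φ.source)
    (hh : ∀ α β, ContDiffOn ℝ ∞ (fun v => pullMetric h θ v α β) (bdryImage φ))
    (hk : ∀ α β, ContDiffOn ℝ ∞ (tangentialCoef h k σ w θ b α β) (bdryImage φ))
    (hσ : ContDiffOn ℝ ∞ (fun v => σ (θ v)) (bdryImage φ))
    (hsig : ∀ y ∈ bdryImage φ, (0 < ν ∧ IsLorentzianMatrix (pullMetric h θ y)) ∨
      (ν < 0 ∧ (pullMetric h θ y).PosDef))
    (h1 : ∀ v ∈ bdryImage φ, radialCoef ν h σ w c θ b v = 0)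
    (h2 : ∀ v ∈ bdryImage φ, ∀ α, mixedCoefZero ν h w θ b α v = 0)
    (h3 : ∀ v ∈ bdryImage φ, ∀ α, mixedCoefOne ν h k σ w c θ b b' α v = 0) :
    IsBeigSchmidt ghat ν φ (pullMetric h θ)
      (fun v => Matrix.of fun α β => tangentialCoef h k σ w θ b α β v +
        2 * σ (θ v) * pullMetric h θ v α β) (fun v => σ (θ v)) := by
  subst hO
  have hev : ∀ q ∈ φ.source ∩ Bdry n M, ∀ᶠ x in 𝓝[Inn n M] q, yOf φ x ∈ bdryImage φ :=
    fun q hq => by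
      filter_upwards [J.eventually_pair hq] with x hx
      rw [bdryImage, image_boundary_eq J.mem le_rfl]
      exact hx
  refine ⟨J.mem, hh, fun α β => (hk α β).add ((contDiffOn_const.mul hσ).mul (hh α β)), hσ, hsig,
    fun q hq => ?_, fun q hq α => ?_, fun q hq α β => ?_⟩
  · refine (J.exp_rescaled_rho_rho hB hsymm hq).rem.congr' ?_ .rfl
    filter_upwards [hev q hq] with x hx
    rw [h1 _ hx]
    ring
  · refine (J.exp_rescaled_rho_y hB hsymm hq α).rem.congr' ?_ .rfl
    filter_upwards [hev q hq] with x hx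
    rw [h2 _ hx, h3 _ hx]
    ring
  · refine (J.exp_rescaled_y_y hB hsymm hq α β).rem.congr_left fun x => ?_
    simp only [Matrix.of_apply]
    ring

variable {h₁ k₁ : E n → Matrix (Fin n) (Fin n) ℝ} {σ₁ : E n → ℝ}
  (hB₁ : IsBeigSchmidt ghat ν φ h₁ k₁ σ₁)

include hB₁

lemma compare_rho_rho (hq : q ∈ O ∩ Bdry n M) (hν : ν ≠ 0) :
    σ (θ (yOf φ q)) = σ₁ (yOf φ q) ∧ radialCoef ν h σ w c θ b (yOf φ q) = 0 := by
  have hq' : q ∈ φ.source ∩ Bdry n M := ⟨J.sub_left hq.1, hq.2⟩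
  have e1 := (J.exp_rescaled_rho_rho hB hsymm hq).rem
  have e2 := (hB₁.expansion_rho_rho q hq').sub e1
  -- The constant terms are both `ν⁻¹`; the linear terms give `σ`, after which the `σ²` terms cancel
  -- and the quadratic terms leave `radialCoef`.
  obtain ⟨-, h1, h2⟩ := coefficients_eq_zero_three (a := fun _ => 0)
    (b := fun y => ν⁻¹ * (2 * σ (θ y)) - ν⁻¹ * (2 * σ₁ y))
    (c := fun y => ν⁻¹ * σ (θ y) ^ 2 + radialCoef ν h σ w c θ b y - ν⁻¹ * σ₁ y ^ 2)
    J.mem hq' (e2.congr_left fun x => by ring)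
  have h3 : σ (θ (yOf φ q)) = σ₁ (yOf φ q) := by
    have : ν⁻¹ * 2 * (σ (θ (yOf φ q)) - σ₁ (yOf φ q)) = 0 := by linarith
    have h4 : ν⁻¹ * 2 ≠ 0 := by positivity
    linarith [(mul_eq_zero.1 this).resolve_left h4]
  refine ⟨h3, ?_⟩
  rw [h3] at h2
  linarith

lemma compare_rho_y (hq : q ∈ O ∩ Bdry n M) (α : Fin n) :
    mixedCoefZero ν h w θ b α (yOf φ q) = 0 ∧
      mixedCoefOne ν h k σ w c θ b b' α (yOf φ q) = 0 := by
  have hq' : q ∈ φ.source ∩ Bdry n M := ⟨J.sub_left hq.1, hq.2⟩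
  exact coefficients_eq_zero J.mem hq' (((hB₁.expansion_rho_y q hq' α).sub
    (J.exp_rescaled_rho_y hB hsymm hq α).rem).congr_left fun x => by ring)

lemma compare_y_y (hq : q ∈ O ∩ Bdry n M) (α β : Fin n) :
    pullMetric h θ (yOf φ q) α β = h₁ (yOf φ q) α β ∧
      tangentialCoef h k σ w θ b α β (yOf φ q) =
        k₁ (yOf φ q) α β - 2 * σ₁ (yOf φ q) * h₁ (yOf φ q) α β := by
  have hq' : q ∈ φ.source ∩ Bdry n M := ⟨J.sub_left hq.1, hq.2⟩
  obtain ⟨h1, h2⟩ := coefficients_eq_zero (a := fun y => pullMetric h θ y α β - h₁ y α β)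
    (b := fun y => tangentialCoef h k σ w θ b α β y -
      (k₁ y α β - 2 * σ₁ y * h₁ y α β)) J.mem hq' (((hB₁.expansion_y_y q hq' α β).sub
    (J.exp_rescaled_y_y hB hsymm hq α β).rem).congr_left fun x => by ring)
  exact ⟨by linarith, by linarith⟩

end TransitionJets

end Comparison

/-! ### Two-jets in arbitrary charts and along normal rays -/

section TwoJets

variable {n : ℕ} {M : Type*} [TopologicalSpace M] [ChartedSpace (EuclideanHalfSpace (n + 1)) M]
variable {φ φ₁ φ₂ : OpenPartialHomeomorph M (EuclideanHalfSpace (n + 1))} {O : Set M} {x q p : M}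
variable [IsManifold (𝓡∂ (n + 1)) ∞ M]

lemma differentiableWithinAt_comp_coInv {V : Type*} [NormedAddCommGroup V] [NormedSpace ℝ V]
    {f : M → V} (hφ : φ ∈ IsManifold.maximalAtlas (𝓡∂ (n + 1)) ∞ M) (hq : q ∈ φ.source)
    (hf : ContMDiffAt (𝓡∂ (n + 1)) 𝓘(ℝ, V) ∞ f q) :
    DifferentiableWithinAt ℝ (fun z => f (coInv φ z)) (HS n) (co φ q) := by
  have h1 : MDifferentiableWithinAt 𝓘(ℝ, E (n + 1)) (𝓡∂ (n + 1)) (coInv φ) (HS n) (co φ q) := by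
    have h2 := (contMDiffOn_extend_symm hφ (co φ q) ⟨φ q, φ.map_source hq, rfl⟩).mono_of_mem_nhdsWithin
      (t := HS n) (by
        rw [HS_eq_range]
        exact (𝓡∂ (n + 1)).image_mem_nhdsWithin (φ.open_target.mem_nhds (φ.map_source hq)))
    exact h2.mdifferentiableWithinAt (by simp)
  have h3 : MDifferentiableAt (𝓡∂ (n + 1)) 𝓘(ℝ, V) f (coInv φ (co φ q)) := by
    rw [coInv_co hq]; exact hf.mdifferentiableAt (by simp)
  have h4 := h3.comp_mdifferentiableWithinAt (co φ q) h1
  rwa [mdifferentiableWithinAt_iff_differentiableWithinAt] at h4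

lemma isBigO_sub_co {V : Type*} [NormedAddCommGroup V] [NormedSpace ℝ V] {f : M → V}
    (hφ : φ ∈ IsManifold.maximalAtlas (𝓡∂ (n + 1)) ∞ M) (hp : p ∈ φ.source)
    (hf : ContMDiffAt (𝓡∂ (n + 1)) 𝓘(ℝ, V) ∞ f p) :
    (fun x => f x - f p) =O[𝓝 p] fun x => co φ x - co φ p := by
  refine ((differentiableWithinAt_comp_coInv hφ hp hf).hasFDerivWithinAt.isBigO_sub.comp_tendsto
    (tendsto_co hp)).congr' ?_ .rfl
  filter_upwards [φ.open_source.mem_nhds hp] with x hx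
  simp [coInv_co hx, coInv_co hp]

/-- Used in both directions, this makes coordinate distances to `p` comparable, so that the notion
of two-jet does not depend on the chart. -/
lemma isBigO_co_co (hφ₁ : φ₁ ∈ IsManifold.maximalAtlas (𝓡∂ (n + 1)) ∞ M)
    (hφ₂ : φ₂ ∈ IsManifold.maximalAtlas (𝓡∂ (n + 1)) ∞ M) (h₁ : p ∈ φ₁.source)
    (h₂ : p ∈ φ₂.source) :
    (fun x => co φ₂ x - co φ₂ p) =O[𝓝 p] fun x => co φ₁ x - co φ₁ p :=
  isBigO_sub_co hφ₁ h₁ (φ₂.contMDiffAt_extend hφ₂ h₂)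

/-- Vanishing to second order can be tested in any chart. -/
lemma mem_vanishToSecondOrder_iff (hφ : φ ∈ IsManifold.maximalAtlas (𝓡∂ (n + 1)) ∞ M)
    (hp : p ∈ φ.source) (f : SmoothAt n p) : f ∈ VanishToSecondOrder (n := n) p ↔
      (f : M → ℝ) =o[𝓝 p] fun x => ‖co φ x - co φ p‖ ^ 2 := by
  have hc := IsManifold.chart_mem_maximalAtlas (I := 𝓡∂ (n + 1)) (n := ∞) p
  have hs := mem_chart_source (EuclideanHalfSpace (n + 1)) p
  constructor
  · intro h
    exact IsLittleO.trans_isBigO h ((isBigO_co_co hφ hc hp hs).norm_norm.pow 2)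
  · intro h
    exact IsLittleO.trans_isBigO h ((isBigO_co_co hc hφ hs hp).norm_norm.pow 2)

lemma norm_pair_sub (t : ℝ) (y : E n) : ‖pair t y - pair 0 y‖ = |t| := by
  rw [pair_eq, add_sub_cancel_right, norm_smul]
  simp

lemma tendsto_pair (y : E n) :
    Tendsto (fun t => pair t y) (𝓝[>] 0) (𝓝[HS n] (pair 0 y)) := by
  refine tendsto_nhdsWithin_iff.2 ⟨?_, ?_⟩
  · have : Continuous fun t => pair t y := by
      rw [show (fun t => pair t y) = fun t =>
        t • (EuclideanSpace.single 0 1 : E (n + 1)) + pair 0 y from funext fun t => pair_eq t _]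
      fun_prop
    exact (this.tendsto 0).mono_left nhdsWithin_le_nhds
  · filter_upwards [self_mem_nhdsWithin] with t ht using pair_mem_HS (le_of_lt ht) y

/-- The normal two-jet can be read off on the normal ray. -/
lemma normal_jet_of_isLittleO {U : Set (E (n + 1))} {F : E (n + 1) → ℝ} {y : E n} {a b c : ℝ}
    (hU : IsOpen U) (hF : ContDiffOn ℝ ∞ F (U ∩ HS n)) (hy : pair 0 y ∈ U)
    (h : (fun t => F (pair t y) - (a + b * t + c * t ^ 2)) =o[𝓝[>] 0] fun t => t ^ 2) :
    F (pair 0 y) = a ∧ dd 0 F (pair 0 y) = b ∧ dd 0 (dd 0 F) (pair 0 y) = 2 * c := by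
  have h1 := (taylor_normal hU hF hy 3).comp_tendsto (tendsto_pair y)
  have h2 : (fun t : ℝ => t ^ 3) =o[𝓝[>] 0] fun t => t ^ 2 :=
    (isLittleO_pow_pow (by norm_num : 2 < 3)).mono nhdsWithin_le_nhds
  have h3 : (fun t : ℝ => F (pair t y) - (F (pair 0 y) + dd 0 F (pair 0 y) * t +
      dd 0 (dd 0 F) (pair 0 y) / 2 * t ^ 2)) =o[𝓝[>] 0] fun t => t ^ 2 := by
    refine (h1.trans_isLittleO h2).congr_left fun t => ?_
    simp [Finset.sum_range_succ, Function.comp_apply, Nat.factorial]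
    ring
  obtain ⟨e1, e2, e3⟩ := eq_zero_of_isLittleO_sq (a := F (pair 0 y) - a)
    (b := dd 0 F (pair 0 y) - b) (c := dd 0 (dd 0 F) (pair 0 y) / 2 - c)
    (tendsto_id : Tendsto id (𝓝[>] (0 : ℝ)) _)
    ((h.sub h3).congr_left fun t => by simp only [id]; ring)
  exact ⟨by linarith, by linarith, by linarith⟩

lemma isLittleO_ray {f : M → ℝ} (hφ : φ ∈ IsManifold.maximalAtlas (𝓡∂ (n + 1)) ∞ M)
    (hq : q ∈ φ.source ∩ Bdry n M)
    (h : f =o[𝓝 q] fun x => ‖co φ x - co φ q‖ ^ 2) :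
    (fun t => f (coInv φ (pair t (yOf φ q)))) =o[𝓝[>] 0] fun t : ℝ => t ^ 2 := by
  obtain ⟨h1, h2⟩ := tendsto_ray hφ hq
  refine (h.comp_tendsto (h1.mono_right nhdsWithin_le_nhds)).congr' .rfl ?_
  filter_upwards [h2] with t ht
  rw [Function.comp_apply, ht, co_boundary hφ hq, norm_pair_sub, sq_abs]

end TwoJets

/-! ### Fibre coordinates and the first coordinate of an adapted chart -/

namespace AsymptoticSpacetime

section Adapted

variable {n : ℕ} {M : Type*} [TopologicalSpace M] [ChartedSpace (EuclideanHalfSpace (n + 1)) M]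
variable {φ φ₁ φ₂ : OpenPartialHomeomorph M (EuclideanHalfSpace (n + 1))} {p : M}
variable [IsManifold (𝓡∂ (n + 1)) ∞ M] {S : AsymptoticSpacetime n M}

lemma act_mk {p : M} (hp : p ∈ Bdry n M) {j j' : Jet2 (n := n) p} (hj) (hj') {s : ℝ}
    (h : j' = j + s • S.jetρsq p) : (⟨p, hp, j', hj'⟩ : S.Spi) = Spi.act s ⟨p, hp, j, hj⟩ := by
  subst h; rfl

lemma jet_eq_of_mk_eq {p : M} {hp hp' : p ∈ Bdry n M} {j j' : Jet2 (n := n) p} {hj hj'}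
    (h : (⟨p, hp, j, hj⟩ : S.Spi) = ⟨p, hp', j', hj'⟩) : j = j' := by
  cases h; rfl

/-- Both jets have class `φ(p)` modulo the line of `j²ρ²`, so their difference lies in that line. -/
lemma exists_act (z z' : S.Spi) (h : z.pt = z'.pt) : ∃ s, z' = z.act s := by
  obtain ⟨p, hp, j, hj⟩ := z
  obtain ⟨p', hp', j', hj'⟩ := z'
  obtain rfl : p = p' := h
  have h1 : j' - j ∈ S.line p := by
    rw [← Submodule.Quotient.eq, hj, hj']
  obtain ⟨s, hs⟩ := Submodule.mem_span_singleton.1 h1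
  exact ⟨s, act_mk hp hj hj' (by rw [hs]; abel)⟩

/-- Both coordinates are translated by the same amount under the action, so a relation between them
need only be checked at one point of each fibre, here `j²ρ`. -/
lemma u_sub_u (c₁ c₂ : S.SpiCoord) (z z' : S.Spi) (h : z.pt = z'.pt)
    (h₁ : (⟨z.pt, z.pt_mem⟩ : Bdry n M) ∈ c₁.y.source)
    (h₂ : (⟨z.pt, z.pt_mem⟩ : Bdry n M) ∈ c₂.y.source) :
    c₂.u z' - c₁.u z' = c₂.u z - c₁.u z := by
  obtain ⟨s, rfl⟩ := exists_act z z' h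
  rw [c₁.u_act z s h₁, c₂.u_act z s h₂]
  ring

/-- The two-jet of the first coordinate of an adapted chart. -/
lemma IsAdapted.jet (hφ : φ ∈ IsManifold.maximalAtlas (𝓡∂ (n + 1)) ∞ M) {c : S.SpiCoord}
    (A : IsAdapted c φ) (p : Bdry n M) (hp : (p : M) ∈ φ.source) :
    jet2 (p : M) (rhoOf φ) (contMDiffAt_rhoOf hφ hp) =
      S.jetρ p + (-c.u (S.refSection p)) • S.jetρsq p := by
  obtain ⟨z, hz, hu, hρ, hj⟩ := A.zero_section p hp
  obtain ⟨p, hpB⟩ := p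
  obtain ⟨p', hp', j, hjm⟩ := z
  obtain rfl : p' = p := hz
  obtain ⟨s, hs⟩ := exists_act (S.refSection ⟨p', hpB⟩) ⟨p', hp', j, hjm⟩ rfl
  rw [hs, c.u_act _ _ (A.mem_source ⟨p', hpB⟩ hp)] at hu
  have h1 : (j : Jet2 (n := n) p') = S.jetρ p' + s • S.jetρsq p' :=
    jet_eq_of_mk_eq hs
  have h2 : s = -c.u (S.refSection ⟨p', hpB⟩) := by linarith
  rw [← h2, ← h1]
  exact hj.symm

/-- The first coordinate of an adapted chart to second order. -/
lemma IsAdapted.isLittleO (hφ : φ ∈ IsManifold.maximalAtlas (𝓡∂ (n + 1)) ∞ M) {c : S.SpiCoord}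
    (A : IsAdapted c φ) (p : Bdry n M) (hp : (p : M) ∈ φ.source)
    {ψ : OpenPartialHomeomorph M (EuclideanHalfSpace (n + 1))}
    (hψ : ψ ∈ IsManifold.maximalAtlas (𝓡∂ (n + 1)) ∞ M) (hpψ : (p : M) ∈ ψ.source) :
    (fun x => rhoOf φ x - S.ρ x + c.u (S.refSection p) * S.ρ x ^ 2) =o[𝓝 (p : M)]
      fun x => ‖co ψ x - co ψ p‖ ^ 2 := by
  have h := A.jet hφ p hp
  have h1 : (⟨rhoOf φ, contMDiffAt_rhoOf hφ hp⟩ : SmoothAt n (p : M)) -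
      (⟨S.ρ, S.ρ_smooth p⟩ + (-c.u (S.refSection p)) •
        ⟨fun x => S.ρ x ^ 2, ContMDiffAt.pow (S.ρ_smooth p) 2⟩) ∈
      VanishToSecondOrder (n := n) (p : M) := (Submodule.Quotient.eq _).1 h
  refine ((mem_vanishToSecondOrder_iff hψ hpψ _).1 h1).congr_left fun x => ?_
  change rhoOf φ x - (S.ρ x + (-c.u (S.refSection p)) * S.ρ x ^ 2) = _
  ring

lemma isBigO_rho (hψ : φ ∈ IsManifold.maximalAtlas (𝓡∂ (n + 1)) ∞ M) (hp : p ∈ φ.source)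
    (hpB : p ∈ Bdry n M) : S.ρ =O[𝓝 p] fun x => ‖co φ x - co φ p‖ := by
  have h := isBigO_sub_co hψ hp (S.ρ_smooth p)
  rw [S.ρ_zero p hpB] at h
  simpa using h.norm_right

/-- Replacing `ρ²` by the square of the first coordinate of an adapted chart. -/
lemma IsAdapted.isLittleO_sq (hφ : φ ∈ IsManifold.maximalAtlas (𝓡∂ (n + 1)) ∞ M)
    {c : S.SpiCoord} (A : IsAdapted c φ) (p : Bdry n M) (hp : (p : M) ∈ φ.source) :
    (fun x => rhoOf φ x ^ 2 - S.ρ x ^ 2) =o[𝓝 (p : M)] fun x => ‖co φ x - co φ p‖ ^ 2 := by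
  have h1 := A.isLittleO hφ p hp hφ hp
  have h2 := isBigO_rho (S := S) hφ hp p.2
  have h0 : Tendsto (fun x => ‖co φ x - co φ p‖) (𝓝 (p : M)) (𝓝 0) := by
    have := ((continuousAt_co hp).sub_const (co φ p)).norm
    simpa [ContinuousAt] using this
  -- The difference of squares factors as `(ρ_φ - ρ)(ρ_φ + ρ)`, of orders two and one in the
  -- distance, hence of order three.
  have h3 : (fun x => rhoOf φ x - S.ρ x) =O[𝓝 (p : M)] fun x => ‖co φ x - co φ p‖ ^ 2 :=
    (h1.isBigO.sub ((h2.pow 2).const_mul_left (c.u (S.refSection p)))).congr_left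
      fun x => by ring
  have h4 : (fun x => ‖co φ x - co φ p‖ ^ 2) =o[𝓝 (p : M)] fun x => ‖co φ x - co φ p‖ := by
    simpa [pow_two] using (isBigO_refl (fun x => ‖co φ x - co φ p‖) (𝓝 (p : M))).mul_isLittleO
      ((isLittleO_one_iff ℝ).2 h0)
  have h5 : (fun x => rhoOf φ x + S.ρ x) =O[𝓝 (p : M)] fun x => ‖co φ x - co φ p‖ :=
    ((h3.trans h4.isBigO).add (h2.const_mul_left 2)).congr_left fun x => by ring
  refine ((h3.trans_isLittleO h4).mul_isBigO h5).congr (fun x => by ring) fun x => by ring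

variable {c₁ c₂ : S.SpiCoord}

/-- The normal two-jet of the transition function between two adapted charts. -/
lemma normal_jets (hφ₁ : φ₁ ∈ IsManifold.maximalAtlas (𝓡∂ (n + 1)) ∞ M)
    (hφ₂ : φ₂ ∈ IsManifold.maximalAtlas (𝓡∂ (n + 1)) ∞ M) (A₁ : IsAdapted c₁ φ₁)
    (A₂ : IsAdapted c₂ φ₂) (p : Bdry n M) (hp : (p : M) ∈ φ₁.source ∩ φ₂.source) :
    trans φ₁ φ₂ 0 (pair 0 (yOf φ₁ p)) = 0 ∧ dd 0 (trans φ₁ φ₂ 0) (pair 0 (yOf φ₁ p)) = 1 ∧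
      dd 0 (dd 0 (trans φ₁ φ₂ 0)) (pair 0 (yOf φ₁ p)) =
        2 * (c₁.u (S.refSection p) - c₂.u (S.refSection p)) := by
  have h1 := A₁.isLittleO hφ₁ p hp.1 hφ₁ hp.1
  have h2 := A₂.isLittleO hφ₂ p hp.2 hφ₁ hp.1
  have h3 := A₁.isLittleO_sq hφ₁ p hp.1
  -- Subtracting the two adaptation conditions eliminates `ρ`; `ρ²` is replaced by the square of the
  -- first coordinate of `φ₁`.
  have h4 : (fun x => rhoOf φ₂ x - (rhoOf φ₁ x +
      (c₁.u (S.refSection p) - c₂.u (S.refSection p)) * rhoOf φ₁ x ^ 2)) =o[𝓝 (p : M)]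
      fun x => ‖co φ₁ x - co φ₁ p‖ ^ 2 :=
    ((h2.sub h1).sub (h3.const_mul_left (c₁.u (S.refSection p) - c₂.u (S.refSection p)))).congr_left
      fun x => by ring
  have hq : (p : M) ∈ φ₁.source ∩ Bdry n M := ⟨hp.1, p.2⟩
  have h5 := isLittleO_ray hφ₁ hq h4
  obtain ⟨-, h6⟩ := tendsto_ray hφ₁ hq
  refine normal_jet_of_isLittleO (isOpen_coordDom (O := φ₁.source ∩ φ₂.source) isOpen_overlap)
    (contDiffOn_trans hφ₁ hφ₂ inter_subset_right 0) ?_ (h5.congr' ?_ .rfl)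
  · rw [← co_boundary hφ₁ hq]; exact co_mem_coordDom hp.1 hp
  · filter_upwards [h6] with t ht
    have : rhoOf φ₁ (coInv φ₁ (pair t (yOf φ₁ p))) = t := by rw [← co_zero, ht, pair_zero]
    rw [this, trans, co_zero]
    ring

end Adapted

end AsymptoticSpacetime

/-! ### The Lie derivative of the boundary metric along the gradient of a function -/

section Bilinear

variable {ι κ : Type*} [Fintype ι] [Fintype κ]

/-- The value of a bilinear form given by a matrix. -/
def bil (A : ι → ι → ℝ) (u v : ι → ℝ) : ℝ := ∑ γ, ∑ δ, A γ δ * u γ * v δ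

lemma bil_comm {A : ι → ι → ℝ} (hA : ∀ γ δ, A γ δ = A δ γ) (u v : ι → ℝ) :
    bil A u v = bil A v u := by
  unfold bil
  rw [Finset.sum_comm]
  exact Finset.sum_congr rfl fun γ _ => Finset.sum_congr rfl fun δ _ => by rw [hA]; ring

lemma bil_sum_left (A : ι → ι → ℝ) (f : κ → ι → ℝ) (c : κ → ℝ) (v : ι → ℝ) :
    bil A (fun γ => ∑ δ, c δ * f δ γ) v = ∑ δ, c δ * bil A (f δ) v := by
  simp only [bil, Finset.mul_sum, Finset.sum_mul]
  rw [Finset.sum_comm_cycle]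
  refine Finset.sum_congr rfl fun γ _ => Finset.sum_congr rfl fun δ _ =>
    Finset.sum_congr rfl fun ε _ => by ring

lemma bil_sum_form (X : κ → ι → ι → ℝ) (c : κ → ℝ) (u v : ι → ℝ) :
    bil (fun γ δ => ∑ ε, c ε * X ε γ δ) u v = ∑ ε, c ε * bil (X ε) u v := by
  simp only [bil, Finset.mul_sum, Finset.sum_mul]
  rw [Finset.sum_comm_cycle]
  refine Finset.sum_congr rfl fun γ _ => Finset.sum_congr rfl fun δ _ =>
    Finset.sum_congr rfl fun ε _ => by ring

end Bilinear

/-! ### Product, sum and chain rules for partial derivatives -/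

section PartialDerivativeRules

variable {n : ℕ} {f g : E n → ℝ} {v : E n}

lemma pd_mul (α : Fin n) (hf : DifferentiableAt ℝ f v) (hg : DifferentiableAt ℝ g v) :
    pd α (fun u => f u * g u) v = f v * pd α g v + pd α f v * g v := by
  rw [pd, fderiv_fun_mul hf hg]
  simp only [add_apply, smul_apply, smul_eq_mul, pd]
  ring

lemma pd_sum {ι : Type*} (s : Finset ι) (α : Fin n) {f : ι → E n → ℝ}
    (hf : ∀ i ∈ s, DifferentiableAt ℝ (f i) v) :
    pd α (fun u => ∑ i ∈ s, f i u) v = ∑ i ∈ s, pd α (f i) v := by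
  rw [pd, fderiv_fun_sum hf, sum_apply]
  rfl

lemma pd_bil {ι : Type*} [Fintype ι] (α : Fin n) {A : ι → ι → E n → ℝ} {x y : ι → E n → ℝ}
    (hA : ∀ γ δ, DifferentiableAt ℝ (A γ δ) v) (hx : ∀ γ, DifferentiableAt ℝ (x γ) v)
    (hy : ∀ γ, DifferentiableAt ℝ (y γ) v) :
    pd α (fun u => bil (fun γ δ => A γ δ u) (fun γ => x γ u) fun γ => y γ u) v =
      bil (fun γ δ => pd α (A γ δ) v) (fun γ => x γ v) (fun γ => y γ v) +
      bil (fun γ δ => A γ δ v) (fun γ => pd α (x γ) v) (fun γ => y γ v) +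
      bil (fun γ δ => A γ δ v) (fun γ => x γ v) (fun γ => pd α (y γ) v) := by
  have hd : ∀ γ δ, DifferentiableAt ℝ (fun u => A γ δ u * x γ u * y δ u) v := fun γ δ =>
    ((hA γ δ).mul (hx γ)).mul (hy δ)
  unfold bil
  rw [pd_sum (f := fun γ u => ∑ δ, A γ δ u * x γ u * y δ u) _ _ fun γ _ =>
    DifferentiableAt.fun_sum fun δ _ => hd γ δ, ← Finset.sum_add_distrib,
    ← Finset.sum_add_distrib]
  refine Finset.sum_congr rfl fun γ _ => ?_
  rw [pd_sum (f := fun δ u => A γ δ u * x γ u * y δ u) _ _ fun δ _ => hd γ δ,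
    ← Finset.sum_add_distrib, ← Finset.sum_add_distrib]
  refine Finset.sum_congr rfl fun δ _ => ?_
  have h1 : DifferentiableAt ℝ (fun u => A γ δ u * x γ u) v := (hA γ δ).mul (hx γ)
  rw [pd_mul (f := fun u => A γ δ u * x γ u) α h1 (hy δ), pd_mul α (hA γ δ) (hx γ)]
  ring

lemma pd_comm (α β : Fin n) (hf : ContDiffAt ℝ ∞ f v) :
    pd α (pd β f) v = pd β (pd α f) v := by
  have hs : IsSymmSndFDerivAt ℝ f v := hf.isSymmSndFDerivAt (by simpa using two_le_infty)
  have hd : DifferentiableAt ℝ (fderiv ℝ f) v :=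
    (hf.fderiv_right (m := 1) (by norm_num; exact two_le_infty)).differentiableAt (by simp)
  have key : ∀ α β : Fin n, pd α (pd β f) v = fderiv ℝ (fderiv ℝ f) v
      (EuclideanSpace.single α 1) (EuclideanSpace.single β 1) := fun α β => by
    have : HasFDerivAt (pd β f) _ v :=
      hd.hasFDerivAt.clm_apply (hasFDerivAt_const (EuclideanSpace.single β 1) _)
    conv_lhs => rw [pd, this.fderiv]
    simp
  rw [key, key, hs.eq]

/-- The chain rule for partial derivatives. -/
lemma pd_comp {θ : E n → E n} (α : Fin n) (hf : DifferentiableAt ℝ f (θ v))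
    (hθ : ∀ γ, DifferentiableAt ℝ (fun u => θ u γ) v) :
    pd α (fun u => f (θ u)) v = ∑ ε, pd α (fun u => θ u ε) v * pd ε f (θ v) := by
  have hθ' : DifferentiableAt ℝ θ v := differentiableAt_euclidean.2 hθ
  have h1 : HasFDerivAt (fun u => f (θ u)) _ v := hf.hasFDerivAt.comp v hθ'.hasFDerivAt
  have h2 : ∀ γ : Fin n, pd α (fun u => θ u γ) v =
      fderiv ℝ θ v (EuclideanSpace.single α 1) γ := fun γ => by
    have : HasFDerivAt (fun u => θ u γ) ((EuclideanSpace.proj (𝕜 := ℝ) γ).comp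
        (fderiv ℝ θ v)) v :=
      (EuclideanSpace.proj (𝕜 := ℝ) γ).hasFDerivAt.comp _ hθ'.hasFDerivAt
    rw [pd, this.fderiv]
    rfl
  rw [pd, h1.fderiv]
  set u := fderiv ℝ θ v (EuclideanSpace.single α 1) with hu
  have h3 : u = ∑ γ, u γ • (EuclideanSpace.single γ 1 : E n) := by
    ext b
    simp [Pi.single_apply]
  rw [ContinuousLinearMap.comp_apply, ← hu, h3, map_sum]
  refine Finset.sum_congr rfl fun γ _ => ?_
  rw [map_smul, h2 γ, smul_eq_mul, pd]

end PartialDerivativeRules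

/-! ### Lie derivative along a gradient as covariant Hessian -/

section LieDerivative

variable {n : ℕ}

lemma pullMetric_eq (h : E n → Matrix (Fin n) (Fin n) ℝ) (θ : E n → E n) (v : E n) :
    pullMetric h θ v = (jacobian θ v)ᵀ * h (θ v) * jacobian θ v := by
  ext α β
  simp only [pullMetric, Matrix.of_apply, Matrix.mul_apply, Matrix.transpose_apply, jacobian,
    Finset.sum_mul]
  rw [Finset.sum_comm]
  exact Finset.sum_congr rfl fun γ _ => Finset.sum_congr rfl fun δ _ => by ring

/-- The Lie derivative of the pulled back metric along `b`. -/
def lieCoef (h : E n → Matrix (Fin n) (Fin n) ℝ) (θ : E n → E n) (b : Fin n → E n → ℝ)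
    (α β : Fin n) (v : E n) : ℝ :=
  bil (fun γ δ => ∑ ε, b ε v * pd ε (fun y => h y γ δ) (θ v)) (fun γ => pd α (fun u => θ u γ) v)
      (fun γ => pd β (fun u => θ u γ) v) +
    bil (fun γ δ => h (θ v) γ δ) (fun γ => pd α (b γ) v) (fun γ => pd β (fun u => θ u γ) v) +
    bil (fun γ δ => h (θ v) γ δ) (fun γ => pd α (fun u => θ u γ) v) (fun γ => pd β (b γ) v)

lemma tangentialCoef_eq (h k : E n → Matrix (Fin n) (Fin n) ℝ) (σ w : E n → ℝ) (θ : E n → E n)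
    (b : Fin n → E n → ℝ) (α β : Fin n) (v : E n) :
    tangentialCoef h k σ w θ b α β v = lieCoef h θ b α β v + pullMetric k θ v α β -
      2 * σ (θ v) * pullMetric h θ v α β - 2 * w v * pullMetric h θ v α β := by
  simp only [tangentialCoef, lieCoef, bil, pullMetric, Matrix.of_apply, firstCoef, Finset.mul_sum,
    ← Finset.sum_add_distrib, ← Finset.sum_sub_distrib]
  refine Finset.sum_congr rfl fun γ _ => Finset.sum_congr rfl fun δ _ => ?_
  rw [Finset.sum_congr rfl fun ε _ => mul_comm (b ε v) (pd ε (fun y => h y γ δ) (θ v))]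
  ring

/-- Raising an index with the pulled back metric and pushing forward by `J` recovers the vector
whose lowered, pulled back components are `ξ`. The transposes are kept because `H` need not be
symmetric here. -/
lemma gradient_eq {J H : Matrix (Fin n) (Fin n) ℝ} {h₁ : Matrix (Fin n) (Fin n) ℝ}
    (hh : h₁ = Jᵀ * H * J) (hdet : h₁.det ≠ 0) {b ξ : Fin n → ℝ}
    (hξ : ξ = (Jᵀ * Hᵀ) *ᵥ b) : J *ᵥ ((h₁⁻¹)ᵀ *ᵥ ξ) = b := by
  subst hh
  rw [Matrix.det_mul, Matrix.det_mul, Matrix.det_transpose] at hdet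
  have hJ : IsUnit J.det := (isUnit_iff_ne_zero.2 (right_ne_zero_of_mul hdet))
  have hH : IsUnit H.det :=
    isUnit_iff_ne_zero.2 (right_ne_zero_of_mul (left_ne_zero_of_mul hdet))
  have hJH : IsUnit (Jᵀ * Hᵀ).det := by
    rw [Matrix.det_mul, Matrix.det_transpose, Matrix.det_transpose]; exact hJ.mul hH
  have h1 : ((Jᵀ * H * J)⁻¹)ᵀ = J⁻¹ * (Jᵀ * Hᵀ)⁻¹ := by
    rw [Matrix.transpose_nonsing_inv, Matrix.transpose_mul, Matrix.transpose_mul,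
      Matrix.transpose_transpose, ← Matrix.mul_assoc, Matrix.mul_inv_rev]
  rw [h1, hξ, Matrix.mulVec_mulVec, Matrix.mulVec_mulVec, Matrix.mul_assoc, Matrix.mul_assoc (J⁻¹),
    Matrix.nonsing_inv_mul _ hJH, Matrix.mul_one, Matrix.mul_nonsing_inv _ hJ, Matrix.one_mulVec]

/-- The Lie derivative of the metric along the gradient is twice the covariant Hessian. -/
theorem lieCoef_eq_covHess {U V : Set (E n)} {θ : E n → E n}
    {h h₁ : E n → Matrix (Fin n) (Fin n) ℝ} {b : Fin n → E n → ℝ} {w : E n → ℝ} {ν : ℝ} {v : E n}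
    (hU : IsOpen U) (hV : IsOpen V) (hv : v ∈ U) (hθV : MapsTo θ U V)
    (hθ : ∀ γ, ContDiffOn ℝ ∞ (fun u => θ u γ) U)
    (hh : ∀ γ δ, ContDiffOn ℝ ∞ (fun y => h y γ δ) V) (hb : ∀ γ, ContDiffOn ℝ ∞ (b γ) U)
    (hw : ContDiffOn ℝ ∞ w U) (hsymm : ∀ γ δ, h (θ v) γ δ = h (θ v) δ γ)
    (hξ : ∀ u ∈ U, ∀ α, mixedCoefZero ν h w θ b α u = 0)
    (hh₁ : ∀ u ∈ U, h₁ u = pullMetric h θ u) (hdet : (h₁ v).det ≠ 0) (hν : ν ≠ 0)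
    (α β : Fin n) :
    lieCoef h θ b α β v = -2 * ν⁻¹ * covHess h₁ w v α β := by
  have hUv := hU.mem_nhds hv
  have dif : ∀ {f : E n → ℝ}, ContDiffOn ℝ ∞ f U → DifferentiableAt ℝ f v := fun hf =>
    (hf.contDiffAt hUv).differentiableAt (by simp)
  have dθ : ∀ γ, DifferentiableAt ℝ (fun u => θ u γ) v := fun γ => dif (hθ γ)
  have dθd : ∀ (γ α : Fin n), DifferentiableAt ℝ (pd α fun u => θ u γ) v := fun γ α =>
    dif (contDiffOn_pd hU (hθ γ) α)
  have hθc : ContDiffOn ℝ ∞ θ U := contDiffOn_euclidean.2 hθ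
  have dh : ∀ γ δ, DifferentiableAt ℝ (fun u => h (θ u) γ δ) v := fun γ δ =>
    dif ((hh γ δ).comp hθc hθV)
  have db : ∀ γ, DifferentiableAt ℝ (b γ) v := fun γ => dif (hb γ)
  set H : Fin n → Fin n → ℝ := fun γ δ => h (θ v) γ δ with hH
  set DH : Fin n → Fin n → Fin n → ℝ := fun α γ δ => pd α (fun u => h (θ u) γ δ) v with hDH
  set Θ : Fin n → Fin n → ℝ := fun α γ => pd α (fun u => θ u γ) v with hΘ
  set ΘΘ : Fin n → Fin n → Fin n → ℝ := fun α β γ => pd α (pd β fun u => θ u γ) v with hΘΘ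
  have hΘΘs : ∀ α β, ΘΘ α β = ΘΘ β α := fun α β => funext fun γ =>
    pd_comm α β ((hθ γ).contDiffAt hUv)
  set ξ : Fin n → E n → ℝ := fun α u => bil (fun γ δ => h (θ u) γ δ) (fun γ => b γ u)
    (fun γ => pd α (fun u => θ u γ) u) with hξd
  set B : Fin n → ℝ := fun γ => b γ v with hB
  set DB : Fin n → Fin n → ℝ := fun α γ => pd α (b γ) v with hDB
  -- the gradient of `w`
  have hwξ : ∀ u ∈ U, ∀ α, pd α w u = -ν * ξ α u := fun u hu α => by
    have := hξ u hu α
    simp only [mixedCoefZero] at this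
    change ν⁻¹ * pd α w u + ξ α u = 0 at this
    field_simp at this
    linarith
  have hww : ∀ α β, pd α (pd β w) v = -ν * pd α (ξ β) v := fun α β => by
    rw [← pd_const_mul]
    exact pd_congr α (by filter_upwards [hUv] with u hu using hwξ u hu β)
  -- `ξ`, the lowered form of `b`, is a multiple of `dw`, hence closed.
  have hξξ : ∀ α β, pd α (ξ β) v = pd β (ξ α) v := fun α β => by
    have h1 := pd_comm α β (hw.contDiffAt hUv)
    rw [hww, hww] at h1
    exact mul_left_cancel₀ (neg_ne_zero.2 hν) h1
  have hdξ : ∀ α β, pd α (ξ β) v = bil (DH α) B (Θ β) + bil H (DB α) (Θ β) + bil H B (ΘΘ α β) :=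
    fun α β => pd_bil α dh db fun γ => dθd γ β
  -- derivatives of the metric
  have hdh₁ : ∀ δ α β, pd δ (fun u => h₁ u α β) v =
      bil (DH δ) (Θ α) (Θ β) + bil H (ΘΘ δ α) (Θ β) + bil H (Θ α) (ΘΘ δ β) := fun δ α β => by
    rw [← pd_bil δ dh (fun γ => dθd γ α) fun γ => dθd γ β]
    refine pd_congr δ ?_
    filter_upwards [hUv] with u hu
    rw [hh₁ u hu]
    rfl
  -- the vector field in the new coordinates
  set X : Fin n → ℝ := fun δ => ∑ γ, (h₁ v)⁻¹ γ δ * ξ γ v with hX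
  have hBX : B = fun γ => ∑ δ, X δ * Θ δ γ := by
    have h1 := gradient_eq (J := jacobian θ v) (H := h (θ v)) (b := B) (ξ := fun α => ξ α v)
      (by rw [hh₁ v hv, pullMetric_eq]) hdet (by
        ext α
        simp only [hξd, bil, Matrix.mulVec, dotProduct, Matrix.mul_apply, Matrix.transpose_apply,
          jacobian, Matrix.of_apply, Finset.sum_mul, hB]
        exact Finset.sum_congr rfl fun γ _ => Finset.sum_congr rfl fun δ _ => by ring)
    rw [← h1]
    ext γ
    simp only [Matrix.mulVec, dotProduct, Matrix.transpose_apply, jacobian, Matrix.of_apply, hX, hΘ]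
    exact Finset.sum_congr rfl fun δ _ => mul_comm _ _
  -- Since `B` is the push-forward of `X`, differentiating `h` along `B` is differentiating `h ∘ θ`
  -- along `X`.
  have hDHX : ∀ γ δ, ∑ ε, B ε * pd ε (fun y => h y γ δ) (θ v) = ∑ ε, X ε * DH ε γ δ :=
    fun γ δ => by
      have h1 : ∀ ε, DH ε γ δ = ∑ μ, Θ ε μ * pd μ (fun y => h y γ δ) (θ v) := fun ε =>
        pd_comp ε (((hh γ δ).contDiffAt (hV.mem_nhds (hθV hv))).differentiableAt (by simp)) dθ
      simp only [h1, hBX, Finset.sum_mul, Finset.mul_sum]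
      rw [Finset.sum_comm]
      exact Finset.sum_congr rfl fun ε _ => Finset.sum_congr rfl fun μ _ => by ring
  have hΓ : ∑ γ, christoffel h₁ γ α β v * pd γ w v = -ν / 2 * (bil (DH α) B (Θ β) +
      bil (DH β) B (Θ α) - bil (fun γ δ => ∑ ε, X ε * DH ε γ δ) (Θ α) (Θ β) +
      2 * bil H B (ΘΘ α β)) := by
    have h1 : ∑ γ, christoffel h₁ γ α β v * pd γ w v = -ν / 2 * ∑ δ, X δ *
        (pd α (fun u => h₁ u δ β) v + pd β (fun u => h₁ u δ α) v - pd δ (fun u => h₁ u α β) v) := by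
      simp only [christoffel, hX, Finset.mul_sum, Finset.sum_mul]
      rw [Finset.sum_comm]
      refine Finset.sum_congr rfl fun δ _ => Finset.sum_congr rfl fun γ _ => ?_
      rw [hwξ v hv γ]
      ring
    have h2 : ∀ A w, bil A B w = ∑ δ, X δ * bil A (Θ δ) w := fun A w => by
      rw [← bil_sum_left, hBX]
    rw [h1, bil_sum_form, h2, h2, h2, Finset.mul_sum (a := (2 : ℝ)), ← Finset.sum_add_distrib,
      ← Finset.sum_sub_distrib, ← Finset.sum_add_distrib]
    congr 1
    refine Finset.sum_congr rfl fun δ _ => ?_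
    rw [hdh₁, hdh₁, hdh₁, hΘΘs α δ, hΘΘs β δ, hΘΘs β α,
      bil_comm hsymm (ΘΘ δ β) (Θ α)]
    ring
  have hL : lieCoef h θ b α β v = bil (fun γ δ => ∑ ε, X ε * DH ε γ δ) (Θ α) (Θ β) +
      bil H (DB α) (Θ β) + bil H (Θ α) (DB β) := by
    rw [← funext₂ hDHX]
    rfl
  have hC : covHess h₁ w v α β = pd α (pd β w) v - ∑ γ, christoffel h₁ γ α β v * pd γ w v := rfl
  -- Adding the product rules for `∂_α ξ_β` and `∂_β ξ_α` gives `2 ∂_α ξ_β`. The terms in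
  -- derivatives of `h` contracted with `B` and in second derivatives of `θ` cancel against the
  -- Christoffel term, leaving the Lie derivative.
  have e1 := hdξ α β
  have e2 := hdξ β α
  rw [← hξξ α β, hΘΘs β α, bil_comm hsymm (DB β)] at e2
  rw [hL, hC, hΓ, hww]
  field_simp
  linarith

end LieDerivative

/-! ### Symmetry and nondegeneracy of the boundary metric, invariance under congruence -/

section Signature

variable {n : ℕ} {A : Matrix (Fin n) (Fin n) ℝ}

lemma IsLorentzianMatrix.isSymm (h : IsLorentzianMatrix A) : Aᵀ = A := by
  obtain ⟨P, hP, hA⟩ := h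
  have h1 : Pᵀ * Aᵀ * P = Pᵀ * A * P := by
    have := congrArg Matrix.transpose hA
    rwa [Matrix.transpose_mul, Matrix.transpose_mul, Matrix.transpose_transpose,
      Matrix.diagonal_transpose, ← hA, ← Matrix.mul_assoc] at this
  have hP' : IsUnit P := (Matrix.isUnit_iff_isUnit_det _).2 hP
  have hPt : IsUnit Pᵀ := (Matrix.isUnit_iff_isUnit_det _).2 (by rwa [Matrix.det_transpose])
  exact hPt.mul_left_cancel (hP'.mul_right_cancel h1)

lemma IsLorentzianMatrix.det_ne_zero (h : IsLorentzianMatrix A) : A.det ≠ 0 := by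
  obtain ⟨P, hP, hA⟩ := h
  intro h0
  have h1 := congrArg Matrix.det hA
  rw [Matrix.det_mul, Matrix.det_mul, h0, Matrix.det_diagonal] at h1
  simp only [mul_zero, zero_mul] at h1
  obtain ⟨i, -, hi⟩ := Finset.prod_eq_zero_iff.1 h1.symm
  split_ifs at hi <;> simp at hi

lemma IsLorentzianMatrix.congruence (h : IsLorentzianMatrix A) {J : Matrix (Fin n) (Fin n) ℝ}
    (hJ : IsUnit J.det) : IsLorentzianMatrix (Jᵀ * A * J) := by
  obtain ⟨P, hP, hA⟩ := h
  refine ⟨J⁻¹ * P, ?_, ?_⟩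
  · rw [Matrix.det_mul]
    exact (Matrix.isUnit_nonsing_inv_det _ hJ).mul hP
  · have h1 : (J⁻¹)ᵀ * Jᵀ = 1 := by
      rw [← Matrix.transpose_mul, Matrix.mul_nonsing_inv _ hJ, Matrix.transpose_one]
    calc (J⁻¹ * P)ᵀ * (Jᵀ * A * J) * (J⁻¹ * P)
        = Pᵀ * ((J⁻¹)ᵀ * Jᵀ) * A * (J * J⁻¹) * P := by
          simp only [Matrix.transpose_mul, Matrix.mul_assoc]
      _ = _ := by rw [h1, Matrix.mul_nonsing_inv _ hJ, Matrix.mul_one, Matrix.mul_one, hA]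

lemma posDef_congruence (h : A.PosDef) {J : Matrix (Fin n) (Fin n) ℝ}
    (hJ : IsUnit J.det) : (Jᵀ * A * J).PosDef := by
  have := h.conjTranspose_mul_mul_same (B := J)
    (Matrix.mulVec_injective_of_isUnit ((Matrix.isUnit_iff_isUnit_det _).2 hJ))
  rwa [Matrix.conjTranspose_eq_transpose_of_trivial] at this

variable {M : Type*} [TopologicalSpace M] [ChartedSpace (EuclideanHalfSpace (n + 1)) M]
variable {φ : OpenPartialHomeomorph M (EuclideanHalfSpace (n + 1))}
variable [IsManifold (𝓡∂ (n + 1)) ∞ M]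
variable {ghat : BilinField n M} {ν : ℝ} {h k : E n → Matrix (Fin n) (Fin n) ℝ} {σ : E n → ℝ}
variable {y : E n}

lemma IsBeigSchmidt.ne_zero (hB : IsBeigSchmidt ghat ν φ h k σ) (hy : y ∈ bdryImage φ) :
    ν ≠ 0 := by
  rcases hB.signature y hy with h | h
  · exact h.1.ne'
  · exact h.1.ne

lemma IsBeigSchmidt.transpose_eq (hB : IsBeigSchmidt ghat ν φ h k σ) (hy : y ∈ bdryImage φ) :
    (h y)ᵀ = h y := by
  rcases hB.signature y hy with h | h
  · exact h.2.isSymm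
  · exact h.2.isHermitian

lemma IsBeigSchmidt.det_ne_zero (hB : IsBeigSchmidt ghat ν φ h k σ) (hy : y ∈ bdryImage φ) :
    (h y).det ≠ 0 := by
  rcases hB.signature y hy with h | h
  · exact h.2.det_ne_zero
  · exact h.2.det_pos.ne'

end Signature

/-! ### The linear map that determines the normal jets -/

section Contraction

variable {n : ℕ}

lemma contraction_eq (H : Matrix (Fin n) (Fin n) ℝ) (x : Fin n → ℝ) (θ : E n → E n) (v : E n)
    (α : Fin n) : ∑ γ, ∑ δ, H γ δ * x γ * pd α (fun u => θ u δ) v =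
      (((jacobian θ v)ᵀ * Hᵀ) *ᵥ x) α := by
  simp only [Matrix.mulVec, dotProduct, Matrix.mul_apply, Matrix.transpose_apply, jacobian,
    Matrix.of_apply, Finset.sum_mul]
  exact Finset.sum_congr rfl fun γ _ => Finset.sum_congr rfl fun δ _ => by ring

/-- If the pulled back metric is nondegenerate, so are `h` at `θ v` and the Jacobian, and `x ↦ h(x,
∂_α θ)` is injective. The jets `b` and `b'` enter the mixed equations through this map. -/
lemma eq_zero_of_contraction {h : E n → Matrix (Fin n) (Fin n) ℝ} {x : Fin n → ℝ}
    {θ : E n → E n} {v : E n} (hdet : (pullMetric h θ v).det ≠ 0)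
    (hx : ∀ α, ∑ γ, ∑ δ, h (θ v) γ δ * x γ * pd α (fun u => θ u δ) v = 0) : x = 0 := by
  refine Matrix.eq_zero_of_mulVec_eq_zero (M := (jacobian θ v)ᵀ * (h (θ v))ᵀ) ?_
    (funext fun α => (contraction_eq _ _ _ _ α).symm.trans (hx α))
  rw [pullMetric_eq, Matrix.det_mul, Matrix.det_mul] at hdet
  rw [Matrix.det_mul, Matrix.det_transpose (h (θ v))]
  exact left_ne_zero_of_mul hdet

lemma covHess_neg (h : E n → Matrix (Fin n) (Fin n) ℝ) (w : E n → ℝ) (v : E n) :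
    covHess h (fun u => -w u) v = -covHess h w v := by
  have h1 : ∀ (α : Fin n) (f : E n → ℝ), pd α (fun u => -f u) = fun u => -pd α f u :=
    fun α f => funext fun u => by
      rw [pd, fderiv_fun_neg]; rfl
  ext α β
  simp only [covHess, Matrix.of_apply, Matrix.neg_apply, h1]
  simp only [mul_neg, Finset.sum_neg_distrib]
  ring

lemma isBigO_euclidean {ι : Type*} {l : Filter ι} {f : ι → E n} {g : ι → ℝ}
    (h : ∀ γ, (fun x => f x γ) =O[l] g) : f =O[l] g := by
  have h1 : (fun x => ∑ γ, f x γ • (EuclideanSpace.single γ 1 : E n)) =O[l] g :=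
    IsBigO.fun_sum fun γ _ => by
      refine IsBigO.trans (IsBigO.of_bound 1 (.of_forall fun x => ?_)) (h γ)
      simp [norm_smul]
  refine h1.congr_left fun x => ?_
  ext b
  simp [Pi.single_apply]

end Contraction

/-! ### Transformation law and rigidity for transition maps -/

namespace TransitionJets

section

variable {n : ℕ} {M : Type*} [TopologicalSpace M] [ChartedSpace (EuclideanHalfSpace (n + 1)) M]
variable {φ φ' : OpenPartialHomeomorph M (EuclideanHalfSpace (n + 1))} {O : Set M} {q : M}
variable [IsManifold (𝓡∂ (n + 1)) ∞ M]
variable {w c : E n → ℝ} {θ : E n → E n} {b b' : Fin n → E n → ℝ}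
  (J : TransitionJets φ φ' O w c θ b b')

include J

lemma isOpen_preimage : IsOpen (pair 0 ⁻¹' coordDom φ O) :=
  (isOpen_coordDom J.isOpen).preimage (contDiff_pair_zero (m := 0)).continuous

lemma contDiffOn_boundary {F : E (n + 1) → ℝ} (hF : ContDiffOn ℝ ∞ F (coordDom φ O ∩ HS n)) :
    ContDiffOn ℝ ∞ (fun v => F (pair 0 v)) (pair 0 ⁻¹' coordDom φ O) :=
  hF.comp contDiff_pair_zero.contDiffOn fun v hv => ⟨hv, pair_mem_HS le_rfl v⟩

lemma contDiffOn_theta (γ : Fin n) :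
    ContDiffOn ℝ ∞ (fun v => θ v γ) (pair 0 ⁻¹' coordDom φ O) :=
  (J.contDiffOn_boundary (J.smooth γ.succ)).congr fun v hv => (J.y_zero v hv γ).symm

lemma contDiffOn_b (γ : Fin n) : ContDiffOn ℝ ∞ (b γ) (pair 0 ⁻¹' coordDom φ O) :=
  (J.contDiffOn_boundary (contDiffOn_dd (J.smooth γ.succ) (isOpen_coordDom J.isOpen) 0)).congr
    fun v hv => (J.y_one v hv γ).symm

lemma mapsTo_theta : MapsTo θ (pair 0 ⁻¹' coordDom φ O) (bdryImage φ') := fun v hv => by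
  rw [← J.yOf_coInv hv]
  exact yOf_mem_bdryImage ⟨J.sub_right (coInv_mem hv), coInv_pair_mem_Bdry J.mem hv⟩

lemma coInv_mem_boundary {v : E n} (hv : pair 0 v ∈ coordDom φ O) :
    coInv φ (pair 0 v) ∈ O ∩ Bdry n M := ⟨coInv_mem hv, coInv_pair_mem_Bdry J.mem hv⟩

lemma yOf_mem (hq : q ∈ O ∩ Bdry n M) : pair 0 (yOf φ q) ∈ coordDom φ O := by
  rw [← co_boundary J.mem ⟨J.sub_left hq.1, hq.2⟩]
  exact co_mem_coordDom (J.sub_left hq.1) hq.1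

lemma theta_yOf (hq : q ∈ O ∩ Bdry n M) : θ (yOf φ q) = yOf φ' q := by
  rw [← J.yOf_coInv (J.yOf_mem hq), ← co_boundary J.mem ⟨J.sub_left hq.1, hq.2⟩,
    coInv_co (J.sub_left hq.1)]

variable {ghat : BilinField n M} {ν : ℝ} {h k h₁ k₁ : E n → Matrix (Fin n) (Fin n) ℝ}
  {σ σ₁ : E n → ℝ} (hB : IsBeigSchmidt ghat ν φ' h k σ) (hB₁ : IsBeigSchmidt ghat ν φ h₁ k₁ σ₁)
  (hsymm : ∀ x ∈ Inn n M, ∀ v w, ghat x v w = ghat x w v)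

include hB hB₁ hsymm

/-- The transformation law of the coefficients of a Beig–Schmidt chart. -/
theorem transformation (hw : ContDiffOn ℝ ∞ w (pair 0 ⁻¹' coordDom φ O))
    (hq : q ∈ O ∩ Bdry n M) :
    pullMetric h θ (yOf φ q) = h₁ (yOf φ q) ∧
      pullMetric k θ (yOf φ q) = k₁ (yOf φ q) + (2 : ℝ) • (w (yOf φ q) • h₁ (yOf φ q) +
        ν⁻¹ • covHess h₁ w (yOf φ q)) ∧ σ₁ (yOf φ q) = σ (θ (yOf φ q)) := by
  have hq' : q ∈ φ.source ∩ Bdry n M := ⟨J.sub_left hq.1, hq.2⟩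
  have hν := hB₁.ne_zero (yOf_mem_bdryImage hq')
  have hσ := (J.compare_rho_rho hB hsymm hB₁ hq hν).1
  have hv := J.yOf_mem hq
  refine ⟨?_, ?_, hσ.symm⟩
  · ext α β
    exact (J.compare_y_y hB hsymm hB₁ hq α β).1
  · ext α β
    have h1 := J.compare_y_y hB hsymm hB₁ hq α β
    have h2 := lieCoef_eq_covHess (h := h) (h₁ := h₁) (ν := ν) J.isOpen_preimage
      (isOpen_bdryImage J.mem') hv J.mapsTo_theta J.contDiffOn_theta hB.smooth_h
      J.contDiffOn_b hw
      (fun γ δ => congrFun (congrFun (hB.transpose_eq (J.mapsTo_theta hv)) δ) γ)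
      (fun u hu α => by
        have := (J.compare_rho_y hB hsymm hB₁ (J.coInv_mem_boundary hu) α).1
        rwa [yOf_coInv_pair le_rfl hu] at this)
      (fun u hu => by
        ext α β
        have := (J.compare_y_y hB hsymm hB₁ (J.coInv_mem_boundary hu) α β).1
        rwa [yOf_coInv_pair le_rfl hu, eq_comm] at this)
      (hB₁.det_ne_zero (yOf_mem_bdryImage hq')) hν α β
    rw [tangentialCoef_eq, h2, h1.1, hσ] at h1
    simp only [Matrix.add_apply, Matrix.smul_apply, smul_eq_mul]
    linarith [h1.2]

end

section

variable {n : ℕ} {M : Type*} [TopologicalSpace M] [ChartedSpace (EuclideanHalfSpace (n + 1)) M]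
variable {φ φ' : OpenPartialHomeomorph M (EuclideanHalfSpace (n + 1))} {O : Set M} {q : M}
variable [IsManifold (𝓡∂ (n + 1)) ∞ M]
variable {c : E n → ℝ} {θ : E n → E n} {b b' : Fin n → E n → ℝ}
  (J : TransitionJets φ φ' O (fun _ => 0) c θ b b')
variable {ghat : BilinField n M} {ν : ℝ} {h k h₁ k₁ : E n → Matrix (Fin n) (Fin n) ℝ}
  {σ σ₁ : E n → ℝ} (hB : IsBeigSchmidt ghat ν φ' h k σ) (hB₁ : IsBeigSchmidt ghat ν φ h₁ k₁ σ₁)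
  (hsymm : ∀ x ∈ Inn n M, ∀ v w, ghat x v w = ghat x w v)

include J hB hB₁ hsymm

/-- Rigidity: a transition map that is the identity to lowest orders has no further jets. -/
theorem rigidity {v : E n} (hv : pair 0 v ∈ coordDom φ O) :
    (∀ γ, b γ v = 0) ∧ ∀ γ, b' γ v = 0 := by
  have hν : ν ≠ 0 := hB₁.ne_zero
    (yOf_mem_bdryImage ⟨J.sub_left (coInv_mem hv), coInv_pair_mem_Bdry J.mem hv⟩)
  have hdet : ∀ {u : E n}, pair 0 u ∈ coordDom φ O → (pullMetric h θ u).det ≠ 0 := fun {u} hu => by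
    have h1 := J.coInv_mem_boundary hu
    have h2 : pullMetric h θ u = h₁ u := by
      ext α β
      have := (J.compare_y_y hB hsymm hB₁ h1 α β).1
      rwa [yOf_coInv_pair le_rfl hu] at this
    have h3 := hB₁.det_ne_zero (yOf_mem_bdryImage ⟨J.sub_left h1.1, h1.2⟩)
    rwa [yOf_coInv_pair le_rfl hu, ← h2] at h3
  have hb : ∀ {u : E n}, pair 0 u ∈ coordDom φ O → ∀ γ, b γ u = 0 := fun {u} hu γ => by
    refine congrFun (eq_zero_of_contraction (x := fun γ => b γ u) (hdet hu) fun α => ?_) γ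
    have := (J.compare_rho_y hB hsymm hB₁ (J.coInv_mem_boundary hu) α).1
    rw [yOf_coInv_pair le_rfl hu, mixedCoefZero, pd_const, mul_zero, zero_add] at this
    exact this
  have hc : ∀ {u : E n}, pair 0 u ∈ coordDom φ O → c u = 0 := fun {u} hu => by
    have := (J.compare_rho_rho hB hsymm hB₁ (J.coInv_mem_boundary hu) hν).2
    rw [yOf_coInv_pair le_rfl hu] at this
    simp only [radialCoef, hb hu, mul_zero, zero_mul, Finset.sum_const_zero, add_zero] at this
    have h2 : ν⁻¹ * 2 ≠ 0 := by positivity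
    have h3 : ν⁻¹ * 2 * c u = 0 := by rw [← this]; ring
    exact (mul_eq_zero.1 h3).resolve_left h2
  refine ⟨hb hv, fun γ => ?_⟩
  refine congrFun (eq_zero_of_contraction (x := fun γ => b' γ v) (hdet hv) fun α => ?_) γ
  have := (J.compare_rho_y hB hsymm hB₁ (J.coInv_mem_boundary hv) α).2
  -- `c` vanishes on a neighbourhood of `v`, not only at `v`; this is why the preceding facts are
  -- proved at all boundary points. Only the `b'` term of the mixed equation then remains.
  have h0 : pd α c v = 0 :=
    (pd_congr α ((J.nhds_pair hv).mono fun u hu => hc hu)).trans (pd_const α 0)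
  rw [yOf_coInv_pair le_rfl hv] at this
  simpa only [mixedCoefOne, pd_const, hb hv, h0, mul_zero, zero_mul, zero_add, add_zero] using this

end

end TransitionJets

/-! ### Uniqueness of adapted charts and change of fibre coordinate -/

namespace AsymptoticSpacetime

variable {n : ℕ} {M : Type*} [TopologicalSpace M] [ChartedSpace (EuclideanHalfSpace (n + 1)) M]
variable {φ₁ φ₂ : OpenPartialHomeomorph M (EuclideanHalfSpace (n + 1))} {q : M}
variable [IsManifold (𝓡∂ (n + 1)) ∞ M] {S : AsymptoticSpacetime n M} {c₁ c₂ : S.SpiCoord}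

/-- The transition map between two adapted charts. -/
lemma transitionJets (hφ₁ : φ₁ ∈ IsManifold.maximalAtlas (𝓡∂ (n + 1)) ∞ M)
    (hφ₂ : φ₂ ∈ IsManifold.maximalAtlas (𝓡∂ (n + 1)) ∞ M) (A₁ : IsAdapted c₁ φ₁)
    (A₂ : IsAdapted c₂ φ₂) {w : E n → ℝ}
    (hw : ∀ p : Bdry n M, (p : M) ∈ φ₁.source ∩ φ₂.source →
      c₁.u (S.refSection p) - c₂.u (S.refSection p) = w (yOf φ₁ p)) :
    TransitionJets φ₁ φ₂ (φ₁.source ∩ φ₂.source) w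
      (fun v => dd 0 (dd 0 (dd 0 (trans φ₁ φ₂ 0))) (pair 0 v) / 6)
      (fun v => yOf φ₂ (coInv φ₁ (pair 0 v))) (fun γ v => dd 0 (trans φ₁ φ₂ γ.succ) (pair 0 v))
      (fun γ v => dd 0 (dd 0 (trans φ₁ φ₂ γ.succ)) (pair 0 v)) where
  mem := hφ₁
  mem' := hφ₂
  isOpen := isOpen_overlap
  sub := le_rfl
  rho_one v hv := by
    have := (normal_jets hφ₁ hφ₂ A₁ A₂ ⟨_, coInv_pair_mem_Bdry hφ₁ hv⟩ (coInv_mem hv)).2.1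
    rwa [yOf_coInv_pair le_rfl hv] at this
  rho_two v hv := by
    have := (normal_jets hφ₁ hφ₂ A₁ A₂ ⟨_, coInv_pair_mem_Bdry hφ₁ hv⟩ (coInv_mem hv)).2.2
    rwa [hw _ (coInv_mem hv), yOf_coInv_pair le_rfl hv] at this
  rho_three v hv := by ring
  y_zero v hv γ := rfl
  y_one v hv γ := rfl
  y_two v hv γ := rfl

/-- Adapted charts are unique up to third order. -/
theorem IsAdapted.unique {c : S.SpiCoord} {h k h' k' : E n → Matrix (Fin n) (Fin n) ℝ}
    {σ σ' : E n → ℝ} (hB₁ : IsBeigSchmidt S.ghat S.ν₀ φ₁ h k σ)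
    (hB₂ : IsBeigSchmidt S.ghat S.ν₀ φ₂ h' k' σ') (A₁ : IsAdapted c φ₁) (A₂ : IsAdapted c φ₂)
    (hq : q ∈ φ₁.source ∩ φ₂.source ∩ Bdry n M) :
    ((fun x => rhoOf φ₂ x - rhoOf φ₁ x) =O[𝓝 q] fun x => rhoOf φ₁ x ^ 3) ∧
      ((fun x => yOf φ₂ x - yOf φ₁ x) =O[𝓝 q] fun x => rhoOf φ₁ x ^ 3) := by
  have J := transitionJets hB₁.mem_atlas hB₂.mem_atlas A₁ A₂ (w := fun _ => 0)
    fun p hp => sub_self _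
  have hev := eventually_pair_mem J.mem J.isOpen J.sub_left hq
  have hO := J.isOpen.mem_nhds hq.1
  constructor
  · refine (J.taylor_nhds (J.smooth 0) hq 3).congr' ?_ .rfl
    filter_upwards [hev, hO] with x hx hxO
    simp only [Finset.sum_range_succ, Finset.range_zero, Finset.sum_empty, Function.iterate_succ,
      Function.iterate_zero, Function.comp_apply, id_eq, J.rho_one _ hx, J.rho_two _ hx,
      trans_zero_boundary J.mem J.mem' J.sub_right hx, trans_co hxO.1, co_zero, Nat.factorial]
    norm_num
  · refine isBigO_euclidean fun γ => ?_
    refine (J.taylor_nhds (J.smooth γ.succ) hq 3).congr' ?_ .rfl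
    filter_upwards [hev, hO] with x hx hxO
    -- For `ρ` the adaptation alone fixes the jet up to second order; for `y` the metric is needed,
    -- to exclude the terms `b r` and `½ b' r²`.
    obtain ⟨h1, h2⟩ := J.rigidity hB₂ hB₁ S.ghat_symm hx
    have h3 : yOf φ₂ (coInv φ₁ (pair 0 (yOf φ₁ x))) = yOf φ₁ x := by
      have hp := coInv_mem hx
      rw [A₂.y_eq ⟨_, coInv_pair_mem_Bdry J.mem hx⟩ hp.2,
        ← A₁.y_eq ⟨_, coInv_pair_mem_Bdry J.mem hx⟩ hp.1, yOf_coInv_pair le_rfl hx]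
    simp only [Finset.sum_range_succ, Finset.range_zero, Finset.sum_empty, Function.iterate_succ,
      Function.iterate_zero, Function.comp_apply, id_eq, h1, h2, J.y_zero _ hx, h3,
      trans_co hxO.1, co_succ, Nat.factorial]
    norm_num

/-- The change of the first coordinate determines the change of the fibre coordinate. -/
theorem u_eq_iff {w : E n → ℝ} (hφ₁ : φ₁ ∈ IsManifold.maximalAtlas (𝓡∂ (n + 1)) ∞ M)
    (hφ₂ : φ₂ ∈ IsManifold.maximalAtlas (𝓡∂ (n + 1)) ∞ M)
    (A₁ : IsAdapted c₁ φ₁) (A₂ : IsAdapted c₂ φ₂) :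
    (∀ z : S.Spi, z.pt ∈ φ₁.source ∩ φ₂.source →
      c₂.u z = c₁.u z + w (c₁.y ⟨z.pt, z.pt_mem⟩)) ↔
    ∀ q ∈ φ₁.source ∩ φ₂.source ∩ Bdry n M,
      (fun x => rhoOf φ₂ x - (rhoOf φ₁ x - w (yOf φ₁ x) * rhoOf φ₁ x ^ 2))
        =O[𝓝 q] fun x => rhoOf φ₁ x ^ 3 := by
  constructor
  · intro hu q hq
    -- The sign: `transitionJets` takes the coefficient of `+ρ₁²` in `ρ₂`, which is `u₁ - u₂`.
    have J := transitionJets hφ₁ hφ₂ A₁ A₂ (w := fun v => -w v) fun p hp => by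
      rw [A₁.y_eq p hp.1]
      have h0 : c₂.u (S.refSection p) = c₁.u (S.refSection p) + w (c₁.y p) :=
        hu (S.refSection p) hp
      linarith
    refine (J.taylor_nhds (J.smooth 0) hq 3).congr' ?_ .rfl
    filter_upwards [eventually_pair_mem J.mem J.isOpen J.sub_left hq, J.isOpen.mem_nhds hq.1]
      with x hx hxO
    simp only [Finset.sum_range_succ, Finset.range_zero, Finset.sum_empty, Function.iterate_succ,
      Function.iterate_zero, Function.comp_apply, id_eq, J.rho_one _ hx, J.rho_two _ hx,
      trans_zero_boundary J.mem J.mem' J.sub_right hx, trans_co hxO.1, co_zero, Nat.factorial]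
    push_cast
    ring
  · intro H z hz
    have hq : z.pt ∈ φ₁.source ∩ Bdry n M := ⟨hz.1, z.pt_mem⟩
    obtain ⟨h1, h2⟩ := tendsto_ray hφ₁ hq
    have h3 := (H z.pt ⟨hz, z.pt_mem⟩).comp_tendsto (h1.mono_right nhdsWithin_le_nhds)
    have h4 : (fun t : ℝ => trans φ₁ φ₂ 0 (pair t (yOf φ₁ z.pt)) -
        (0 + 1 * t + (-w (yOf φ₁ z.pt)) * t ^ 2)) =O[𝓝[>] 0] fun t => t ^ 3 := by
      refine h3.congr' ?_ ?_
      · filter_upwards [h2] with t ht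
        have e1 : rhoOf φ₁ (coInv φ₁ (pair t (yOf φ₁ z.pt))) = t := by
          rw [← co_zero, ht, pair_zero]
        have e2 : yOf φ₁ (coInv φ₁ (pair t (yOf φ₁ z.pt))) = yOf φ₁ z.pt := by
          rw [← tl_co, ht, tl_pair]
        rw [Function.comp_apply, e1, e2, trans, co_zero]
        ring
      · filter_upwards [h2] with t ht
        rw [Function.comp_apply, ← co_zero, ht, pair_zero]
    have h5 := normal_jet_of_isLittleO (isOpen_coordDom (O := φ₁.source ∩ φ₂.source) isOpen_overlap)
      (contDiffOn_trans hφ₁ hφ₂ inter_subset_right 0)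
      (by rw [← co_boundary hφ₁ hq]; exact co_mem_coordDom hz.1 hz)
      (h4.trans_isLittleO ((isLittleO_pow_pow (by norm_num : 2 < 3)).mono nhdsWithin_le_nhds))
    have h6 := normal_jets hφ₁ hφ₂ A₁ A₂ ⟨z.pt, z.pt_mem⟩ hz
    have h7 := u_sub_u c₁ c₂ (S.refSection ⟨z.pt, z.pt_mem⟩) z rfl (A₁.mem_source _ hz.1)
      (A₂.mem_source _ hz.2)
    rw [h5.2.2] at h6
    rw [← A₁.y_eq ⟨z.pt, z.pt_mem⟩ hz.1]
    linarith [h6.2.2]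

/-- The transformation law under a change of the coordinate system on `Spi`. -/
theorem change_of_coordinates {h₁ k₁ h₂ k₂ : E n → Matrix (Fin n) (Fin n) ℝ}
    {σ₁ σ₂ w : E n → ℝ} (hB₁ : IsBeigSchmidt S.ghat S.ν₀ φ₁ h₁ k₁ σ₁)
    (hB₂ : IsBeigSchmidt S.ghat S.ν₀ φ₂ h₂ k₂ σ₂) (A₁ : IsAdapted c₁ φ₁) (A₂ : IsAdapted c₂ φ₂)
    (hw : ContDiffOn ℝ ∞ w (yOf φ₁ '' (φ₁.source ∩ φ₂.source ∩ Bdry n M)))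
    (hu : ∀ z : S.Spi, z.pt ∈ φ₁.source ∩ φ₂.source →
      c₂.u z = c₁.u z + w (c₁.y ⟨z.pt, z.pt_mem⟩))
    (p : Bdry n M) (hp : (p : M) ∈ φ₁.source ∩ φ₂.source) :
    (jacobian (fun v => c₂.y (c₁.y.symm v)) (c₁.y p))ᵀ * h₂ (c₂.y p) *
        jacobian (fun v => c₂.y (c₁.y.symm v)) (c₁.y p) = h₁ (c₁.y p) ∧
      (jacobian (fun v => c₂.y (c₁.y.symm v)) (c₁.y p))ᵀ * k₂ (c₂.y p) *
        jacobian (fun v => c₂.y (c₁.y.symm v)) (c₁.y p) = k₁ (c₁.y p) -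
          (2 : ℝ) • (w (c₁.y p) • h₁ (c₁.y p) + S.ν₀⁻¹ • covHess h₁ w (c₁.y p)) ∧
      σ₁ (c₁.y p) = σ₂ (c₂.y p) := by
  have J := transitionJets hB₁.mem_atlas hB₂.mem_atlas A₁ A₂ (w := fun v => -w v) fun p hp => by
    rw [A₁.y_eq p hp.1]
    have h0 : c₂.u (S.refSection p) = c₁.u (S.refSection p) + w (c₁.y p) :=
      hu (S.refSection p) hp
    linarith
  rw [image_boundary_eq J.mem J.sub_left] at hw
  have hq : (p : M) ∈ φ₁.source ∩ φ₂.source ∩ Bdry n M := ⟨hp, p.2⟩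
  obtain ⟨e1, e2, e3⟩ := J.transformation hB₂ hB₁ S.ghat_symm hw.neg hq
  -- Near the point, the change of boundary coordinates is the boundary restriction of the
  -- transition map of the charts.
  have hjac : jacobian (fun v => c₂.y (c₁.y.symm v)) (c₁.y p) =
      jacobian (fun v => yOf φ₂ (coInv φ₁ (pair 0 v))) (yOf φ₁ p) := by
    rw [← A₁.y_eq p hp.1]
    ext γ α
    refine pd_congr α ((J.nhds_pair (J.yOf_mem hq)).mono fun v hv => ?_)
    have hm := coInv_mem hv
    have e4 : c₁.y ⟨_, coInv_pair_mem_Bdry J.mem hv⟩ = v := by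
      rw [← A₁.y_eq ⟨_, coInv_pair_mem_Bdry J.mem hv⟩ hm.1, yOf_coInv_pair le_rfl hv]
    have e5 := c₁.y.left_inv (A₁.mem_source ⟨_, coInv_pair_mem_Bdry J.mem hv⟩ hm.1)
    rw [e4] at e5
    simp only
    rw [e5, ← A₂.y_eq ⟨_, coInv_pair_mem_Bdry J.mem hv⟩ hm.2]
  rw [pullMetric_eq, J.theta_yOf hq] at e1 e2
  rw [J.theta_yOf hq] at e3
  rw [hjac, ← A₁.y_eq p hp.1, ← A₂.y_eq p hp.2]
  refine ⟨e1, ?_, e3⟩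
  rw [e2, covHess_neg]
  module

end AsymptoticSpacetime

/-! ### Change of a chart by a local diffeomorphism of the half space -/

section InverseFunction

/-- The inverse function theorem, with an inverse that is smooth on an open set. -/
lemma exists_smooth_local_inverse {F : Type*} [NormedAddCommGroup F] [NormedSpace ℝ F]
    [CompleteSpace F] {T : F → F} {U : Set F} {z : F} (hU : IsOpen U) (hT : ContDiffOn ℝ ∞ T U)
    (hz : z ∈ U) (L : F ≃L[ℝ] F) (hL : HasFDerivAt T (L : F →L[ℝ] F) z) :
    ∃ e : OpenPartialHomeomorph F F, z ∈ e.source ∧ e.source ⊆ U ∧ (∀ x, e x = T x) ∧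
      ContDiffOn ℝ ∞ e.symm e.target := by
  have hTz := hT.contDiffAt (hU.mem_nhds hz)
  -- Restricting to the open set where the derivative is invertible makes the inverse smooth on the
  -- whole target, not only at the image of `z`.
  set V : Set F := U ∩ fderiv ℝ T ⁻¹' range ((↑) : (F ≃L[ℝ] F) → F →L[ℝ] F) with hV
  have hVo : IsOpen V :=
    (hT.continuousOn_fderiv_of_isOpen hU (by simp)).isOpen_inter_preimage hU
      ContinuousLinearEquiv.isOpen
  set e₀ := hTz.toOpenPartialHomeomorph T hL (by simp) with he₀
  refine ⟨e₀.restrOpen V hVo, ?_, fun x hx => ?_, fun x => rfl, fun x hx => ?_⟩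
  · rw [OpenPartialHomeomorph.restrOpen_source]
    exact ⟨hTz.mem_toOpenPartialHomeomorph_source hL (by simp), hz, L, hL.fderiv.symm⟩
  · rw [OpenPartialHomeomorph.restrOpen_source] at hx
    exact hx.2.1
  · have hs := (e₀.restrOpen V hVo).map_target hx
    rw [OpenPartialHomeomorph.restrOpen_source] at hs
    obtain ⟨L', hL'⟩ := hs.2.2
    have hd := hT.contDiffAt (hU.mem_nhds hs.2.1)
    refine ((e₀.restrOpen V hVo).contDiffAt_symm (f₀' := L') hx ?_ hd).contDiffWithinAt
    rw [hL']
    exact (hd.differentiableAt (by simp)).hasFDerivAt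

end InverseFunction

/-! ### From local diffeomorphisms of the half space to charts of `M` -/

section HalfSpace

variable {n : ℕ}

lemma mem_HS_coe (w : EuclideanHalfSpace (n + 1)) : w.1 ∈ HS n := w.2

/-- A local diffeomorphism of `ℝⁿ⁺¹` that preserves the half space. -/
def restrictHalfSpace (e : OpenPartialHomeomorph (E (n + 1)) (E (n + 1)))
    (he : ∀ z ∈ e.source, (z ∈ HS n ↔ e z ∈ HS n)) :
    OpenPartialHomeomorph (EuclideanHalfSpace (n + 1)) (EuclideanHalfSpace (n + 1)) where
  toFun w := (𝓡∂ (n + 1)).symm (e w.1)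
  invFun w := (𝓡∂ (n + 1)).symm (e.symm w.1)
  source := Subtype.val ⁻¹' e.source
  target := Subtype.val ⁻¹' e.target
  map_source' w hw := by
    rw [mem_preimage, model_coe_symm ((he _ hw).1 (mem_HS_coe w))]
    exact e.map_source hw
  map_target' w hw := by
    have h : e.symm w.1 ∈ HS n := by
      rw [he _ (e.map_target hw), e.right_inv hw]; exact mem_HS_coe w
    rw [mem_preimage, model_coe_symm h]
    exact e.map_target hw
  left_inv' w hw := by
    rw [model_coe_symm ((he _ hw).1 (mem_HS_coe w)), e.left_inv hw, model_symm_coe]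
  right_inv' w hw := by
    have h : e.symm w.1 ∈ HS n := by
      rw [he _ (e.map_target hw), e.right_inv hw]; exact mem_HS_coe w
    rw [model_coe_symm h, e.right_inv hw, model_symm_coe]
  open_source := e.open_source.preimage continuous_subtype_val
  open_target := e.open_target.preimage continuous_subtype_val
  continuousOn_toFun := (𝓡∂ (n + 1)).continuous_symm.comp_continuousOn
    (e.continuousOn.comp continuous_subtype_val.continuousOn fun _ hw => hw)
  continuousOn_invFun := (𝓡∂ (n + 1)).continuous_symm.comp_continuousOn
    (e.symm.continuousOn.comp continuous_subtype_val.continuousOn fun _ hw => hw)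

lemma contMDiffOn_halfSpace {f : E (n + 1) → E (n + 1)} {s : Set (E (n + 1))}
    (hf : ContDiffOn ℝ ∞ f s) (hs : ∀ z ∈ s ∩ HS n, f z ∈ HS n) :
    ContMDiffOn (𝓡∂ (n + 1)) (𝓡∂ (n + 1)) ∞
      (fun w : EuclideanHalfSpace (n + 1) => (𝓡∂ (n + 1)).symm (f w.1)) (Subtype.val ⁻¹' s) := by
  refine (𝓡∂ (n + 1)).contMDiffOn_symm.comp (t := range (𝓡∂ (n + 1))) ?_ ?_
  · exact hf.contMDiffOn.comp ((𝓡∂ (n + 1)).contMDiff.contMDiffOn) fun w hw => hw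
  · intro w hw
    rw [← HS_eq_range]
    exact hs _ ⟨hw, mem_HS_coe w⟩

variable {M : Type*} [TopologicalSpace M] [ChartedSpace (EuclideanHalfSpace (n + 1)) M]
variable [IsManifold (𝓡∂ (n + 1)) ∞ M]

/-- Here `e` expresses old coordinates through new ones, the direction in which the jets are
prescribed; the new chart is therefore `φ` followed by the inverse of `e`. -/
lemma exists_chart_of_local_diffeomorphism
    {φ : OpenPartialHomeomorph M (EuclideanHalfSpace (n + 1))}
    (hφ : φ ∈ IsManifold.maximalAtlas (𝓡∂ (n + 1)) ∞ M)
    (e : OpenPartialHomeomorph (E (n + 1)) (E (n + 1))) (he : ContDiffOn ℝ ∞ e e.source)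
    (he' : ContDiffOn ℝ ∞ e.symm e.target) (heH : ∀ z ∈ e.source, (z ∈ HS n ↔ e z ∈ HS n)) :
    ∃ φ' : OpenPartialHomeomorph M (EuclideanHalfSpace (n + 1)),
      φ' ∈ IsManifold.maximalAtlas (𝓡∂ (n + 1)) ∞ M ∧ φ'.source ⊆ φ.source ∧
      (∀ x ∈ φ'.source, co φ' x ∈ e.source ∧ e (co φ' x) = co φ x) ∧
      ∀ x ∈ φ.source, co φ x ∈ e.target → x ∈ φ'.source := by
  have heH' : ∀ z ∈ e.target ∩ HS n, e.symm z ∈ HS n := fun z hz => by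
    rw [heH _ (e.map_target hz.1), e.right_inv hz.1]; exact hz.2
  set ψ := restrictHalfSpace e heH with hψ
  refine ⟨φ ≫ₕ ψ.symm, ?_, ?_, fun x hx => ?_, fun x hx h => ?_⟩
  · refine OpenPartialHomeomorph.mem_maximalAtlas_of_contMDiffOn _ ?_ ?_
    · refine (contMDiffOn_halfSpace he' heH').comp
        ((contMDiffOn_of_mem_maximalAtlas hφ).mono ?_) ?_
      · intro x hx
        rw [OpenPartialHomeomorph.trans_source] at hx
        exact hx.1
      · intro x hx
        rw [OpenPartialHomeomorph.trans_source] at hx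
        exact hx.2
    · refine (contMDiffOn_symm_of_mem_maximalAtlas hφ).comp
        ((contMDiffOn_halfSpace he fun z hz => (heH z hz.1).1 hz.2).mono ?_) ?_
      · intro x hx
        rw [OpenPartialHomeomorph.trans_target] at hx
        exact hx.1
      · intro x hx
        rw [OpenPartialHomeomorph.trans_target] at hx
        exact hx.2
  · intro x hx
    rw [OpenPartialHomeomorph.trans_source] at hx
    exact hx.1
  · rw [OpenPartialHomeomorph.trans_source] at hx
    have h1 : co φ x ∈ e.target := hx.2
    have h2 : co (φ ≫ₕ ψ.symm) x = e.symm (co φ x) := model_coe_symm (heH' _ ⟨h1, co_mem_HS⟩)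
    rw [h2]
    exact ⟨e.map_target h1, e.right_inv h1⟩
  · rw [OpenPartialHomeomorph.trans_source]
    exact ⟨hx, h⟩

end HalfSpace

/-! ### Polynomial transition maps -/

section Polynomial

variable {n : ℕ}

/-- A polynomial in the first coordinate with coefficients depending on the others. -/
def normalPoly (a₀ a₁ a₂ a₃ : E n → ℝ) (z : E (n + 1)) : ℝ :=
  a₀ (tl z) + a₁ (tl z) * z 0 + a₂ (tl z) * z 0 ^ 2 + a₃ (tl z) * z 0 ^ 3

/-- Only the restriction to a normal line matters, where a one-sided derivative on `[0, ∞)` is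
unique; no regularity of the coefficients in `y` is needed beyond that of `F`. -/
lemma dd_normalPoly {U : Set (E (n + 1))} {F : E (n + 1) → ℝ} {a₀ a₁ a₂ a₃ : E n → ℝ}
    (hU : IsOpen U) (hF : ContDiffOn ℝ ∞ F (U ∩ HS n))
    (h : EqOn F (normalPoly a₀ a₁ a₂ a₃) (U ∩ HS n)) :
    EqOn (dd 0 F) (normalPoly a₁ (fun v => 2 * a₂ v) (fun v => 3 * a₃ v) fun _ => 0)
      (U ∩ HS n) := by
  intro z hz
  obtain ⟨t, v, rfl⟩ : ∃ t v, z = pair t v := ⟨z 0, tl z, (pair_tl z).symm⟩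
  have ht : 0 ≤ t := hz.2
  have h1 := hasDerivWithinAt_pair (differentiableWithinAt_HS hF hU hz)
  have hc : Continuous fun s => pair s v := by
    rw [show (fun s => pair s v) = fun s =>
      s • (EuclideanSpace.single 0 1 : E (n + 1)) + pair 0 v from funext fun s => pair_eq s _]
    fun_prop
  have h2 : HasDerivWithinAt (fun s => normalPoly a₀ a₁ a₂ a₃ (pair s v))
      (dd 0 F (pair t v)) (Ici 0) t := by
    refine h1.congr_of_eventuallyEq ?_ (h hz).symm
    filter_upwards [nhdsWithin_le_nhds (hc.continuousAt.eventually_mem (hU.mem_nhds hz.1)),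
      self_mem_nhdsWithin] with s hs hs0
    exact (h ⟨hs, pair_mem_HS hs0 v⟩).symm
  have h3 : HasDerivAt (fun s => normalPoly a₀ a₁ a₂ a₃ (pair s v))
      (normalPoly a₁ (fun v => 2 * a₂ v) (fun v => 3 * a₃ v) (fun _ => 0) (pair t v)) t := by
    simp only [normalPoly, tl_pair, pair_zero]
    have := (((hasDerivAt_const t (a₀ v)).add ((hasDerivAt_id t).const_mul (a₁ v))).add
      (((hasDerivAt_id t).pow 2).const_mul (a₂ v))).add
      (((hasDerivAt_id t).pow 3).const_mul (a₃ v))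
    refine this.congr_deriv ?_
    simp only [id]
    push_cast
    ring
  exact (uniqueDiffOn_Ici (0 : ℝ) t ht).eq_deriv _ h2 h3.hasDerivWithinAt

lemma contDiffOn_normalPoly {W : Set (E n)} {a₀ a₁ a₂ a₃ : E n → ℝ} (h₀ : ContDiffOn ℝ ∞ a₀ W)
    (h₁ : ContDiffOn ℝ ∞ a₁ W) (h₂ : ContDiffOn ℝ ∞ a₂ W) (h₃ : ContDiffOn ℝ ∞ a₃ W) :
    ContDiffOn ℝ ∞ (normalPoly a₀ a₁ a₂ a₃) (tl ⁻¹' W) := by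
  have ht : ∀ {a : E n → ℝ}, ContDiffOn ℝ ∞ a W →
      ContDiffOn ℝ ∞ (fun z : E (n + 1) => a (tl z)) (tl ⁻¹' W) :=
    fun ha => ha.comp contDiff_tl.contDiffOn fun z hz => hz
  have h0 : ContDiffOn ℝ ∞ (fun z : E (n + 1) => z 0) (tl ⁻¹' W) := (contDiff_coord 0).contDiffOn
  exact (((ht h₀).add ((ht h₁).mul h0)).add ((ht h₂).mul (h0.pow 2))).add
    ((ht h₃).mul (h0.pow 3))

/-- The transition map with prescribed normal jets. -/
def polyMap (w c : E n → ℝ) (ψ : E n → E n) (b b' : Fin n → E n → ℝ) (z : E (n + 1)) : E (n + 1) :=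
  WithLp.toLp 2 (Fin.cons (normalPoly (fun _ => 0) (fun _ => 1) w c z)
    fun γ => normalPoly (fun v => ψ v γ) (b γ) (fun v => b' γ v / 2) (fun _ => 0) z)

variable {w c : E n → ℝ} {ψ : E n → E n} {b b' : Fin n → E n → ℝ} {W : Set (E n)} {z : E (n + 1)}

lemma polyMap_zero : polyMap w c ψ b b' z 0 = normalPoly (fun _ => 0) (fun _ => 1) w c z := rfl

lemma polyMap_succ (γ : Fin n) : polyMap w c ψ b b' z γ.succ =
    normalPoly (fun v => ψ v γ) (b γ) (fun v => b' γ v / 2) (fun _ => 0) z := rfl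

lemma polyMap_pair_zero (v : E n) : polyMap w c ψ b b' (pair 0 v) = pair 0 (ψ v) := by
  ext i
  refine Fin.cases ?_ (fun γ => ?_) i
  · simp [polyMap_zero, normalPoly]
  · simp [polyMap_succ, normalPoly]

lemma contDiffOn_polyMap (hw : ContDiffOn ℝ ∞ w W) (hc : ContDiffOn ℝ ∞ c W)
    (hψ : ∀ γ, ContDiffOn ℝ ∞ (fun v => ψ v γ) W) (hb : ∀ γ, ContDiffOn ℝ ∞ (b γ) W)
    (hb' : ∀ γ, ContDiffOn ℝ ∞ (b' γ) W) : ContDiffOn ℝ ∞ (polyMap w c ψ b b') (tl ⁻¹' W) := by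
  rw [contDiffOn_euclidean]
  intro i
  refine Fin.cases ?_ (fun γ => ?_) i
  · exact contDiffOn_normalPoly contDiffOn_const contDiffOn_const hw hc
  · exact contDiffOn_normalPoly (hψ γ) (hb γ) ((hb' γ).div_const 2) contDiffOn_const

lemma jacobian_mulVec {v : E n} (hψ : DifferentiableAt ℝ ψ v) (u : E n) (γ : Fin n) :
    (jacobian ψ v *ᵥ fun α => u α) γ = fderiv ℝ ψ v u γ := by
  have h1 : ∀ α : Fin n, pd α (fun y => ψ y γ) v =
      fderiv ℝ ψ v (EuclideanSpace.single α 1) γ := fun α => by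
    have : HasFDerivAt (fun y => ψ y γ) ((EuclideanSpace.proj (𝕜 := ℝ) γ).comp
        (fderiv ℝ ψ v)) v :=
      (EuclideanSpace.proj (𝕜 := ℝ) γ).hasFDerivAt.comp _ hψ.hasFDerivAt
    rw [pd, this.fderiv]
    rfl
  have h3 : u = ∑ α, u α • (EuclideanSpace.single α 1 : E n) := by
    ext b
    simp [Pi.single_apply]
  conv_rhs => rw [h3, map_sum]
  simp only [Matrix.mulVec, dotProduct, jacobian, Matrix.of_apply, h1, map_smul]
  simp [mul_comm]

/-- At a boundary point the derivative is block triangular: it preserves the first coordinate and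
acts on the boundary directions by the derivative of `ψ`. It is thus injective, and invertible by
finite dimension. -/
lemma exists_hasFDerivAt_polyMap {v : E n} (hW : IsOpen W) (hv : v ∈ W)
    (hw : ContDiffOn ℝ ∞ w W) (hc : ContDiffOn ℝ ∞ c W)
    (hψ : ∀ γ, ContDiffOn ℝ ∞ (fun v => ψ v γ) W) (hb : ∀ γ, ContDiffOn ℝ ∞ (b γ) W)
    (hb' : ∀ γ, ContDiffOn ℝ ∞ (b' γ) W) (hdet : (jacobian ψ v).det ≠ 0) :
    ∃ L : E (n + 1) ≃L[ℝ] E (n + 1),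
      HasFDerivAt (polyMap w c ψ b b') (L : E (n + 1) →L[ℝ] E (n + 1)) (pair 0 v) := by
  have hWo : IsOpen (tl ⁻¹' W : Set (E (n + 1))) :=
    hW.preimage (contDiff_tl (m := 0)).continuous
  have hvW : pair 0 v ∈ (tl ⁻¹' W : Set (E (n + 1))) := by rwa [mem_preimage, tl_pair]
  have hd := (((contDiffOn_polyMap hw hc hψ hb hb').contDiffAt (hWo.mem_nhds hvW)).differentiableAt
    (by simp)).hasFDerivAt
  set L := fderiv ℝ (polyMap w c ψ b b') (pair 0 v) with hL
  have hψd : DifferentiableAt ℝ ψ v := differentiableAt_euclidean.2 fun γ =>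
    ((hψ γ).contDiffAt (hW.mem_nhds hv)).differentiableAt (by simp)
  have h0 : ∀ u, L u 0 = u 0 := fun u => by
    have h1 : HasFDerivAt (fun z => polyMap w c ψ b b' z 0)
        ((EuclideanSpace.proj (𝕜 := ℝ) 0).comp L) (pair 0 v) :=
      (EuclideanSpace.proj (𝕜 := ℝ) (0 : Fin (n + 1))).hasFDerivAt.comp _ hd
    have h2 : ContDiffOn ℝ ∞ (normalPoly (fun _ => 1) w c fun _ => 0) (tl ⁻¹' W) :=
      contDiffOn_normalPoly contDiffOn_const hw hc contDiffOn_const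
    have h3 := ((h2.contDiffAt (hWo.mem_nhds hvW)).differentiableAt (by simp)).hasFDerivAt
    have h4 : HasFDerivAt (fun z : E (n + 1) => z 0) (EuclideanSpace.proj (𝕜 := ℝ) 0) (pair 0 v) :=
      (EuclideanSpace.proj (𝕜 := ℝ) (0 : Fin (n + 1))).hasFDerivAt
    have h5 := (h4.mul h3).congr_of_eventuallyEq (f₁ := fun z => polyMap w c ψ b b' z 0)
      (.of_forall fun z => by
        simp only [polyMap_zero, normalPoly, Pi.mul_apply]; ring)
    have h6 := congrArg (fun A : E (n + 1) →L[ℝ] ℝ => A u) (h1.unique h5)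
    simpa [normalPoly] using h6
  have h1 : ∀ u : E n, L (pair 0 u) = pair 0 (fderiv ℝ ψ v u) := fun u => by
    have h2 : HasFDerivAt (fun y => polyMap w c ψ b b' (pair 0 y)) (L.comp incL) v :=
      HasFDerivAt.comp (f := pair 0) v hd incL.hasFDerivAt
    have h3 : HasFDerivAt (fun y => polyMap w c ψ b b' (pair 0 y)) (incL.comp (fderiv ℝ ψ v)) v := by
      have : (fun y => polyMap w c ψ b b' (pair 0 y)) = fun y => incL (ψ y) :=
        funext fun y => polyMap_pair_zero y
      rw [this]
      exact incL.hasFDerivAt.comp v hψd.hasFDerivAt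
    exact congrArg (fun A : E n →L[ℝ] E (n + 1) => A u) (h2.unique h3)
  have hinj : Function.Injective L := by
    rw [injective_iff_map_eq_zero]
    intro u hu
    have hu0 : u 0 = 0 := by rw [← h0 u, hu]; rfl
    have hu1 : u = pair 0 (tl u) := by rw [← hu0, pair_tl]
    have h2 : fderiv ℝ ψ v (tl u) = 0 := by
      have := h1 (tl u)
      rw [← hu1, hu] at this
      ext γ
      have h3 := congrArg (fun z : E (n + 1) => z γ.succ) this
      simpa using h3.symm
    have h3 : (fun α => tl u α) = 0 := by
      refine Matrix.eq_zero_of_mulVec_eq_zero hdet (funext fun γ => ?_)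
      rw [jacobian_mulVec hψd, h2]
      rfl
    rw [hu1]
    ext i
    refine Fin.cases ?_ (fun γ => ?_) i
    · simp
    · simpa using congrFun h3 γ
  refine ⟨(LinearEquiv.ofInjectiveEndo (L : E (n + 1) →ₗ[ℝ] E (n + 1))
    hinj).toContinuousLinearEquiv, ?_⟩
  exact hd.congr_fderiv (ContinuousLinearMap.ext fun u => rfl)

/-- The local diffeomorphism of the half space with prescribed normal jets. -/
lemma exists_polyMap_diffeomorphism {v : E n} (hW : IsOpen W) (hv : v ∈ W)
    (hw : ContDiffOn ℝ ∞ w W) (hc : ContDiffOn ℝ ∞ c W)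
    (hψ : ∀ γ, ContDiffOn ℝ ∞ (fun v => ψ v γ) W) (hb : ∀ γ, ContDiffOn ℝ ∞ (b γ) W)
    (hb' : ∀ γ, ContDiffOn ℝ ∞ (b' γ) W) (hdet : (jacobian ψ v).det ≠ 0) :
    ∃ e : OpenPartialHomeomorph (E (n + 1)) (E (n + 1)), pair 0 v ∈ e.source ∧
      e.source ⊆ tl ⁻¹' W ∧ (∀ z, e z = polyMap w c ψ b b' z) ∧
      ContDiffOn ℝ ∞ e.symm e.target ∧ ∀ z ∈ e.source, (z ∈ HS n ↔ e z ∈ HS n) := by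
  obtain ⟨L, hL⟩ := exists_hasFDerivAt_polyMap hW hv hw hc hψ hb hb' hdet
  have hWo : IsOpen (tl ⁻¹' W : Set (E (n + 1))) :=
    hW.preimage (contDiff_tl (m := 0)).continuous
  have hvW : pair 0 v ∈ (tl ⁻¹' W : Set (E (n + 1))) := by rwa [mem_preimage, tl_pair]
  have h2 : ContDiffOn ℝ ∞ (normalPoly (fun _ => 1) w c fun _ => 0) (tl ⁻¹' W) :=
    contDiffOn_normalPoly contDiffOn_const hw hc contDiffOn_const
  -- The first component is `r (1 + w r + c r²)`; where the second factor is positive, the sign of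
  -- the first coordinate, and with it the half space, is preserved.
  set U := tl ⁻¹' W ∩ normalPoly (fun _ => 1) w c (fun _ => 0) ⁻¹' Ioi 0 with hU
  have hUo : IsOpen U := h2.continuousOn.isOpen_inter_preimage hWo isOpen_Ioi
  have hvU : pair 0 v ∈ U := ⟨hvW, by simp [normalPoly]⟩
  obtain ⟨e, h1, h2, h3, h4⟩ := exists_smooth_local_inverse hUo
    ((contDiffOn_polyMap hw hc hψ hb hb').mono inter_subset_left) hvU L hL
  refine ⟨e, h1, fun z hz => (h2 hz).1, h3, h4, fun z hz => ?_⟩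
  have h5 : 0 < normalPoly (fun _ => 1) w c (fun _ => 0) z := (h2 hz).2
  have h6 : e z 0 = z 0 * normalPoly (fun _ => 1) w c (fun _ => 0) z := by
    rw [h3, polyMap_zero]; simp only [normalPoly]; ring
  change 0 ≤ z 0 ↔ 0 ≤ e z 0
  rw [h6, mul_nonneg_iff_of_pos_right h5]

end Polynomial

/-! ### Solution of the equations for the normal jets -/

section Solve

variable {n : ℕ} {W : Set (E n)}

lemma contDiffOn_det {m : ℕ} {A : E n → Matrix (Fin m) (Fin m) ℝ}
    (hA : ∀ i j, ContDiffOn ℝ ∞ (fun v => A v i j) W) : ContDiffOn ℝ ∞ (fun v => (A v).det) W := by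
  simp only [Matrix.det_apply']
  exact ContDiffOn.sum fun s _ => contDiffOn_const.mul (contDiffOn_prod fun i _ => hA _ _)

/-- Cramer's rule: the entries are determinants divided by a nonvanishing determinant. -/
lemma contDiffOn_inv {m : ℕ} {A : E n → Matrix (Fin m) (Fin m) ℝ}
    (hA : ∀ i j, ContDiffOn ℝ ∞ (fun v => A v i j) W) (hdet : ∀ v ∈ W, (A v).det ≠ 0)
    (i j : Fin m) : ContDiffOn ℝ ∞ (fun v => (A v)⁻¹ i j) W := by
  simp only [Matrix.inv_def, Matrix.smul_apply, smul_eq_mul, Ring.inverse_eq_inv',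
    Matrix.adjugate_apply]
  refine ((contDiffOn_det hA).inv hdet).mul (contDiffOn_det fun k l => ?_)
  simp only [Matrix.updateRow_apply]
  split_ifs
  · exact contDiffOn_const
  · exact hA k l

variable {ψ : E n → E n} {V : Set (E n)}

lemma contDiffOn_comp_map {f : E n → ℝ} (hf : ContDiffOn ℝ ∞ f V)
    (hψ : ∀ γ, ContDiffOn ℝ ∞ (fun v => ψ v γ) W) (hV : MapsTo ψ W V) :
    ContDiffOn ℝ ∞ (fun v => f (ψ v)) W :=
  hf.comp (contDiffOn_euclidean.2 hψ) hV

/-- The linear equations for the normal jets have smooth solutions. -/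
lemma exists_contraction_eq {h : E n → Matrix (Fin n) (Fin n) ℝ} (hW : IsOpen W)
    (hψ : ∀ γ, ContDiffOn ℝ ∞ (fun v => ψ v γ) W)
    (hh : ∀ γ δ, ContDiffOn ℝ ∞ (fun v => h (ψ v) γ δ) W)
    (hdet : ∀ v ∈ W, (jacobian ψ v).det ≠ 0) (hdet' : ∀ v ∈ W, (h (ψ v)).det ≠ 0)
    {ξ : Fin n → E n → ℝ} (hξ : ∀ α, ContDiffOn ℝ ∞ (ξ α) W) :
    ∃ x : Fin n → E n → ℝ, (∀ γ, ContDiffOn ℝ ∞ (x γ) W) ∧ ∀ v ∈ W, ∀ α,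
      ∑ γ, ∑ δ, h (ψ v) γ δ * x γ v * pd α (fun u => ψ u δ) v = ξ α v := by
  set N : E n → Matrix (Fin n) (Fin n) ℝ := fun v => (jacobian ψ v)ᵀ * (h (ψ v))ᵀ with hN
  have hNs : ∀ i j, ContDiffOn ℝ ∞ (fun v => N v i j) W := fun i j => by
    simp only [hN, Matrix.mul_apply, Matrix.transpose_apply, jacobian, Matrix.of_apply]
    exact ContDiffOn.sum fun k _ => (contDiffOn_pd hW (hψ k) i).mul (hh j k)
  have hNd : ∀ v ∈ W, (N v).det ≠ 0 := fun v hv => by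
    rw [hN, Matrix.det_mul, Matrix.det_transpose, Matrix.det_transpose]
    exact mul_ne_zero (hdet v hv) (hdet' v hv)
  refine ⟨fun γ v => ((N v)⁻¹ *ᵥ fun α => ξ α v) γ, fun γ => ?_, fun v hv α => ?_⟩
  · simp only [Matrix.mulVec, dotProduct]
    exact ContDiffOn.sum fun α _ => (contDiffOn_inv hNs hNd γ α).mul (hξ α)
  · rw [contraction_eq (h (ψ v)) (fun γ => ((N v)⁻¹ *ᵥ fun α => ξ α v) γ)]
    change (N v *ᵥ ((N v)⁻¹ *ᵥ fun α => ξ α v)) α = ξ α v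
    rw [Matrix.mulVec_mulVec, Matrix.mul_nonsing_inv _ (isUnit_iff_ne_zero.2 (hNd v hv)),
      Matrix.one_mulVec]

variable {h k : E n → Matrix (Fin n) (Fin n) ℝ} {σ w : E n → ℝ} {b : Fin n → E n → ℝ}

lemma contDiffOn_pullMetric (hW : IsOpen W) (hV : MapsTo ψ W V)
    (hψ : ∀ γ, ContDiffOn ℝ ∞ (fun v => ψ v γ) W)
    (hh : ∀ γ δ, ContDiffOn ℝ ∞ (fun y => h y γ δ) V) (α β : Fin n) :
    ContDiffOn ℝ ∞ (fun v => pullMetric h ψ v α β) W := by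
  simp only [pullMetric, Matrix.of_apply]
  exact ContDiffOn.sum fun γ _ => ContDiffOn.sum fun δ _ =>
    ((contDiffOn_comp_map (hh γ δ) hψ hV).mul (contDiffOn_pd hW (hψ γ) α)).mul
      (contDiffOn_pd hW (hψ δ) β)

lemma contDiffOn_firstCoef (hVo : IsOpen V) (hV : MapsTo ψ W V)
    (hψ : ∀ γ, ContDiffOn ℝ ∞ (fun v => ψ v γ) W)
    (hh : ∀ γ δ, ContDiffOn ℝ ∞ (fun y => h y γ δ) V)
    (hk : ∀ γ δ, ContDiffOn ℝ ∞ (fun y => k y γ δ) V) (hσ : ContDiffOn ℝ ∞ σ V)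
    (hw : ContDiffOn ℝ ∞ w W) (hb : ∀ γ, ContDiffOn ℝ ∞ (b γ) W) (γ δ : Fin n) :
    ContDiffOn ℝ ∞ (firstCoef h k σ w ψ b γ δ) W := by
  have hc : ∀ {f : E n → ℝ}, ContDiffOn ℝ ∞ f V → ContDiffOn ℝ ∞ (fun v => f (ψ v)) W :=
    fun hf => contDiffOn_comp_map hf hψ hV
  exact (((ContDiffOn.sum fun ε _ => (hc (contDiffOn_pd hVo (hh γ δ) ε)).mul (hb ε)).add
    (hc (hk γ δ))).sub ((contDiffOn_const.mul (hc hσ)).mul (hc (hh γ δ)))).sub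
    ((contDiffOn_const.mul hw).mul (hc (hh γ δ)))

lemma contDiffOn_tangentialCoef (hW : IsOpen W) (hVo : IsOpen V) (hV : MapsTo ψ W V)
    (hψ : ∀ γ, ContDiffOn ℝ ∞ (fun v => ψ v γ) W)
    (hh : ∀ γ δ, ContDiffOn ℝ ∞ (fun y => h y γ δ) V)
    (hk : ∀ γ δ, ContDiffOn ℝ ∞ (fun y => k y γ δ) V) (hσ : ContDiffOn ℝ ∞ σ V)
    (hw : ContDiffOn ℝ ∞ w W) (hb : ∀ γ, ContDiffOn ℝ ∞ (b γ) W) (α β : Fin n) :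
    ContDiffOn ℝ ∞ (tangentialCoef h k σ w ψ b α β) W := by
  have hc : ∀ {f : E n → ℝ}, ContDiffOn ℝ ∞ f V → ContDiffOn ℝ ∞ (fun v => f (ψ v)) W :=
    fun hf => contDiffOn_comp_map hf hψ hV
  exact ContDiffOn.sum fun γ _ => ContDiffOn.sum fun δ _ =>
    ((((contDiffOn_firstCoef hVo hV hψ hh hk hσ hw hb γ δ).mul (contDiffOn_pd hW (hψ γ) α)).mul
      (contDiffOn_pd hW (hψ δ) β)).add
      (((hc (hh γ δ)).mul (contDiffOn_pd hW (hb γ) α)).mul (contDiffOn_pd hW (hψ δ) β))).add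
      (((hc (hh γ δ)).mul (contDiffOn_pd hW (hψ γ) α)).mul (contDiffOn_pd hW (hb δ) β))

/-- The jets of a transition map to a Beig–Schmidt chart. -/
lemma exists_normal_jets {ν : ℝ} (hν : ν ≠ 0) (hW : IsOpen W) (hVo : IsOpen V)
    (hV : MapsTo ψ W V) (hψ : ∀ γ, ContDiffOn ℝ ∞ (fun v => ψ v γ) W)
    (hh : ∀ γ δ, ContDiffOn ℝ ∞ (fun y => h y γ δ) V)
    (hk : ∀ γ δ, ContDiffOn ℝ ∞ (fun y => k y γ δ) V) (hσ : ContDiffOn ℝ ∞ σ V)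
    (hw : ContDiffOn ℝ ∞ w W) (hdet : ∀ v ∈ W, (jacobian ψ v).det ≠ 0)
    (hdet' : ∀ v ∈ W, (h (ψ v)).det ≠ 0) :
    ∃ (c : E n → ℝ) (b b' : Fin n → E n → ℝ), ContDiffOn ℝ ∞ c W ∧
      (∀ γ, ContDiffOn ℝ ∞ (b γ) W) ∧ (∀ γ, ContDiffOn ℝ ∞ (b' γ) W) ∧
      (∀ v ∈ W, radialCoef ν h σ w c ψ b v = 0) ∧
      (∀ v ∈ W, ∀ α, mixedCoefZero ν h w ψ b α v = 0) ∧
      ∀ v ∈ W, ∀ α, mixedCoefOne ν h k σ w c ψ b b' α v = 0 := by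
  have hcp : ∀ {f : E n → ℝ}, ContDiffOn ℝ ∞ f V → ContDiffOn ℝ ∞ (fun v => f (ψ v)) W :=
    fun hf => contDiffOn_comp_map hf hψ hV
  obtain ⟨b, hb, hb₀⟩ := exists_contraction_eq hW hψ (fun γ δ => hcp (hh γ δ)) hdet hdet'
    (ξ := fun α v => -(ν⁻¹ * pd α w v)) fun α => (contDiffOn_const.mul (contDiffOn_pd hW hw α)).neg
  -- The solution of `radialCoef = 0`, in which `c` has the factor `2 ν⁻¹`.
  set c : E n → ℝ := fun v => w v ^ 2 - w v * σ (ψ v) - (∑ ε, pd ε σ (ψ v) * b ε v) -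
    ν / 2 * ∑ γ, ∑ δ, h (ψ v) γ δ * b γ v * b δ v with hc
  have hcs : ContDiffOn ℝ ∞ c W :=
    (((hw.pow 2).sub (hw.mul (hcp hσ))).sub (ContDiffOn.sum fun ε _ =>
      (hcp (contDiffOn_pd hVo hσ ε)).mul (hb ε))).sub (contDiffOn_const.mul
      (ContDiffOn.sum fun γ _ => ContDiffOn.sum fun δ _ =>
        ((hcp (hh γ δ)).mul (hb γ)).mul (hb δ)))
  -- With `b` and `c` known, `b'` enters `mixedCoefOne` undifferentiated and through the same
  -- invertible contraction as `b`; everything else goes to the right-hand side.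
  obtain ⟨b', hb', hb₁⟩ := exists_contraction_eq hW hψ (fun γ δ => hcp (hh γ δ)) hdet hdet'
    (ξ := fun α v => -(ν⁻¹ * (pd α c v + (2 * σ (ψ v) - 2 * w v) * pd α w v) +
      ∑ γ, ∑ δ, (firstCoef h k σ w ψ b γ δ v * b γ v * pd α (fun u => ψ u δ) v +
        h (ψ v) γ δ * b γ v * pd α (b δ) v))) fun α =>
    ((contDiffOn_const.mul ((contDiffOn_pd hW hcs α).add (((contDiffOn_const.mul (hcp hσ)).sub
      (contDiffOn_const.mul hw)).mul (contDiffOn_pd hW hw α)))).add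
      (ContDiffOn.sum fun γ _ => ContDiffOn.sum fun δ _ =>
        (((contDiffOn_firstCoef hVo hV hψ hh hk hσ hw hb γ δ).mul (hb γ)).mul
          (contDiffOn_pd hW (hψ δ) α)).add
          (((hcp (hh γ δ)).mul (hb γ)).mul (contDiffOn_pd hW (hb δ) α)))).neg
  refine ⟨c, b, b', hcs, hb, hb', fun v _ => ?_, fun v hv α => ?_, fun v hv α => ?_⟩
  · simp only [radialCoef, hc]
    field_simp
    ring
  · rw [mixedCoefZero, hb₀ v hv α]
    ring
  · have h1 := hb₁ v hv α
    simp only [mixedCoefOne, Finset.sum_add_distrib] at h1 ⊢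
    linarith

end Solve

/-! ### Existence of adapted charts -/

section ChangeOfChart

variable {n : ℕ} {M : Type*} [TopologicalSpace M] [ChartedSpace (EuclideanHalfSpace (n + 1)) M]
variable [IsManifold (𝓡∂ (n + 1)) ∞ M]
variable {φ φ' : OpenPartialHomeomorph M (EuclideanHalfSpace (n + 1))}
variable {w c : E n → ℝ} {ψ : E n → E n} {b b' : Fin n → E n → ℝ}

lemma transitionJets_of_polyMap (hφ : φ ∈ IsManifold.maximalAtlas (𝓡∂ (n + 1)) ∞ M)
    (hφ' : φ' ∈ IsManifold.maximalAtlas (𝓡∂ (n + 1)) ∞ M) (hsub : φ.source ⊆ φ'.source)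
    (h : ∀ x ∈ φ.source, co φ' x = polyMap w c ψ b b' (co φ x)) :
    TransitionJets φ φ' φ.source w c ψ b b' := by
  have hU := isOpen_coordDom (φ := φ) φ.open_source
  have hs := contDiffOn_trans hφ hφ' hsub
  have ht : ∀ a, ∀ z ∈ coordDom φ φ.source ∩ HS n,
      trans φ φ' a z = polyMap w c ψ b b' z a := fun a z hz => by
    rw [trans, h _ (coInv_mem hz.1), co_coInv hz]
  have p0 : EqOn (trans φ φ' 0) (normalPoly (fun _ => 0) (fun _ => 1) w c)
    (coordDom φ φ.source ∩ HS n) := ht 0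
  have p1 := dd_normalPoly hU (hs 0) p0
  have p2 := dd_normalPoly hU (contDiffOn_dd (hs 0) hU 0) p1
  have p3 := dd_normalPoly hU (contDiffOn_dd (contDiffOn_dd (hs 0) hU 0) hU 0) p2
  have y0 : ∀ γ : Fin n, EqOn (trans φ φ' γ.succ)
    (normalPoly (fun v => ψ v γ) (b γ) (fun v => b' γ v / 2) (fun _ => 0))
    (coordDom φ φ.source ∩ HS n) := fun γ => ht γ.succ
  have y1 := fun γ : Fin n => dd_normalPoly hU (hs γ.succ) (y0 γ)
  have y2 := fun γ : Fin n => dd_normalPoly hU (contDiffOn_dd (hs γ.succ) hU 0) (y1 γ)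
  have hm : ∀ {v}, pair 0 v ∈ coordDom φ φ.source → pair 0 v ∈ coordDom φ φ.source ∩ HS n :=
    fun {v} hv => ⟨hv, pair_mem_HS le_rfl v⟩
  refine ⟨hφ, hφ', φ.open_source, fun x hx => ⟨hx, hsub hx⟩, fun v hv => ?_, fun v hv => ?_,
    fun v hv => ?_, fun v hv γ => ?_, fun v hv γ => ?_, fun v hv γ => ?_⟩
  · rw [p1 (hm hv)]; simp [normalPoly]
  · rw [p2 (hm hv)]; simp [normalPoly]
  · rw [p3 (hm hv)]; simp [normalPoly]; ring
  · rw [y0 γ (hm hv)]; simp [normalPoly]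
  · rw [y1 γ (hm hv)]; simp [normalPoly]
  · rw [y2 γ (hm hv)]; simp [normalPoly]; ring

end ChangeOfChart

namespace AsymptoticSpacetime

/-! ### Construction of an adapted chart from the reference chart -/

section Existence

variable {n : ℕ} {M : Type*} [TopologicalSpace M] [ChartedSpace (EuclideanHalfSpace (n + 1)) M]
variable [IsManifold (𝓡∂ (n + 1)) ∞ M] {S : AsymptoticSpacetime n M} (c : S.SpiCoord)
variable {φ φ' : OpenPartialHomeomorph M (EuclideanHalfSpace (n + 1))}

/-- The values of `y` at the boundary points in the domain of a chart. -/
def coordOverlap (φ : OpenPartialHomeomorph M (EuclideanHalfSpace (n + 1))) : Set (E n) :=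
  c.y.target ∩ (fun v => (c.y.symm v : M)) ⁻¹' φ.source

lemma isOpen_coordOverlap : IsOpen (coordOverlap c φ) :=
  (continuous_subtype_val.comp_continuousOn c.y.symm.continuousOn).isOpen_inter_preimage
    c.y.open_target φ.open_source

lemma contDiffOn_coordChange (hφ : φ ∈ IsManifold.maximalAtlas (𝓡∂ (n + 1)) ∞ M) (γ : Fin n) :
    ContDiffOn ℝ ∞ (fun v => yOf φ (c.y.symm v : M) γ) (coordOverlap c φ) := by
  have h := (contMDiffOn_yOf hφ).comp (c.y_symm_smooth.mono inter_subset_left)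
    fun v (hv : v ∈ coordOverlap c φ) => hv.2
  exact (contDiff_coord γ).comp_contDiffOn h.contDiffOn

lemma mapsTo_coordChange :
    MapsTo (fun v => yOf φ (c.y.symm v : M)) (coordOverlap c φ) (bdryImage φ) :=
  fun v hv => yOf_mem_bdryImage ⟨hv.2, (c.y.symm v).2⟩

/-- A local extension `Y` of the boundary coordinates to `M` gives a differentiable left inverse of
the coordinate change, so the chain rule yields a left inverse of the Jacobian. -/
lemma det_coordChange_ne_zero (hφ : φ ∈ IsManifold.maximalAtlas (𝓡∂ (n + 1)) ∞ M) {v : E n}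
    (hv : v ∈ coordOverlap c φ) : (jacobian (fun v => yOf φ (c.y.symm v : M)) v).det ≠ 0 := by
  set ψ : E n → E n := fun v => yOf φ (c.y.symm v : M) with hψ
  have hco : ∀ u ∈ coordOverlap c φ, co φ (c.y.symm u : M) = pair 0 (ψ u) := fun u hu =>
    co_boundary hφ ⟨hu.2, (c.y.symm u).2⟩
  have hdψ : ∀ γ, DifferentiableAt ℝ (fun u => ψ u γ) v := fun γ =>
    ((contDiffOn_coordChange c hφ γ).contDiffAt
      ((isOpen_coordOverlap c).mem_nhds hv)).differentiableAt (by simp)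
  obtain ⟨Y, hY, hYe⟩ := c.y_smooth _ (c.y.map_target hv.1)
  have hG : DifferentiableAt ℝ (fun u => Y (coInv φ (pair 0 u))) (ψ v) := by
    have h1 := differentiableWithinAt_comp_coInv hφ hv.2 hY
    rw [hco v hv] at h1
    have h2 := h1.comp (ψ v) (incL.differentiableAt.differentiableWithinAt (s := univ))
      fun u _ => pair_mem_HS le_rfl u
    exact differentiableWithinAt_univ.1 h2
  have hinv : ∀ᶠ u in 𝓝 v, Y (coInv φ (pair 0 (ψ u))) = u := by
    have h1 : ContinuousAt (fun u => (c.y.symm u : M)) v :=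
      continuous_subtype_val.continuousAt.comp (c.y.continuousAt_symm hv.1)
    filter_upwards [(isOpen_coordOverlap c).mem_nhds hv, h1.eventually hYe] with u hu hu'
    rw [← hco u hu, coInv_co hu.2, hu' (c.y.symm u).2]
    exact c.y.right_inv hu.1
  refine (Matrix.isUnit_det_of_left_inverse
    (B := jacobian (fun u => Y (coInv φ (pair 0 u))) (ψ v)) ?_).ne_zero
  ext δ α
  have h1 := pd_comp (f := fun u => Y (coInv φ (pair 0 u)) δ) α
    ((differentiableAt_euclidean.1 hG) δ) hdψ
  have h2 : pd α (fun u => Y (coInv φ (pair 0 (ψ u))) δ) v = pd α (fun u : E n => u δ) v :=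
    pd_congr α (hinv.mono fun u hu => congrArg (fun z : E n => z δ) hu)
  have h3 : pd α (fun u : E n => u δ) v = (1 : Matrix (Fin n) (Fin n) ℝ) δ α := by
    have : HasFDerivAt (fun u : E n => u δ) (EuclideanSpace.proj (𝕜 := ℝ) δ) v :=
      (EuclideanSpace.proj (𝕜 := ℝ) δ).hasFDerivAt
    rw [pd, this.fderiv]
    simp [Matrix.one_apply]
  rw [← h3, ← h2, h1, Matrix.mul_apply]
  exact Finset.sum_congr rfl fun ε _ => by
    simp only [jacobian, Matrix.of_apply]; ring

/-- A sufficient condition for a chart to be adapted. -/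
lemma isAdapted_of_polyMap {cc : E n → ℝ} {b b' : Fin n → E n → ℝ}
    (hφ : φ ∈ IsManifold.maximalAtlas (𝓡∂ (n + 1)) ∞ M)
    (hφ' : φ' ∈ IsManifold.maximalAtlas (𝓡∂ (n + 1)) ∞ M) (hsub : φ'.source ⊆ φ.source)
    (hρ : ∀ x ∈ φ.source, rhoOf φ x = S.ρ x) (hcc : ContinuousOn cc (coordOverlap c φ))
    (hmem : ∀ x ∈ φ'.source, yOf φ' x ∈ coordOverlap c φ)
    (h : ∀ x ∈ φ'.source, co φ x = polyMap (fun v => c.u (S.refSection (c.y.symm v))) cc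
      (fun v => yOf φ (c.y.symm v : M)) b b' (co φ' x)) : IsAdapted c φ' := by
  -- On the boundary the polynomial map reduces to `ψ`, so both points have the same coordinates in
  -- `φ`, which is injective on its source.
  have hpt : ∀ p : Bdry n M, (p : M) ∈ φ'.source → p = c.y.symm (yOf φ' p) := fun p hp => by
    have hv := hmem p hp
    have h1 := h p hp
    rw [co_boundary hφ' ⟨hp, p.2⟩, polyMap_pair_zero,
      ← co_boundary hφ ⟨hv.2, (c.y.symm _).2⟩] at h1
    exact Subtype.ext ((coInv_co (hsub hp)).symm.trans
      ((congrArg (coInv φ) h1).trans (coInv_co hv.2)))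
  have hsrc : ∀ p : Bdry n M, (p : M) ∈ φ'.source → p ∈ c.y.source := fun p hp => by
    rw [hpt p hp]
    exact c.y.map_target (hmem p hp).1
  have hy : ∀ p : Bdry n M, (p : M) ∈ φ'.source → yOf φ' p = c.y p := fun p hp => by
    conv_rhs => rw [hpt p hp, c.y.right_inv (hmem p hp).1]
  refine ⟨hsrc, hy, fun p hp => ?_⟩
  refine ⟨(S.refSection p).act (-c.u (S.refSection p)), rfl, ?_, contMDiffAt_rhoOf hφ' hp, ?_⟩
  · rw [c.u_act _ _ (hsrc p hp), add_neg_cancel]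
  · set s := c.u (S.refSection p) with hs
    change S.jetρ p + (-s) • S.jetρsq p = jet2 (p : M) (rhoOf φ') _
    have hv : (⟨S.ρ, S.ρ_smooth p⟩ + (-s) •
        ⟨fun x => S.ρ x ^ 2, ContMDiffAt.pow (S.ρ_smooth p) 2⟩ : SmoothAt n (p : M)) -
        ⟨rhoOf φ', contMDiffAt_rhoOf hφ' hp⟩ ∈ VanishToSecondOrder (n := n) (p : M) := by
      rw [mem_vanishToSecondOrder_iff hφ' hp]
      set w : E n → ℝ := fun v => c.u (S.refSection (c.y.symm v)) with hw
      -- With `r` the new first coordinate, `ρ - s ρ² - r = r² f`. Since `f` is continuous and `f p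
      -- = w - s = 0`, the difference vanishes to second order.
      set f : M → ℝ := fun x => w (yOf φ' x) + cc (yOf φ' x) * rhoOf φ' x - s *
        (1 + w (yOf φ' x) * rhoOf φ' x + cc (yOf φ' x) * rhoOf φ' x ^ 2) ^ 2 with hf
      have hW := (isOpen_coordOverlap c (φ := φ)).mem_nhds (hmem p hp)
      have hr0 : rhoOf φ' (p : M) = 0 := (mem_Bdry_iff hφ' hp).1 p.2
      have hcw : ContinuousAt (fun x => w (yOf φ' x)) (p : M) :=
        ContinuousAt.comp (f := yOf φ') (((c.u_smooth.continuousOn).mono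
          (inter_subset_left (t := _ ⁻¹' φ.source))).continuousAt hW) (continuousAt_yOf hp)
      have hcc' : ContinuousAt (fun x => cc (yOf φ' x)) (p : M) :=
        ContinuousAt.comp (f := yOf φ') (hcc.continuousAt hW) (continuousAt_yOf hp)
      have hcr := continuousAt_rhoOf hp
      have hfc : ContinuousAt f (p : M) :=
        (hcw.add (hcc'.mul hcr)).sub (continuousAt_const.mul
          (((continuousAt_const.add (hcw.mul hcr)).add (hcc'.mul (hcr.pow 2))).pow 2))
      have hf0 : f p = 0 := by
        have : w (yOf φ' p) = s := by
          rw [hw, hs]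
          simp only
          rw [← hpt p hp]
        simp [hf, hr0, this]
      have hfo : f =o[𝓝 (p : M)] fun _ => (1 : ℝ) := by
        rw [isLittleO_one_iff, ← hf0]; exact hfc.tendsto
      have hr : rhoOf φ' =O[𝓝 (p : M)] fun x => ‖co φ' x - co φ' p‖ := by
        refine IsBigO.of_bound 1 (.of_forall fun x => ?_)
        have h1 := EuclideanSpace.norm_eq (co φ' x - co φ' (p : M))
        have h2 : rhoOf φ' x = (co φ' x - co φ' (p : M)) 0 := by
          have : (co φ' x - co φ' (p : M)) 0 = rhoOf φ' x - rhoOf φ' (p : M) := rfl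
          rw [this, hr0, sub_zero]
        rw [h2, norm_norm, one_mul]
        exact PiLp.norm_apply_le _ _
      have key := (hr.pow 2).mul_isLittleO hfo
      refine key.congr' ?_ (.of_forall fun x => mul_one _)
      filter_upwards [φ'.open_source.mem_nhds hp] with x hx
      have h1 := congrArg (fun z : E (n + 1) => z 0) (h x hx)
      have h2 : S.ρ x = rhoOf φ' x + w (yOf φ' x) * rhoOf φ' x ^ 2 +
          cc (yOf φ' x) * rhoOf φ' x ^ 3 := by
        rw [← hρ x (hsub hx), ← co_zero]
        refine h1.trans ?_
        rw [polyMap_zero]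
        simp only [normalPoly, tl_co, co_zero]
        ring
      change _ = S.ρ x + (-s) * S.ρ x ^ 2 - rhoOf φ' x
      rw [h2, hf]
      ring
    exact (Submodule.Quotient.eq _).2 hv

/-- There are adapted Beig–Schmidt charts. -/
theorem exists_isAdapted (q : Bdry n M) (hq : q ∈ c.y.source) :
    ∃ φ h k σ, IsBeigSchmidt S.ghat S.ν₀ φ h k σ ∧ IsAdapted c φ ∧ (q : M) ∈ φ.source := by
  obtain ⟨φ, h, k, σ, hB, hqφ, hρ⟩ := S.exists_chart q q.2
  have hφ := hB.mem_atlas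
  set W := coordOverlap c φ with hWdef
  set ψ : E n → E n := fun v => yOf φ (c.y.symm v : M) with hψdef
  -- The zero section of `u` is `j²ρ - u(j²ρ) j²ρ²`, so the new coordinate must be `r = ρ - w ρ² +
  -- …`, that is `ρ = r + w r² + …`.
  set w : E n → ℝ := fun v => c.u (S.refSection (c.y.symm v)) with hwdef
  have hW : IsOpen W := isOpen_coordOverlap c
  have hvW : c.y q ∈ W := ⟨c.y.map_source hq, by
    rw [mem_preimage, c.y.left_inv hq]; exact hqφ⟩
  have hV := mapsTo_coordChange c (φ := φ)
  have hψ := contDiffOn_coordChange c hφ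
  have hw : ContDiffOn ℝ ∞ w W := c.u_smooth.mono inter_subset_left
  have hdet := fun v (hv : v ∈ W) => det_coordChange_ne_zero c hφ hv
  obtain ⟨cc, b, b', hcc, hb, hb', h1, h2, h3⟩ := exists_normal_jets
    (hB.ne_zero (hV hvW)) hW (isOpen_bdryImage hφ) hV hψ hB.smooth_h hB.smooth_k hB.smooth_σ hw
    hdet fun v hv => hB.det_ne_zero (hV hv)
  obtain ⟨e, he1, he2, he3, he4, he5⟩ := exists_polyMap_diffeomorphism hW hvW hw hcc hψ hb hb'
    (hdet _ hvW)
  have hes : ContDiffOn ℝ ∞ e e.source :=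
    ((contDiffOn_polyMap hw hcc hψ hb hb').mono he2).congr fun z _ => he3 z
  obtain ⟨φ', hφ', hsub, hco, hmem⟩ := exists_chart_of_local_diffeomorphism hφ e hes he4 he5
  have hpoly : ∀ x ∈ φ'.source, co φ x = polyMap w cc ψ b b' (co φ' x) := fun x hx => by
    rw [← he3, (hco x hx).2]
  have hyW : ∀ x ∈ φ'.source, yOf φ' x ∈ W := fun x hx => he2 (hco x hx).1
  have hsubW : bdryImage φ' ⊆ W := by
    rintro _ ⟨x, hx, rfl⟩
    exact hyW x hx.1
  have J := transitionJets_of_polyMap hφ' hφ hsub hpoly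
  refine ⟨φ', _, _, _, J.isBeigSchmidt hB S.ghat_symm rfl
    (fun α β => (contDiffOn_pullMetric hW hV hψ hB.smooth_h α β).mono hsubW)
    (fun α β => (contDiffOn_tangentialCoef hW (isOpen_bdryImage hφ) hV hψ hB.smooth_h hB.smooth_k
      hB.smooth_σ hw hb α β).mono hsubW)
    ((contDiffOn_comp_map hB.smooth_σ hψ hV).mono hsubW) (fun v hv => ?_)
    (fun v hv => h1 v (hsubW hv)) (fun v hv => h2 v (hsubW hv)) (fun v hv => h3 v (hsubW hv)),
    isAdapted_of_polyMap c hφ hφ' hsub hρ hcc.continuousOn hyW hpoly, hmem _ hqφ ?_⟩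
  · have hJ := isUnit_iff_ne_zero.2 (hdet v (hsubW hv))
    rw [pullMetric_eq]
    rcases hB.signature _ (hV (hsubW hv)) with h | h
    · exact Or.inl ⟨h.1, h.2.congruence hJ⟩
    · exact Or.inr ⟨h.1, posDef_congruence h.2 hJ⟩
  · have h4 : e (pair 0 (c.y q)) = co φ q := by
      rw [he3, polyMap_pair_zero, c.y.left_inv hq, co_boundary hφ ⟨hqφ, q.2⟩]
    rw [← h4]
    exact e.map_source he1

end Existence

end AsymptoticSpacetime

end ExtendedBoundary

end

theorem mainTheorem12 {n : ℕ} {M : Type*} [TopologicalSpace M] [T2Space M]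
    [SecondCountableTopology M] [ChartedSpace (EuclideanHalfSpace (n + 1)) M]
    [IsManifold (𝓡∂ (n + 1)) ∞ M] (S : ExtendedBoundary.AsymptoticSpacetime n M) :
    -- every coordinate system on `Spi` defines a Beig–Schmidt chart near each point of its domain
    (∀ (c : S.SpiCoord) (q : ExtendedBoundary.Bdry n M), q ∈ c.y.source →
      ∃ φ h k σ, ExtendedBoundary.IsBeigSchmidt S.ghat S.ν₀ φ h k σ ∧
        ExtendedBoundary.AsymptoticSpacetime.IsAdapted c φ ∧ (q : M) ∈ φ.source) ∧
    -- this chart is unique up to third order in `ρ`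
    (∀ (c : S.SpiCoord) (φ φ' : OpenPartialHomeomorph M (EuclideanHalfSpace (n + 1)))
      (h k h' k' : ExtendedBoundary.E n → Matrix (Fin n) (Fin n) ℝ)
      (σ σ' : ExtendedBoundary.E n → ℝ),
      ExtendedBoundary.IsBeigSchmidt S.ghat S.ν₀ φ h k σ →
      ExtendedBoundary.IsBeigSchmidt S.ghat S.ν₀ φ' h' k' σ' →
      ExtendedBoundary.AsymptoticSpacetime.IsAdapted c φ →
      ExtendedBoundary.AsymptoticSpacetime.IsAdapted c φ' →
      ∀ q ∈ φ.source ∩ φ'.source ∩ ExtendedBoundary.Bdry n M,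
        ((fun x => ExtendedBoundary.rhoOf φ' x - ExtendedBoundary.rhoOf φ x)
          =O[𝓝 q] fun x => ExtendedBoundary.rhoOf φ x ^ 3) ∧
        ((fun x => ExtendedBoundary.yOf φ' x - ExtendedBoundary.yOf φ x)
          =O[𝓝 q] fun x => ExtendedBoundary.rhoOf φ x ^ 3)) ∧
    -- change of coordinate system
    (∀ (c₁ c₂ : S.SpiCoord) (φ₁ φ₂ : OpenPartialHomeomorph M (EuclideanHalfSpace (n + 1)))
      (h₁ k₁ h₂ k₂ : ExtendedBoundary.E n → Matrix (Fin n) (Fin n) ℝ)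
      (σ₁ σ₂ w : ExtendedBoundary.E n → ℝ),
      ExtendedBoundary.IsBeigSchmidt S.ghat S.ν₀ φ₁ h₁ k₁ σ₁ →
      ExtendedBoundary.IsBeigSchmidt S.ghat S.ν₀ φ₂ h₂ k₂ σ₂ →
      ExtendedBoundary.AsymptoticSpacetime.IsAdapted c₁ φ₁ →
      ExtendedBoundary.AsymptoticSpacetime.IsAdapted c₂ φ₂ →
      ContDiffOn ℝ ∞ w (ExtendedBoundary.yOf φ₁ ''
        (φ₁.source ∩ φ₂.source ∩ ExtendedBoundary.Bdry n M)) →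
      -- `u₂ = u₁ + w` if and only if `ρ₂ = ρ₁ - w ρ₁² + O(ρ₁³)`
      ((∀ z : S.Spi, z.pt ∈ φ₁.source ∩ φ₂.source →
          c₂.u z = c₁.u z + w (c₁.y ⟨z.pt, z.pt_mem⟩)) ↔
        ∀ q ∈ φ₁.source ∩ φ₂.source ∩ ExtendedBoundary.Bdry n M,
          (fun x => ExtendedBoundary.rhoOf φ₂ x - (ExtendedBoundary.rhoOf φ₁ x -
            w (ExtendedBoundary.yOf φ₁ x) * ExtendedBoundary.rhoOf φ₁ x ^ 2))
          =O[𝓝 q] fun x => ExtendedBoundary.rhoOf φ₁ x ^ 3) ∧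
      -- and in this case the coefficients are related as follows
      ((∀ z : S.Spi, z.pt ∈ φ₁.source ∩ φ₂.source →
          c₂.u z = c₁.u z + w (c₁.y ⟨z.pt, z.pt_mem⟩)) →
        ∀ p : ExtendedBoundary.Bdry n M, (p : M) ∈ φ₁.source ∩ φ₂.source →
          ∀ J, J = ExtendedBoundary.jacobian (fun v => c₂.y (c₁.y.symm v)) (c₁.y p) →
            Jᵀ * h₂ (c₂.y p) * J = h₁ (c₁.y p) ∧
            Jᵀ * k₂ (c₂.y p) * J = k₁ (c₁.y p) -
              (2 : ℝ) • (w (c₁.y p) • h₁ (c₁.y p) +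
                S.ν₀⁻¹ • ExtendedBoundary.covHess h₁ w (c₁.y p)) ∧
            σ₁ (c₁.y p) = σ₂ (c₂.y p))) := by
  refine ⟨fun c q hq => ExtendedBoundary.AsymptoticSpacetime.exists_isAdapted c q hq,
    fun c φ φ' h k h' k' σ σ' hB hB' A A' q hq => A.unique hB hB' A' hq,
    fun c₁ c₂ φ₁ φ₂ h₁ k₁ h₂ k₂ σ₁ σ₂ w hB₁ hB₂ A₁ A₂ hw =>
      ⟨ExtendedBoundary.AsymptoticSpacetime.u_eq_iff hB₁.mem_atlas hB₂.mem_atlas A₁ A₂, ?_⟩⟩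
  rintro hu p hp J rfl
  exact ExtendedBoundary.AsymptoticSpacetime.change_of_coordinates hB₁ hB₂ A₁ A₂ hw hu p hp
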